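/- **Theorem.** *Exact Red-Blue Perfect $b$-Matching for Multigraphs* logspace many-one reduces to *Exact Perfect Matching*, and *Exact Red-Blue Perfect Bipartite $b$-Matching for Multigraphs* logspace many-one reduces to *Exact Perfect Bipartite Matching*. The problems are the following. - *Exact Perfect [Bipartite] Matching.* Given a [bipartite] finite simple graph $G=(V,E)$, a set $R\subseteq E$ of red edges, and an integer $k\ge 0$: does there exist a perfect matching of $G$ with exactly $k$ red edges, i.e., a set $E'\subseteq E$ with $|E'\cap R|=k$ such that each $v\in V$ is incident with exactly one edge in $E'$? - *Exact Red-Blue Perfect [Bipartite] $b$-Matching for Multigraphs.* Given a [bipartite] finite multigraph $G=(V,E)$ (parallel edges are allowed, loops are not), a capacity function $b:V\to\mathbb N=\{0,1,2,\dots\}$, disjoint sets $R\subseteq E$ of red and $B\subseteq E$ of blue edges, and integers $k,\ell\ge 0$: does there exist a set $E'\subseteq E$ with $|E'\cap R|=k$ and $|E'\cap B|=\ell$ such that each $v\in V$ is incident with exactly $b(v)$ edges in $E'$? Instances are encoded as strings over a finite alphabet that list all vertices (with their capacities) and all edges (each parallel edge separately, with its colour and its ends); all numbers ($b(v)$, $k$,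 $\ell$ and the names of the ends of edges) are written in binary. Each problem is identified with the language of the encodings of its yes-instances. A language $X$ logspace many-one reduces to a language $Y$ if there is a total function $f$ on strings, computable by a deterministic Turing machine with a read-only input tape, finitely many work tapes and a write-only output tape that visits only $O(\log |x|)$ cells of its work tapes on every input $x$ with $|x|\ge 2$ and only $O(1)$ cells when $|x|\le 1$, such that $x\in X$ if and only if $f(x)\in Y$, for every string $x$. -/

import Mathlib

/-! ### Logarithmic-space transducers -/

/-- What the input head of a machine can read: an end marker or a letter of the input. -/
inductive InputSymbol (α : Type) : Type where
  | leftEnd : InputSymbol α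
  | letter (a : α) : InputSymbol α
  | rightEnd : InputSymbol α

/-- Head movements. -/
inductive HeadMove : Type where
  | left : HeadMove
  | stay : HeadMove
  | right : HeadMove

/-- The new position of a head on a tape whose cells are numbered `0, 1, 2, …`;
a left move in cell `0` has no effect. -/
def HeadMove.apply : HeadMove → ℕ → ℕ
  | .left, p => p - 1
  | .stay, p => p
  | .right, p => p + 1

/-- A deterministic Turing machine with a two-way read-only input tape over `α`, finitely many
two-way read-write work tapes (indexed by `Tape`) over the finite alphabet `Γ`, and a one-way
write-only output tape over `β`. In one step the machine depends on the current state, the scanned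
input symbol and the scanned work symbols; it either halts (`none`) or changes its state, moves the
input head, writes to and moves on every work tape, and writes at most one output letter. -/
structure Transducer (α β : Type) where
  State : Type
  finite_state : Finite State
  Tape : Type
  finite_tape : Finite Tape
  Γ : Type
  finite_Γ : Finite Γ
  blank : Γ
  start : State
  trans : State → InputSymbol α → (Tape → Γ) →
    Option (State × HeadMove × (Tape → Γ × HeadMove) × Option β)

namespace Transducer

variable {α β : Type}

/-- Configurations of a machine (on a fixed input). -/
structure Config (M : Transducer α β) where
  state : M.State
  inputHead : ℕ
  work : M.Tape → ℕ → M.Γ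
  workHead : M.Tape → ℕ
  output : List β

/-- The input tape holds a left end marker in cell `0`, the input `x` in cells `1, …, |x|`, and a
right end marker in cell `|x| + 1`. -/
def readInput (x : List α) : ℕ → InputSymbol α
  | 0 => .leftEnd
  | i + 1 => match x[i]? with
    | some a => .letter a
    | none => .rightEnd

/-- At the start all work tapes are blank, the input head scans the left end marker, the work heads
scan cell `0`, and nothing has been written on the output tape. -/
def init (M : Transducer α β) : M.Config where
  state := M.start
  inputHead := 0
  work := fun _ _ => M.blank
  workHead := fun _ => 0
  output := []

/-- One computation step on input `x`; the input head never leaves the end markers. -/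
def step (M : Transducer α β) (x : List α) (c : M.Config) : Option M.Config :=
  match M.trans c.state (readInput x c.inputHead) (fun t => c.work t (c.workHead t)) with
  | none => none
  | some (q, d, w, o) => some
      { state := q
        inputHead := min (d.apply c.inputHead) (x.length + 1)
        work := fun t => Function.update (c.work t) (c.workHead t) (w t).1
        workHead := fun t => (w t).2.apply (c.workHead t)
        output := c.output ++ o.toList }

/-- On input `x` the machine halts, and then its output tape holds `y`. -/
def Outputs (M : Transducer α β) (x : List α) (y : List β) : Prop :=
  ∃ c : M.Config, StateTransition.Reaches (M.step x) M.init c ∧ M.step x c = none ∧ c.output = y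

/-- During the computation on input `x`, on every work tape only the first `s` cells are ever
visited. -/
def SpaceBoundedBy (M : Transducer α β) (x : List α) (s : ℕ) : Prop :=
  ∀ c : M.Config, StateTransition.Reaches (M.step x) M.init c → ∀ t, c.workHead t < s

end Transducer

/-- A string function is computable in logarithmic space. -/
def LogspaceComputable {α β : Type} [Finite α] [Finite β] (f : List α → List β) : Prop :=
  ∃ M : Transducer α β, (∀ x, M.Outputs x (f x)) ∧
    ∃ C : ℕ, ∀ x : List α, M.SpaceBoundedBy x (C * (Nat.log 2 x.length + 1))

/-- Logspace many-one reducibility between languages. -/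
def LogspaceManyOneReducible {α β : Type} [Finite α] [Finite β]
    (A : Language α) (B : Language β) : Prop :=
  ∃ f : List α → List β, LogspaceComputable f ∧ ∀ x, x ∈ A ↔ f x ∈ B

/-! ### Exact Perfect Matching -/

/-- An instance: a finite graph, a set of red edges, and a number `k`. -/
structure ExactPMInstance where
  n : ℕ
  G : SimpleGraph (Fin n)
  R : Finset (Sym2 (Fin n))
  R_subset : ∀ e ∈ R, e ∈ G.edgeSet
  k : ℕ

/-- There is a perfect matching with exactly `k` red edges. -/
def ExactPMInstance.IsYes (I : ExactPMInstance) : Prop :=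
  ∃ M : Finset (Sym2 (Fin I.n)), (∀ e ∈ M, e ∈ I.G.edgeSet) ∧
    (M ∩ I.R).card = I.k ∧ ∀ v, ∃! e, e ∈ M ∧ v ∈ e

/-! ### Exact Red-Blue Perfect b-Matching for Multigraphs -/

/-- An instance: a finite loopless multigraph (parallel edges are allowed) with vertices `Fin n`
and edges `Fin m`, a capacity function, disjoint sets of red and blue edges, and numbers
`k` and `l`. -/
structure ExactRedBlueInstance where
  n : ℕ
  m : ℕ
  G : Graph (Fin n) (Fin m)
  vertexSet_eq : G.vertexSet = Set.univ
  edgeSet_eq : G.edgeSet = Set.univ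
  loopless : G.Loopless
  b : Fin n → ℕ
  R : Finset (Fin m)
  B : Finset (Fin m)
  disjoint : Disjoint R B
  k : ℕ
  l : ℕ

/-- There is a perfect `b`-matching with exactly `k` red and exactly `l` blue edges. -/
def ExactRedBlueInstance.IsYes (I : ExactRedBlueInstance) : Prop :=
  ∃ M : Finset (Fin I.m), (M ∩ I.R).card = I.k ∧ (M ∩ I.B).card = I.l ∧
    ∀ v, {e | e ∈ M ∧ I.G.Inc e v}.ncard = I.b v

/-- A multigraph is bipartite if its vertices can be split into two parts such that every edge
joins a vertex of one part and a vertex of the other. -/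
def Graph.IsBipartite {V E : Type*} (G : Graph V E) : Prop :=
  ∃ side : V → Bool, ∀ e u v, G.IsLink e u v → side u ≠ side v

/-! ### Encoding of instances as strings -/

/-- The alphabet of the encodings. -/
inductive Letter : Type where
  | bit (d : Bool) : Letter
  | vertex : Letter
  | plain : Letter
  | red : Letter
  | blue : Letter
  | comma : Letter
  | target : Letter

instance : Finite Letter :=
  Finite.of_surjective
    (fun o : Option (Option (Option (Option (Option (Option Bool))))) => match o with
      | none => Letter.vertex
      | some none => .plain
      | some (some none) => .red
      | some (some (some none)) => .blue
      | some (some (some (some none))) => .comma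
      | some (some (some (some (some none)))) => .target
      | some (some (some (some (some (some d))))) => .bit d)
    (by
      intro s
      cases s with
      | bit d => exact ⟨some (some (some (some (some (some d))))), rfl⟩
      | vertex => exact ⟨none, rfl⟩
      | plain => exact ⟨some none, rfl⟩
      | red => exact ⟨some (some none), rfl⟩
      | blue => exact ⟨some (some (some none)), rfl⟩
      | comma => exact ⟨some (some (some (some none))), rfl⟩
      | target => exact ⟨some (some (some (some (some none)))), rfl⟩)

/-- A mark followed by the binary expansion of `a` (least significant bit first, empty for
`a = 0`). -/
def numeral (mark : Letter) (a : ℕ) : List Letter :=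
  mark :: a.bits.map Letter.bit

/-- An edge: its colour and the numbers of its two ends. -/
def edgeCode {n : ℕ} (colour : Letter) (p : Fin n × Fin n) : List Letter :=
  numeral colour p.1 ++ numeral .comma p.2

/-- `x` encodes the instance `I`: `n` vertex marks, a list of the edges of the graph, each edge
listed once (in any order, and with its ends in any order), and the number `k` in binary. -/
def ExactPMInstance.IsEncodedBy (I : ExactPMInstance) (x : List Letter) : Prop :=
  ∃ es : List (Fin I.n × Fin I.n),
    (es.map fun p => s(p.1, p.2)).Nodup ∧
    (∀ e, e ∈ es.map (fun p => s(p.1, p.2)) ↔ e ∈ I.G.edgeSet) ∧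
    x = List.replicate I.n Letter.vertex ++
      es.flatMap (fun p => edgeCode (if s(p.1, p.2) ∈ I.R then .red else .plain) p) ++
      numeral .target I.k

/-- `x` encodes the instance `I`: the list of the capacities, the list of the edges (each with its
ends in any order), and the numbers `k` and `l`, all numbers in binary. -/
def ExactRedBlueInstance.IsEncodedBy (I : ExactRedBlueInstance) (x : List Letter) : Prop :=
  ∃ ends : Fin I.m → Fin I.n × Fin I.n,
    (∀ e, I.G.IsLink e (ends e).1 (ends e).2) ∧
    x = (List.finRange I.n).flatMap (fun v => numeral .vertex (I.b v)) ++
      (List.finRange I.m).flatMap (fun e =>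
        edgeCode (if e ∈ I.R then .red else if e ∈ I.B then .blue else .plain) (ends e)) ++
      numeral .target I.k ++ numeral .target I.l

/-! ### The decision problems as languages -/

/-- Exact Perfect Matching. -/
def exactPM : Language Letter :=
  {x | ∃ I : ExactPMInstance, I.IsEncodedBy x ∧ I.IsYes}

/-- Exact Perfect Bipartite Matching. -/
def exactBipartitePM : Language Letter :=
  {x | ∃ I : ExactPMInstance, I.IsEncodedBy x ∧ I.G.IsBipartite ∧ I.IsYes}

/-- Exact Red-Blue Perfect b-Matching for Multigraphs. -/
def exactRedBlueBM : Language Letter :=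
  {x | ∃ I : ExactRedBlueInstance, I.IsEncodedBy x ∧ I.IsYes}

/-- Exact Red-Blue Perfect Bipartite b-Matching for Multigraphs. -/
def exactRedBlueBipartiteBM : Language Letter :=
  {x | ∃ I : ExactRedBlueInstance, I.IsEncodedBy x ∧ I.G.IsBipartite ∧ I.IsYes}

/-! ### Routines -/

/-! Let `N` be the length of the input; a multigraph with `n` vertices and `m` edges that is read
from it satisfies `n ≤ N` and `m < N`. Every vertex `v` is replaced by `N` ports and `N - b v` extra
vertices, each extra vertex being joined to all ports of `v`. The edge number `e` from `s e` to `t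
e` is replaced by a path with `2 * N` inner vertices from port `e` of `s e` to port `e` of `t e`.
Different edges use different ports, so the result is a simple graph even when the multigraph has
parallel edges.

In a perfect matching the edges of such a path alternate (`Gadget.IsPerfect.mem_path`): either the
`N + 1` edges of even index are used and both end ports are covered, in which case `e` is called
selected, or the `N` edges of odd index are used and neither end port is covered. The extra vertices
of `v` are then matched bijectively with the ports left free by the selected edges. If `d` edges at
`v` are selected, this gives `N - b v = N - d`, and `d ≤ m < N` yields `d = b v`
(`Gadget.IsPerfect.isBMatching`). Conversely, every perfect `b`-matching extends to a perfect
matching by choosing such bijections (`Gadget.IsBMatching.exists_isPerfect`).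

The path of a red edge has its last edge red; the path of a blue edge has all its `N + 1` edges of
even index red; everything else is plain. A perfect matching that selects `r` red and `c` blue edges
thus has `r + (N + 1) * c` red edges (`Gadget.IsPerfect.card_red`). Since `r` and `c` are less than
`N`, they are the digits of this number in base `N + 1`, and the target `min k N + (N + 1) * min l
N` is attained exactly when `r = k` and `c = l` (`Gadget.add_mul_inj`). Capping at `N` is harmless
and keeps all numbers polynomial in `N`.

The paths have odd length, so a bipartition of the multigraph extends to the new graph
(`Gadget.exists_colouring`). Conversely, a perfect matching forces `b v < N`; then `v` has an extra
vertex, all ports of `v` lie on the same side, and a bipartition of the graph induces one of the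
multigraph (`Gadget.exists_side`).

For the space bound, the machine keeps a fixed number of registers in binary, all below `4 * N ^ 2`.
Routines that sweep over the digits are composed sequentially and in loops, and `Routine.Run`
carries the bound on the number of digits through every composition. A finite automaton first checks
the syntax of the input; a failure produces the empty string, which encodes no graph. An edge whose
ends are equal or are not vertices makes the machine write the letter `blue`, which occurs in no
code of a graph. For the remaining inputs the output is the code of the graph above
(`Gadget.outputText_eq`), and a code determines its instance (`ExactPMInstance.IsEncodedBy.unique`).
One string function serves both reductions. -/

/-- The content of a cell of a work tape: `none` is the marker in cell `0`, `some none` is blank. -/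
abbrev Cell := Option (Option Bool)

/-- A program fragment of a transducer with work tapes indexed by `T`, which returns a value
of type `A` when it halts. -/
structure Routine (α β T A : Type) where
  State : Type
  finite_state : Finite State
  start : State
  result : State → A
  trans : State → InputSymbol α → (T → Cell) →
    Option (State × HeadMove × (T → Cell × HeadMove) × Option β)

/-- Configurations of a routine with set of states `S`. -/
structure Conf (S T β : Type) where
  state : S
  inputHead : ℕ
  work : T → ℕ → Cell
  workHead : T → ℕ
  output : List β

/-- The data that routines work on: the position of the input head, the values of the registers
and the output written so far. -/
structure Store (T β : Type) where
  head : ℕ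
  reg : T → ℕ
  out : List β

/-- The least significant binary digit, `none` for the number `0`. -/
def lowDigit (v : ℕ) : Option Bool := if v = 0 then none else some (v % 2 = 1)

/-- The tape that holds `v` in binary, least significant digit first. -/
def tapeOf (v : ℕ) : ℕ → Cell
  | 0 => none
  | i + 1 => some (lowDigit (v / 2 ^ i))

namespace Routine

variable {α β T A A' : Type}

/-- One step of a machine with the given transitions. -/
def stepOf {S : Type} (trans : S → InputSymbol α → (T → Cell) →
      Option (S × HeadMove × (T → Cell × HeadMove) × Option β))
    (x : List α) (c : Conf S T β) : Option (Conf S T β) :=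
  match trans c.state (Transducer.readInput x c.inputHead) (fun t => c.work t (c.workHead t)) with
  | none => none
  | some (q, d, w, o) => some
      { state := q
        inputHead := min (d.apply c.inputHead) (x.length + 1)
        work := fun t => Function.update (c.work t) (c.workHead t) (w t).1
        workHead := fun t => (w t).2.apply (c.workHead t)
        output := c.output ++ o.toList }

/-- One step of a routine. -/
def step (M : Routine α β T A) (x : List α) (c : Conf M.State T β) : Option (Conf M.State T β) :=
  stepOf M.trans x c

/-- A step from a configuration in which the work heads scan the first `B` cells. -/
def BStep (M : Routine α β T A) (x : List α) (B : ℕ) (c c' : Conf M.State T β) : Prop :=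
  (∀ t, c.workHead t < B) ∧ M.step x c = some c'

/-- The configuration in state `q` with the data of a store. -/
def conf {S : Type} (q : S) (s : Store T β) : Conf S T β where
  state := q
  inputHead := s.head
  work := fun t => tapeOf (s.reg t)
  workHead := fun _ => 0
  output := s.out

/-- The input head is between the end markers and the registers hold numbers with at most `b`
digits. -/
def _root_.Store.Fits (x : List α) (b : ℕ) (s : Store T β) : Prop :=
  s.head ≤ x.length + 1 ∧ ∀ t, s.reg t < 2 ^ b

/-- Started with the data `s`, the routine halts with the data `s'` and the value `a`; if the
registers initially hold numbers with at most `b` digits, then they do so at the end, and the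
routine visits only the first `b + 2` cells of every tape. -/
def Run (x : List α) (b : ℕ) (M : Routine α β T A) (s : Store T β) (a : A) (s' : Store T β) :
    Prop :=
  s.Fits x b → s'.Fits x b ∧
    ∃ q, M.result q = a ∧
      Relation.ReflTransGen (M.BStep x (b + 2)) (conf M.start s) (conf q s') ∧
      M.step x (conf q s') = none

/-- A transition that only changes the state. -/
def goto {S : Type} (q : S) (w : T → Cell) :
    Option (S × HeadMove × (T → Cell × HeadMove) × Option β) :=
  some (q, .stay, fun t => (w t, .stay), none)

/-- The configuration with another state. -/
def _root_.Conf.withState {S S' : Type} (c : Conf S T β) (q : S') : Conf S' T β :=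
  { c with state := q }

theorem step_goto {M : Routine α β T A} {x : List α} {c : Conf M.State T β} {q : M.State}
    (h : M.trans c.state (Transducer.readInput x c.inputHead)
      (fun t => c.work t (c.workHead t)) = goto q (fun t => c.work t (c.workHead t)))
    (hc : c.inputHead ≤ x.length + 1) :
    M.step x c = some (c.withState q) := by
  unfold step stepOf
  rw [h]
  simp [goto, Conf.withState, HeadMove.apply, hc]

/-- A routine `M` simulates the routine `L` through the embedding `f` of states. -/
theorem step_map {M : Routine α β T A} {L : Routine α β T A'} (f : L.State → M.State)
    {x : List α} {c c' : Conf L.State T β}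
    (h : ∀ q a w r, L.trans q a w = some r → M.trans (f q) a w = some (f r.1, r.2))
    (hc : L.step x c = some c') :
    M.step x (c.withState (f c.state)) = some (c'.withState (f c'.state)) := by
  unfold step stepOf at hc
  split at hc
  · simp at hc
  · rename_i q d w o heq
    simp only [Option.some.injEq] at hc
    subst hc
    have := h _ _ _ _ heq
    unfold step stepOf
    simp only [Conf.withState]
    rw [this]

theorem step_eq_none {M : Routine α β T A} {x : List α} {c : Conf M.State T β} :
    M.step x c = none ↔ M.trans c.state (Transducer.readInput x c.inputHead)
      (fun t => c.work t (c.workHead t)) = none := by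
  unfold step stepOf
  split <;> simp_all

theorem reflTransGen_map {M : Routine α β T A} {L : Routine α β T A'} (f : L.State → M.State)
    {x : List α} {B : ℕ} {c c' : Conf L.State T β}
    (h : ∀ q a w r, L.trans q a w = some r → M.trans (f q) a w = some (f r.1, r.2))
    (hc : Relation.ReflTransGen (L.BStep x B) c c') :
    Relation.ReflTransGen (M.BStep x B) (c.withState (f c.state)) (c'.withState (f c'.state)) :=
  hc.lift (fun c : Conf L.State T β => c.withState (f c.state))
    (fun _ _ hs => ⟨hs.1, step_map f h hs.2⟩)

theorem bStep_goto {M : Routine α β T A} {x : List α} {b : ℕ} {s : Store T β} (hs : s.Fits x b)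
    {q q' : M.State}
    (h : M.trans q (Transducer.readInput x s.head) (fun _ => none) = goto q' fun _ => none) :
    M.BStep x (b + 2) (conf q s) (conf q' s) :=
  ⟨fun _ => by simp [conf], step_goto h hs.1⟩

/-! ### Composition of routines -/

/-- The routine that does nothing. -/
protected def pure (a : A) : Routine α β T A where
  State := Unit
  finite_state := inferInstance
  start := ()
  result _ := a
  trans _ _ _ := none

/-- Sequential composition. -/
protected def bind (M : Routine α β T A) (k : A → Routine α β T A') : Routine α β T A' where
  State := M.State ⊕ Σ q : M.State, (k (M.result q)).State
  finite_state :=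
    have := M.finite_state
    have := fun q => (k (M.result q)).finite_state
    inferInstance
  start := .inl M.start
  result
    | .inl q => (k (M.result q)).result (k (M.result q)).start
    | .inr p => (k (M.result p.1)).result p.2
  trans
    | .inl q, a, w => match M.trans q a w with
      | some r => some (.inl r.1, r.2)
      | none => goto (.inr ⟨q, (k (M.result q)).start⟩) w
    | .inr p, a, w => match (k (M.result p.1)).trans p.2 a w with
      | some r => some (.inr ⟨p.1, r.1⟩, r.2)
      | none => none

instance : Monad (Routine α β T) where
  pure := Routine.pure
  bind := Routine.bind

/-- Repetition of a routine as long as the second component of its value is `true`; the first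
component is passed on to the next round. -/
def loop [Finite A] (M : A → Routine α β T (A × Bool)) (a : A) : Routine α β T A where
  State := Σ a, (M a).State
  finite_state :=
    have := fun a => (M a).finite_state
    inferInstance
  start := ⟨a, (M a).start⟩
  result p := ((M p.1).result p.2).1
  trans p a w := match (M p.1).trans p.2 a w with
    | some r => some (⟨p.1, r.1⟩, r.2)
    | none => if ((M p.1).result p.2).2 then
        goto ⟨((M p.1).result p.2).1, (M ((M p.1).result p.2).1).start⟩ w else none

theorem Run.pure {x : List α} {b : ℕ} {a : A} {s : Store T β} :
    Run x b (pure a : Routine α β T A) s a s :=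
  fun hs => ⟨hs, (), rfl, .refl, step_eq_none.2 rfl⟩

/-- A routine halts with all work heads on the markers in cell `0`. The halting step of `M`
therefore becomes one state change into the start of the continuation, and the two runs are lifted
along the embeddings of their states. -/
theorem Run.bind {x : List α} {b : ℕ} {M : Routine α β T A} {k : A → Routine α β T A'} {a : A}
    {a' : A'} {s s' s'' : Store T β} (h : Run x b M s a s') (h' : Run x b (k a) s' a' s'') :
    Run x b (M >>= k) s a' s'' := by
  intro hs
  obtain ⟨hs', q, rfl, hq, hq'⟩ := h hs
  obtain ⟨hs'', p, rfl, hp, hp'⟩ := h' hs'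
  change _ ∧ ∃ r : M.State ⊕ Σ q : M.State, (k (M.result q)).State, (Routine.bind M k).result r = _ ∧
    Relation.ReflTransGen ((Routine.bind M k).BStep x (b + 2)) (conf (Sum.inl M.start) s)
      (conf r s'') ∧ (Routine.bind M k).step x (conf r s'') = none
  refine ⟨hs'', .inr ⟨q, p⟩, rfl, ?_, ?_⟩
  · refine .trans (reflTransGen_map (M := Routine.bind M k) Sum.inl ?_ hq) (.head ?_
      (reflTransGen_map (M := Routine.bind M k) (fun p => Sum.inr ⟨q, p⟩) ?_ hp))
    · intro q a w r h
      simp [Routine.bind, h]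
    · refine bStep_goto hs' (M := Routine.bind M k) ?_
      have : M.trans q (Transducer.readInput x s'.head) (fun _ => none) = none :=
        step_eq_none.1 hq'
      change (match M.trans q (Transducer.readInput x s'.head) (fun _ => none) with
        | some r => some (Sum.inl r.1, r.2)
        | none => goto _ _) = _
      rw [this]
      rfl
    · intro p a w r h
      simp [Routine.bind, h]
  · rw [step_eq_none] at hp' ⊢
    simp only [conf] at hp'
    simp [Routine.bind, conf, hp']

theorem loop_trans_halt [Finite A] {M : A → Routine α β T (A × Bool)} {a : A} {q : (M a).State}
    {i : InputSymbol α} {w : T → Cell} (h : (M a).trans q i w = none) {a' : A} {r : Bool}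
    (hq : (M a).result q = (a', r)) {a₀ : A} :
    (loop M a₀).trans ⟨a, q⟩ i w = if r then goto ⟨a', (M a').start⟩ w else none := by
  have h1 : ((M a).result q).1 = a' := by rw [hq]
  have h2 : ((M a).result q).2 = r := by rw [hq]
  subst h1 h2
  simp [loop, h]

theorem Run.loop_done [Finite A] {x : List α} {b : ℕ} {M : A → Routine α β T (A × Bool)} {a a' : A}
    {s s' : Store T β} (h : Run x b (M a) s (a', false) s') : Run x b (loop M a) s a' s' := by
  intro hs
  obtain ⟨hs', q, hr, hq, hq'⟩ := h hs
  refine ⟨hs', ⟨a, q⟩, by simp [loop, hr], ?_, ?_⟩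
  · exact reflTransGen_map (M := loop M a) (fun q => ⟨a, q⟩)
      (by intro q i w r h; simp [loop, h]) hq
  · rw [step_eq_none] at hq' ⊢
    exact (loop_trans_halt hq' hr).trans (by simp)

/-- Together with `Run.loop_done` this unrolls a loop round by round. Termination comes from an
induction for each particular loop. -/
theorem Run.loop_next [Finite A] {x : List α} {b : ℕ} {M : A → Routine α β T (A × Bool)}
    {a a' a'' : A} {s s' s'' : Store T β} (h : Run x b (M a) s (a', true) s')
    (h' : Run x b (loop M a') s' a'' s'') : Run x b (loop M a) s a'' s'' := by
  intro hs
  obtain ⟨hs', q, hr, hq, hq'⟩ := h hs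
  obtain ⟨hs'', p, hr', hp, hp'⟩ := h' hs'
  refine ⟨hs'', p, hr', ?_, hp'⟩
  refine .trans (reflTransGen_map (M := loop M a) (fun q => ⟨a, q⟩)
      (by intro q i w r h; simp [loop, h]) hq) (.head ?_ hp)
  have : (M a).trans q (Transducer.readInput x s'.head) (fun _ => none) = none :=
    step_eq_none.1 hq'
  exact bStep_goto (M := loop M a) (q' := (loop M a').start) hs'
    ((loop_trans_halt this hr).trans rfl)

/-! ### Input and output -/

instance [Finite α] : Finite (InputSymbol α) :=
  Finite.of_surjective
    (fun o : Option (Option α) => match o with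
      | none => .leftEnd
      | some none => .rightEnd
      | some (some a) => .letter a)
    (by
      rintro (_ | a | _)
      exacts [⟨none, rfl⟩, ⟨some (some a), rfl⟩, ⟨some none, rfl⟩])

/-- Reads the scanned input symbol. -/
def read [Finite α] : Routine α β T (InputSymbol α) where
  State := Option (InputSymbol α)
  finite_state := inferInstance
  start := none
  result q := q.getD .leftEnd
  trans q a w := match q with
    | none => goto (some a) w
    | some _ => none

/-- Moves the input head and writes at most one letter on the output tape. -/
def act (d : HeadMove) (o : Option β) : Routine α β T Unit where
  State := Bool
  finite_state := inferInstance
  start := true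
  result _ := ()
  trans q _ w := if q then some (false, d, fun t => (w t, .stay), o) else none

theorem Run.read [Finite α] {x : List α} {b : ℕ} {s : Store T β} :
    Run x b read s (Transducer.readInput x s.head) s := by
  intro hs
  refine ⟨hs, some (Transducer.readInput x s.head), rfl, .single ?_, step_eq_none.2 rfl⟩
  exact bStep_goto (M := Routine.read) hs rfl

theorem Run.act {x : List α} {b : ℕ} {s : Store T β} {d : HeadMove} {o : Option β} :
    Run x b (act d o) s () { s with
      head := min (d.apply s.head) (x.length + 1), out := s.out ++ o.toList } := by
  intro hs
  refine ⟨⟨min_le_right _ _, hs.2⟩, false, rfl, .single ⟨fun _ => by simp [conf], ?_⟩,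
    step_eq_none.2 rfl⟩
  simp [step, stepOf, Routine.act, conf, HeadMove.apply]

end Routine

namespace Routine

variable {α β T A A' Q : Type}

/-! ### Arithmetic on the registers -/

/-- Computes a function of the registers digit by digit, from the least significant one on:
`δ` maps the current state and the current digits to the next state, the new digits and a letter
of the output, or decides that the remaining digits do not change. -/
noncomputable def sweep [Finite Q] (δ : Q → (T → Option Bool) → Option (Q × (T → Option Bool) × Option β))
    (q₀ : Q) : Routine α β T Q where
  State := Option (Q × Bool)
  finite_state := inferInstance
  start := none
  result q := (q.map Prod.fst).getD q₀
  trans q _ w := match q with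
    | none => some (some (q₀, true), .stay, fun t => (w t, .right), none)
    | some (q, true) => match δ q (fun t => (w t).join) with
      | none => goto (some (q, false)) w
      | some r => some (some (r.1, true), .stay, fun t => (some (r.2.1 t), .right), r.2.2)
    | some (q, false) => open scoped Classical in
      if ∀ t, w t = none then none else some (some (q, false), .stay, fun t => (w t, .left), none)

/-- The effect of a sweep on the registers. -/
inductive Sweep (δ : Q → (T → Option Bool) → Option (Q × (T → Option Bool) × Option β)) :
    Q → (T → ℕ) → (T → ℕ) → List β → Q → Prop
  | halt {q σ} (h : δ q (fun t => lowDigit (σ t)) = none) : Sweep δ q σ σ [] q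
  | next {q q' q'' σ σ' o os}
      (h : δ q (fun t => lowDigit (σ t)) = some (q', fun t => lowDigit (σ' t), o))
      (h0 : ∃ t, σ t ≠ 0 ∨ σ' t ≠ 0)
      (h' : Sweep δ q' (fun t => σ t / 2) (fun t => σ' t / 2) os q'') :
      Sweep δ q σ σ' (o.toList ++ os) q''

/-- The way to the right. After `i` digits the untreated cells hold `σ`, which is the old contents
shifted by `i` digits, and the treated cells are not touched again. The bounds on `σ t * 2 ^ i` and
`σ' t * 2 ^ i` say that the old and new registers have at most `b` digits. -/
theorem sweep_right [Finite Q]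
    {δ : Q → (T → Option Bool) → Option (Q × (T → Option Bool) × Option β)} {q₀ q q' : Q}
    {σ σ' : T → ℕ} {os : List β} (hS : Sweep δ q σ σ' os q') {x : List α} {b h : ℕ}
    (hh : h ≤ x.length + 1) :
    ∀ (i : ℕ) (work : T → ℕ → Cell) (out : List β), i ≤ b →
      (∀ t, σ t * 2 ^ i < 2 ^ b ∧ σ' t * 2 ^ i < 2 ^ b) →
      (∀ t p, work t (i + 1 + p) = some (lowDigit (σ t / 2 ^ p))) →
      ∃ j work', j ≤ b ∧ (∀ t p, p ≤ i → work' t p = work t p) ∧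
        (∀ t p, work' t (i + 1 + p) = some (lowDigit (σ' t / 2 ^ p))) ∧
        Relation.ReflTransGen ((sweep δ q₀).BStep x (b + 2))
          ⟨some (q, true), h, work, fun _ => i + 1, out⟩
          ⟨some (q', false), h, work', fun _ => j + 1, out ++ os⟩ := by
  induction hS with
  | @halt q σ hδ =>
    intro i work out hi _ hw
    refine ⟨i, work, hi, fun _ _ _ => rfl, hw, .single ⟨fun _ => by simpa using hi, ?_⟩⟩
    have : (fun t => (work t (i + 1)).join) = fun t => lowDigit (σ t) := by
      funext t
      simpa using congrArg Option.join (hw t 0)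
    simp [step, stepOf, sweep, this, hδ, goto, HeadMove.apply, hh]
  | @next q q' q'' σ σ' o os hδ h0 _ ih =>
    intro i work out hi hb hw
    -- A nonzero old or new remainder means that some register still has a digit at position `i`;
    -- this keeps the heads within the first `b + 2` cells.
    have hi' : i < b := by
      obtain ⟨t, ht⟩ := h0
      by_contra hc
      have h2 := Nat.pow_le_pow_right (n := 2) (by norm_num) (not_lt.1 hc)
      rcases ht with ht | ht
      · exact absurd (hb t).1 (not_lt.2 (h2.trans (Nat.le_mul_of_pos_left _ (by omega))))
      · exact absurd (hb t).2 (not_lt.2 (h2.trans (Nat.le_mul_of_pos_left _ (by omega))))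
    obtain ⟨j, work', hj, h1, h2, h3⟩ := ih (i + 1)
      (fun t => Function.update (work t) (i + 1) (some (lowDigit (σ' t)))) (out ++ o.toList) hi'
      (fun t => by
        have h4 : ∀ v : ℕ, v / 2 * 2 ^ (i + 1) ≤ v * 2 ^ i := fun v => by
          rw [pow_succ, mul_comm (2 ^ i), ← mul_assoc]
          exact Nat.mul_le_mul_right _ (Nat.div_mul_le_self v 2)
        exact ⟨(h4 _).trans_lt (hb t).1, (h4 _).trans_lt (hb t).2⟩)
      (fun t p => by
        rw [Function.update_of_ne (by omega), Nat.div_div_eq_div_mul, ← pow_succ', ← hw t (p + 1)]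
        congr 1
        omega)
    refine ⟨j, work', hj, fun t p hp => ?_, fun t p => ?_, .head ⟨fun _ => by simpa using hi, ?_⟩
      (by simpa using h3)⟩
    · rw [h1 t p (by omega), Function.update_of_ne (by omega)]
    · cases p with
      | zero => rw [add_zero, h1 t (i + 1) le_rfl]; simp
      | succ p =>
        have := h2 t p
        rw [Nat.div_div_eq_div_mul, ← pow_succ'] at this
        rw [← this]
        congr 1
        omega
    · have : (fun t => (work t (i + 1)).join) = fun t => lowDigit (σ t) := by
        funext t
        simpa using congrArg Option.join (hw t 0)
      simp [step, stepOf, sweep, this, hδ, HeadMove.apply, hh]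

/-- All heads move in step, so they reach the markers simultaneously, and every cell is rewritten
with its own contents. -/
theorem sweep_left [Finite Q] [Nonempty T]
    {δ : Q → (T → Option Bool) → Option (Q × (T → Option Bool) × Option β)} {q₀ q : Q}
    {x : List α} {b h : ℕ} (hh : h ≤ x.length + 1) (σ : T → ℕ) (out : List β) :
    ∀ j, j ≤ b + 1 → Relation.ReflTransGen ((sweep δ q₀).BStep x (b + 2))
      ⟨some (q, false), h, fun t => tapeOf (σ t), fun _ => j, out⟩
      ⟨some (q, false), h, fun t => tapeOf (σ t), fun _ => 0, out⟩
  | 0, _ => .refl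
  | j + 1, hj => by
    refine .head ⟨fun _ => by simpa using hj, ?_⟩ (sweep_left hh σ out j (by omega))
    have : ∀ t, Function.update (tapeOf (σ t)) (j + 1) (tapeOf (σ t) (j + 1)) = tapeOf (σ t) :=
      fun t => Function.update_eq_self _ _
    simp only [tapeOf] at this
    simp [step, stepOf, sweep, tapeOf, HeadMove.apply, hh, this]

theorem Run.sweep [Finite Q] [Nonempty T]
    {δ : Q → (T → Option Bool) → Option (Q × (T → Option Bool) × Option β)} {q₀ q : Q}
    {x : List α} {b h : ℕ} {σ σ' : T → ℕ} {os out : List β} (hS : Sweep δ q₀ σ σ' os q)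
    (hb : (∀ t, σ t < 2 ^ b) → ∀ t, σ' t < 2 ^ b) :
    Run x b (sweep δ q₀) ⟨h, σ, out⟩ q ⟨h, σ', out ++ os⟩ := by
  intro hs
  have hb' := hb hs.2
  refine ⟨⟨hs.1, hb'⟩, some (q, false), rfl, ?_, ?_⟩
  · obtain ⟨j, work', hj, h1, h2, h3⟩ := sweep_right (q₀ := q₀) hS hs.1 0 (fun t => tapeOf (σ t)) out
      (Nat.zero_le b) (fun t => by simpa using ⟨hs.2 t, hb' t⟩)
      (fun t p => by rw [zero_add, add_comm]; rfl)
    have hw : work' = fun t => tapeOf (σ' t) := by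
      funext t p
      cases p with
      | zero => simpa [tapeOf] using h1 t 0 le_rfl
      | succ p => simpa [add_comm, tapeOf] using h2 t p
    subst hw
    refine .head ⟨fun _ => by simp [conf], ?_⟩ (h3.trans (sweep_left hs.1 σ' _ (j + 1) (by omega)))
    have : ∀ t, Function.update (tapeOf (σ t)) 0 (tapeOf (σ t) 0) = tapeOf (σ t) := fun t =>
      Function.update_eq_self _ _
    have hh : h ≤ x.length + 1 := hs.1
    simp [step, stepOf, Routine.sweep, conf, HeadMove.apply, hh]
  · simp [step, stepOf, Routine.sweep, conf, tapeOf]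

theorem lowDigit_eq_none {v : ℕ} : lowDigit v = none ↔ v = 0 := by
  unfold lowDigit; split <;> simp_all

theorem lowDigit_eq_true {v : ℕ} : lowDigit v = some true ↔ v % 2 = 1 := by
  unfold lowDigit; split <;> simp_all

theorem lowDigit_of_pos {v : ℕ} (h : 0 < v) : lowDigit v = some (decide (v % 2 = 1)) := by
  unfold lowDigit; rw [if_neg (by omega)]

theorem update_apply_map [DecidableEq T] {γ δ : Type} (g : γ → δ) (σ : T → γ) (r : T) (v : γ) :
    (fun t => g (Function.update σ r v t)) = Function.update (fun t => g (σ t)) r (g v) :=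
  Function.comp_update g σ r v

/-- A sweep that replaces the value of the register `r` by `v`. -/
theorem Run.sweep_update [DecidableEq T] [Finite Q]
    {δ : Q → (T → Option Bool) → Option (Q × (T → Option Bool) × Option β)} {q₀ q : Q}
    {x : List α} {b h : ℕ} {σ : T → ℕ} {out : List β} {r : T} {v : ℕ}
    (hS : Sweep δ q₀ σ (Function.update σ r v) [] q)
    (hb : (∀ t, σ t < 2 ^ b) → v < 2 ^ b) :
    Run x b (Routine.sweep δ q₀) ⟨h, σ, out⟩ q ⟨h, Function.update σ r v, out⟩ := by
  have : Nonempty T := ⟨r⟩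
  have := Run.sweep (x := x) (b := b) (h := h) (out := out) hS
    (fun hσ t => by
      by_cases ht : t = r
      · subst ht; simpa using hb hσ
      · simpa [ht] using hσ t)
  simpa using this

/-- One digit of the computation of `r + 1`. -/
def incDigit [DecidableEq T] (r : T) (carry : Bool) (w : T → Option Bool) :
    Option (Bool × (T → Option Bool) × Option β) :=
  if carry then
    some (w r = some true, Function.update w r (some (decide (w r ≠ some true))), none)
  else none

/-- `r := r + 1` -/
noncomputable def inc [DecidableEq T] (r : T) : Routine α β T Unit :=
  sweep (incDigit r) true >>= fun _ => pure ()

theorem sweep_inc [DecidableEq T] (r : T) : ∀ v (σ : T → ℕ), σ r = v →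
    Sweep (β := β) (incDigit r) true σ (Function.update σ r (σ r + 1)) [] false := by
  intro v
  induction v using Nat.strong_induction_on with
  | _ v ih =>
    intro σ hv
    refine Sweep.next (o := none) (os := []) (q' := decide (lowDigit (σ r) = some true)) ?_
      ⟨r, .inr (by simp)⟩ ?_
    · rw [update_apply_map lowDigit, lowDigit_of_pos (Nat.succ_pos _)]
      simp [incDigit, lowDigit_eq_true, Nat.succ_mod_two_eq_one_iff]
    · rw [update_apply_map (· / 2)]
      by_cases h1 : σ r % 2 = 1
      · have := ih (v / 2) (by omega) (fun t => σ t / 2) (by simp [hv])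
        have h2 : (σ r + 1) / 2 = σ r / 2 + 1 := by omega
        simpa [lowDigit_eq_true, h1, h2] using this
      · have h2 : (σ r + 1) / 2 = σ r / 2 := by omega
        have h3 : Function.update (fun t => σ t / 2) r (σ r / 2) = fun t => σ t / 2 :=
          Function.update_eq_self _ _
        simp only [lowDigit_eq_true, h1, h2, h3]
        exact .halt (by simp [incDigit])

theorem Run.inc [DecidableEq T] {x : List α} {b h : ℕ} {σ : T → ℕ} {out : List β} {r : T}
    (hb : (∀ t, σ t < 2 ^ b) → σ r + 1 < 2 ^ b) :
    Run x b (inc r) ⟨h, σ, out⟩ () ⟨h, Function.update σ r (σ r + 1), out⟩ :=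
  .bind (.sweep_update (sweep_inc r _ σ rfl) hb) .pure

/-- One digit of the computation of `r + s`. -/
def addDigit [DecidableEq T] (r s : T) (carry : Bool) (w : T → Option Bool) :
    Option (Bool × (T → Option Bool) × Option β) :=
  if w s = none ∧ carry = false then none else
    some (decide (2 ≤ (if w r = some true then 1 else 0) + (if w s = some true then 1 else 0) +
        carry.toNat),
      Function.update w r (some (decide (((if w r = some true then 1 else 0) +
        (if w s = some true then 1 else 0) + carry.toNat) % 2 = 1))), none)

/-- `r := r + s` -/
noncomputable def add [DecidableEq T] (r s : T) : Routine α β T Unit :=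
  sweep (addDigit r s) false >>= fun _ => pure ()

/-- The carry is part of the state, and the sweep stops once `s` is exhausted and no carry is left.
Each digit is read before it is overwritten, so the case `r = s` is included; `horner` uses it for
doubling. -/
theorem sweep_add [DecidableEq T] (r s : T) : ∀ v (c : Bool) (σ : T → ℕ), σ r + σ s + c.toNat = v →
    Sweep (β := β) (addDigit r s) c σ (Function.update σ r (σ r + σ s + c.toNat)) [] false := by
  intro v
  induction v using Nat.strong_induction_on with
  | _ v ih =>
    intro c σ hv
    by_cases h0 : σ s = 0 ∧ c = false
    · obtain ⟨h0, rfl⟩ := h0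
      have h3 : Function.update σ r (σ r + σ s + Bool.toNat false) = σ := by simp [h0]
      rw [h3]
      exact .halt (by simp [addDigit, lowDigit_eq_none, h0])
    have hpos : 0 < σ r + σ s + c.toNat := by
      (rcases c with _ | _ <;> simp at h0 ⊢) <;> omega
    have hm : ∀ u, (if u % 2 = 1 then 1 else 0) = u % 2 := fun u => by split <;> omega
    have hc : c.toNat ≤ 1 := by cases c <;> simp
    refine Sweep.next (o := none) (os := [])
      (q' := decide (2 ≤ σ r % 2 + σ s % 2 + c.toNat)) ?_ ⟨r, .inr (by simpa using hpos.ne')⟩ ?_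
    · rw [update_apply_map lowDigit, lowDigit_of_pos hpos]
      simp only [addDigit, lowDigit_eq_none, lowDigit_eq_true, h0, hm, if_false]
      congr 5
      simp only [decide_eq_decide]
      omega
    · rw [update_apply_map (· / 2)]
      have h2 : (σ r + σ s + c.toNat) / 2 =
          σ r / 2 + σ s / 2 + (decide (2 ≤ σ r % 2 + σ s % 2 + c.toNat)).toNat := by
        by_cases h : 2 ≤ σ r % 2 + σ s % 2 + c.toNat <;> simp [h] <;> omega
      rw [h2]
      by_cases h1 : σ r + σ s + c.toNat = 1
      · have h4 : σ s / 2 = 0 ∧ decide (2 ≤ σ r % 2 + σ s % 2 + c.toNat) = false := by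
          simp; omega
        have h3 : Function.update (fun t => σ t / 2) r (σ r / 2) = fun t => σ t / 2 :=
          Function.update_eq_self _ _
        rw [h4.2, h4.1]
        simp only [Bool.toNat_false, add_zero, h3]
        exact .halt (by simp [addDigit, lowDigit_eq_none]; omega)
      · exact ih _ (by rw [← h2]; omega) _ (fun t => σ t / 2) rfl

theorem Run.add [DecidableEq T] {x : List α} {b h : ℕ} {σ : T → ℕ} {out : List β} {r s : T}
    (hb : (∀ t, σ t < 2 ^ b) → σ r + σ s < 2 ^ b) :
    Run x b (add r s) ⟨h, σ, out⟩ () ⟨h, Function.update σ r (σ r + σ s), out⟩ :=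
  .bind (.sweep_update (sweep_add r s _ false σ rfl) hb) .pure

/-- One digit of the computation of a copy of `s` in `r`. -/
def copyDigit [DecidableEq T] (r s : T) (_ : Unit) (w : T → Option Bool) :
    Option (Unit × (T → Option Bool) × Option β) :=
  if w r = none ∧ w s = none then none else some ((), Function.update w r (w s), none)

/-- `r := s` -/
noncomputable def copy [DecidableEq T] (r s : T) : Routine α β T Unit :=
  sweep (copyDigit r s) ()

theorem sweep_copy [DecidableEq T] (r s : T) : ∀ v (σ : T → ℕ), σ r + σ s = v →
    Sweep (β := β) (copyDigit r s) () σ (Function.update σ r (σ s)) [] () := by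
  intro v
  induction v using Nat.strong_induction_on with
  | _ v ih =>
    intro σ hv
    by_cases h0 : σ r = 0 ∧ σ s = 0
    · have h3 : Function.update σ r (σ s) = σ := by rw [h0.2, ← h0.1, Function.update_eq_self]
      rw [h3]
      exact .halt (by simp [copyDigit, lowDigit_eq_none, h0])
    refine Sweep.next (o := none) (os := []) (q' := ()) ?_ ⟨r, by simp; omega⟩ ?_
    · rw [update_apply_map lowDigit]
      simp [copyDigit, lowDigit_eq_none, h0]
    · rw [update_apply_map (· / 2)]
      exact ih _ (by omega) (fun t => σ t / 2) rfl

theorem Run.copy [DecidableEq T] {x : List α} {b h : ℕ} {σ : T → ℕ} {out : List β} {r s : T} :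
    Run x b (copy r s) ⟨h, σ, out⟩ () ⟨h, Function.update σ r (σ s), out⟩ :=
  .sweep_update (sweep_copy r s _ σ rfl) fun h => h s

/-- One digit of the comparison of `r` and `s`. -/
def ltDigit (r s : T) (q : Bool) (w : T → Option Bool) :
    Option (Bool × (T → Option Bool) × Option β) :=
  if w r = none ∧ w s = none then none else
    some (if w r = some true ↔ w s = some true then q else decide (w s = some true), w, none)

/-- The value of `r < s`. -/
noncomputable def lt (r s : T) : Routine α β T Bool :=
  sweep (ltDigit r s) false

/-- The digits arrive with increasing significance, so a later difference overrides the verdict `q`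
on the earlier ones; `q` survives only if the remaining numbers are equal. -/
theorem sweep_lt (r s : T) : ∀ v (q : Bool) (σ : T → ℕ), σ r + σ s = v →
    Sweep (β := β) (ltDigit r s) q σ σ [] (decide (σ r < σ s ∨ σ r = σ s ∧ q = true)) := by
  intro v
  induction v using Nat.strong_induction_on with
  | _ v ih =>
    intro q σ hv
    by_cases h0 : σ r = 0 ∧ σ s = 0
    · have : decide (σ r < σ s ∨ σ r = σ s ∧ q = true) = q := by simp [h0]
      rw [this]
      exact .halt (by simp [ltDigit, lowDigit_eq_none, h0])
    refine Sweep.next (o := none) (os := [])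
      (q' := if σ r % 2 = 1 ↔ σ s % 2 = 1 then q else decide (σ s % 2 = 1)) ?_ ?_ ?_
    · simp [ltDigit, lowDigit_eq_none, lowDigit_eq_true, h0]
    · by_cases h1 : σ r = 0
      · exact ⟨s, by simp; omega⟩
      · exact ⟨r, .inl h1⟩
    · convert ih _ (by omega) _ (fun t => σ t / 2) rfl using 2
      split_ifs with h
      · cases q <;> simp <;> omega
      · simp; omega

theorem Run.lt [Nonempty T] {x : List α} {b : ℕ} {s : Store T β} {r r' : T} :
    Run x b (lt r r') s (decide (s.reg r < s.reg r')) s := by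
  have := Run.sweep (x := x) (b := b) (h := s.head) (out := s.out)
    (sweep_lt r r' _ false s.reg rfl) id
  rw [List.append_nil, show decide (s.reg r < s.reg r' ∨ s.reg r = s.reg r' ∧ false = true) =
    decide (s.reg r < s.reg r') by simp] at this
  exact this

/-- One digit of the output of `r`. -/
def emitDigit (g : Bool → β) (r : T) (_ : Unit) (w : T → Option Bool) :
    Option (Unit × (T → Option Bool) × Option β) :=
  (w r).map fun d => ((), w, some (g d))

/-- Writes the binary expansion of `r` on the output tape. -/
noncomputable def emitBits (g : Bool → β) (r : T) : Routine α β T Unit :=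
  sweep (emitDigit g r) ()

theorem sweep_emitBits (g : Bool → β) (r : T) : ∀ v (σ : T → ℕ), σ r = v →
    Sweep (emitDigit g r) () σ σ (v.bits.map g) () := by
  intro v
  induction v using Nat.strong_induction_on with
  | _ v ih =>
    intro σ hv
    by_cases h0 : v = 0
    · subst h0
      simpa using Sweep.halt (by simp [emitDigit, lowDigit_eq_none.2 hv])
    have hbits : v.bits = decide (v % 2 = 1) :: (v / 2).bits := by
      rw [← Nat.bit_bodd_div2 v, Nat.bits_append_bit _ _ (by
        intro h; rw [← Nat.bit_bodd_div2 v, h] at h0; rcases hb : v.bodd <;> simp_all), Nat.bit_bodd_div2,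
        Nat.div2_val, Nat.mod_two_of_bodd]
      cases v.bodd <;> simp
    rw [hbits]
    refine Sweep.next (o := some _) (q' := ()) ?_ ⟨r, by omega⟩
      (ih (v / 2) (by omega) (fun t => σ t / 2) (by simp [hv]))
    simp [emitDigit, hv, lowDigit_of_pos (Nat.pos_of_ne_zero h0)]

theorem Run.emitBits [Nonempty T] {g : Bool → β} {x : List α} {b : ℕ} {s : Store T β} {r : T} :
    Run x b (emitBits g r) s () ⟨s.head, s.reg, s.out ++ (s.reg r).bits.map g⟩ :=
  .sweep (sweep_emitBits g r _ s.reg rfl) id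

/-! ### From routines to transducers -/

/-- The transducer that writes the markers on its work tapes and then executes a routine. -/
def toTransducer [Finite T] (M : Routine α β T A) : Transducer α β where
  State := Option M.State
  finite_state :=
    have := M.finite_state
    inferInstance
  Tape := T
  finite_tape := inferInstance
  Γ := Cell
  finite_Γ := inferInstance
  blank := some none
  start := none
  trans
    | none, _, _ => some (some M.start, .stay, fun _ => (none, .stay), none)
    | some q, a, w => match M.trans q a w with
      | some r => some (some r.1, r.2)
      | none => none

/-- A configuration of a routine as a configuration of the transducer. -/
def toConfig [Finite T] (M : Routine α β T A) (c : Conf M.State T β) : M.toTransducer.Config where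
  state := some c.state
  inputHead := c.inputHead
  work := c.work
  workHead := c.workHead
  output := c.output

theorem toTransducer_step [Finite T] (M : Routine α β T A) (x : List α) (c : Conf M.State T β) :
    M.toTransducer.step x (M.toConfig c) = (M.step x c).map M.toConfig := by
  unfold Transducer.step step stepOf
  simp only [toTransducer, toConfig]
  cases h : M.trans c.state (Transducer.readInput x c.inputHead)
    fun t => c.work t (c.workHead t) <;> rfl

theorem toTransducer_init [Finite T] (M : Routine α β T A) (x : List α) :
    M.toTransducer.step x M.toTransducer.init =
      some (M.toConfig (conf M.start ⟨0, fun _ => 0, []⟩)) := by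
  simp only [Transducer.step, toTransducer, Transducer.init, toConfig, conf, HeadMove.apply]
  congr 2
  · funext t p
    cases p with
    | zero => simp [tapeOf]
    | succ p => simp [tapeOf, lowDigit]

theorem reaches_of_bStep [Finite T] {M : Routine α β T A} {x : List α} {B : ℕ}
    {c c' : Conf M.State T β} (h : Relation.ReflTransGen (M.BStep x B) c c') :
    StateTransition.Reaches (M.toTransducer.step x) (M.toConfig c) (M.toConfig c') :=
  h.lift M.toConfig fun a b hs => by
    change M.toConfig b ∈ M.toTransducer.step x (M.toConfig a)
    rw [toTransducer_step, hs.2]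
    rfl

/-- The machine is deterministic: every configuration that it reaches lies on the given halting run,
where each step respects the bound. -/
theorem workHead_lt_of_reaches [Finite T] {M : Routine α β T A} {x : List α} {B : ℕ} (hB : 0 < B)
    {c : Conf M.State T β} {q : M.State} {s : Store T β}
    (h : Relation.ReflTransGen (M.BStep x B) c (conf q s)) (hq : M.step x (conf q s) = none)
    {d : M.toTransducer.Config}
    (hd : StateTransition.Reaches (M.toTransducer.step x) (M.toConfig c) d) (t : T) :
    d.workHead t < B := by
  induction h using Relation.ReflTransGen.head_induction_on with
  | refl =>
    have h1 : M.toTransducer.step x (M.toConfig (conf q s)) = none := by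
      rw [toTransducer_step, hq]; rfl
    rcases Relation.ReflTransGen.cases_head hd with rfl | ⟨e, he, _⟩
    · exact hB
    · rw [h1] at he; simp at he
  | head h _ ih =>
    rcases Relation.ReflTransGen.cases_head hd with rfl | ⟨e, he, hd'⟩
    · exact h.1 t
    · rw [toTransducer_step, h.2] at he
      simp only [Option.map_some, Option.mem_def, Option.some.injEq] at he
      subst he
      exact ih hd'

theorem Run.outputs [Finite T] {M : Routine α β T A} {x : List α} {b : ℕ} {a : A} {s : Store T β}
    (h : Run x b M ⟨0, fun _ => 0, []⟩ a s) : M.toTransducer.Outputs x s.out := by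
  obtain ⟨-, q, -, hq, hq'⟩ := h ⟨Nat.zero_le _, fun _ => by simp⟩
  refine ⟨M.toConfig (conf q s), .head (toTransducer_init M x) (reaches_of_bStep hq), ?_, rfl⟩
  rw [toTransducer_step, hq']
  rfl

theorem Run.spaceBoundedBy [Finite T] {M : Routine α β T A} {x : List α} {b B : ℕ} {a : A}
    {s : Store T β} (h : Run x b M ⟨0, fun _ => 0, []⟩ a s) (hB : b + 2 ≤ B) :
    M.toTransducer.SpaceBoundedBy x B := by
  obtain ⟨-, q, -, hq, hq'⟩ := h ⟨Nat.zero_le _, fun _ => by simp⟩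
  intro c hc t
  rcases Relation.ReflTransGen.cases_head hc with rfl | ⟨e, he, hc'⟩
  · exact lt_of_lt_of_le (Nat.succ_pos _) hB
  · rw [toTransducer_init] at he
    simp only [Option.mem_def, Option.some.injEq] at he
    subst he
    exact lt_of_lt_of_le (workHead_lt_of_reaches (Nat.succ_pos _) hq hq' hc' t) hB

theorem _root_.Transducer.Outputs.unique {M : Transducer α β} {x : List α} {y z : List β}
    (hy : M.Outputs x y) (hz : M.Outputs x z) : y = z := by
  obtain ⟨c, hc, hc', rfl⟩ := hy
  obtain ⟨d, hd, hd', rfl⟩ := hz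
  rw [Part.mem_unique (StateTransition.mem_eval.2 ⟨hc, hc'⟩)
    (StateTransition.mem_eval.2 ⟨hd, hd'⟩)]

end Routine

/-! ### The registers and elementary programs -/

/-- The names of the registers. -/
inductive Reg : Type where
  | zero | len | num | next | base | i | e | a | a' | p | p' | j
  deriving DecidableEq

instance : Fintype Reg :=
  ⟨{.zero, .len, .num, .next, .base, .i, .e, .a, .a', .p, .p', .j}, by rintro (_ | _) <;> decide⟩

/-- The values of the registers. -/
structure Regs : Type where
  zero : ℕ
  len : ℕ
  num : ℕ
  next : ℕ
  base : ℕ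
  i : ℕ
  e : ℕ
  a : ℕ
  a' : ℕ
  p : ℕ
  p' : ℕ
  j : ℕ

/-- The value of a register. -/
def Regs.get (σ : Regs) : Reg → ℕ
  | .zero => σ.zero
  | .len => σ.len
  | .num => σ.num
  | .next => σ.next
  | .base => σ.base
  | .i => σ.i
  | .e => σ.e
  | .a => σ.a
  | .a' => σ.a'
  | .p => σ.p
  | .p' => σ.p'
  | .j => σ.j

/-- Changes the value of a register. -/
def Regs.set (σ : Regs) (r : Reg) (v : ℕ) : Regs :=
  match r with
  | .zero => { σ with zero := v }
  | .len => { σ with len := v }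
  | .num => { σ with num := v }
  | .next => { σ with next := v }
  | .base => { σ with base := v }
  | .i => { σ with i := v }
  | .e => { σ with e := v }
  | .a => { σ with a := v }
  | .a' => { σ with a' := v }
  | .p => { σ with p := v }
  | .p' => { σ with p' := v }
  | .j => { σ with j := v }

theorem Regs.get_set (σ : Regs) (r t : Reg) (v : ℕ) :
    (σ.set r v).get t = if t = r then v else σ.get t := by
  cases r <;> cases t <;> rfl

theorem Regs.set_set (σ : Regs) (r : Reg) (v w : ℕ) : (σ.set r v).set r w = σ.set r w := by
  cases r <;> rfl

theorem Regs.update_get (σ : Regs) (r : Reg) (v : ℕ) :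
    Function.update σ.get r v = (σ.set r v).get := by
  funext t
  rw [Regs.get_set, Function.update_apply]

instance : Nonempty Reg := ⟨.zero⟩

/-- Programs. -/
abbrev Prog (A : Type) := Routine Letter Letter Reg A

/-- The data of a program. -/
def st (h : ℕ) (σ : Regs) (o : List Letter) : Store Reg Letter := ⟨h, σ.get, o⟩

namespace Routine

variable {x : List Letter} {b h : ℕ} {σ : Regs} {o : List Letter} {A : Type}

theorem run_inc {r : Reg} (hb : (∀ t, σ.get t < 2 ^ b) → σ.get r + 1 < 2 ^ b) :
    Run x b (inc r) (st h σ o) () (st h (σ.set r (σ.get r + 1)) o) := by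
  unfold st
  rw [← Regs.update_get]
  exact .inc hb

theorem run_add {r s : Reg} (hb : (∀ t, σ.get t < 2 ^ b) → σ.get r + σ.get s < 2 ^ b) :
    Run x b (add r s) (st h σ o) () (st h (σ.set r (σ.get r + σ.get s)) o) := by
  unfold st
  rw [← Regs.update_get]
  exact .add hb

theorem run_copy {r s : Reg} :
    Run x b (copy r s) (st h σ o) () (st h (σ.set r (σ.get s)) o) := by
  unfold st
  rw [← Regs.update_get]
  exact .copy

theorem run_lt {r s : Reg} :
    Run x b (lt r s) (st h σ o) (decide (σ.get r < σ.get s)) (st h σ o) :=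
  .lt

/-- Writes a letter. -/
def emit (a : Letter) : Prog Unit := act .stay (some a)

theorem run_emit {a : Letter} : Run x b (emit a) (st h σ o) () (st h σ (o ++ [a])) := by
  intro hs
  have := Run.act (x := x) (b := b) (s := st h σ o) (d := .stay) (o := some a) hs
  have h1 : min (HeadMove.stay.apply (st h σ o).head) (x.length + 1) = h := min_eq_left hs.1
  rw [h1] at this
  exact this

/-- Writes a letter followed by the binary expansion of a register. -/
noncomputable def emitNumeral (m : Letter) (r : Reg) : Prog Unit :=
  emit m >>= fun _ => emitBits Letter.bit r

theorem run_emitNumeral {m : Letter} {r : Reg} :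
    Run x b (emitNumeral m r) (st h σ o) () (st h σ (o ++ numeral m (σ.get r))) := by
  refine .bind run_emit ?_
  have := Run.emitBits (g := Letter.bit) (x := x) (b := b) (s := st h σ (o ++ [m])) (r := r)
  simpa [st, numeral] using this

/-- Repeats a routine as long as `r < s`. -/
noncomputable def whileLt (r s : Reg) (M : Prog Unit) : Prog Unit :=
  loop (fun _ => lt r s >>= fun c => if c then M >>= fun _ => pure ((), true)
    else pure ((), false)) ()

/-- The families `S` and `O` prescribe registers and output before each round, so a loop is verified
one round at a time; the proof is an induction on the number of rounds that remain. -/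
theorem run_whileLt {r s : Reg} {M : Prog Unit} (S : ℕ → Regs) (O : ℕ → List Letter) {K : ℕ}
    (hM : ∀ k < K, (S k).get r < (S k).get s ∧
      Run x b M (st h (S k) (O k)) () (st h (S (k + 1)) (O (k + 1))))
    (hK : (S K).get s ≤ (S K).get r) :
    Run x b (whileLt r s M) (st h (S 0) (O 0)) () (st h (S K) (O K)) := by
  suffices ∀ n k, n + k = K →
      Run x b (whileLt r s M) (st h (S k) (O k)) () (st h (S K) (O K)) from this K 0 (add_zero K)
  intro n
  induction n with
  | zero =>
    rintro k rfl
    rw [zero_add] at hK ⊢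
    refine .loop_done (.bind run_lt ?_)
    rw [if_neg (by simpa using hK)]
    exact .pure
  | succ n ih =>
    intro k hk
    refine .loop_next (.bind run_lt ?_) (ih (k + 1) (by omega))
    rw [if_pos (by simpa using (hM k (by omega)).1)]
    exact .bind (hM k (by omega)).2 .pure

/-- Repeats a routine as long as the scanned symbol is a letter that satisfies `P`. -/
def whileLetter (P : Letter → Bool) (M : Letter → Prog Unit) : Prog Unit :=
  loop (fun _ => read >>= fun c => match c with
    | .letter a => if P a then M a >>= fun _ => pure ((), true) else pure ((), false)
    | _ => pure ((), false)) ()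

theorem run_whileLetter_next {P : Letter → Bool} {M : Letter → Prog Unit} {s s' s'' : Store Reg Letter}
    {a : Letter} (ha : Transducer.readInput x s.head = .letter a) (hP : P a = true)
    (h : Run x b (M a) s () s') (h' : Run x b (whileLetter P M) s' () s'') :
    Run x b (whileLetter P M) s () s'' := by
  refine .loop_next (.bind .read ?_) h'
  rw [ha]
  simp only [hP, if_true]
  exact .bind h .pure

theorem run_whileLetter_done {P : Letter → Bool} {M : Letter → Prog Unit} {s : Store Reg Letter}
    (hP : ∀ a, Transducer.readInput x s.head = .letter a → P a = false) :
    Run x b (whileLetter P M) s () s := by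
  refine .loop_done (.bind .read ?_)
  cases hc : Transducer.readInput x s.head with
  | letter a =>
    simp only [hP a hc]
    exact .pure
  | _ => exact .pure

/-! ### Reading numerals -/

theorem readInput_append (u w : List Letter) (a : Letter) :
    Transducer.readInput (u ++ a :: w) (u.length + 1) = .letter a := by
  simp [Transducer.readInput]

theorem readInput_end (u : List Letter) :
    Transducer.readInput u (u.length + 1) = .rightEnd := by
  simp [Transducer.readInput]

theorem readInput_eq_letter {u w : List Letter} {a : Letter}
    (h : Transducer.readInput (u ++ w) (u.length + 1) = .letter a) : w.head? = some a := by
  cases w with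
  | nil => rw [List.append_nil, readInput_end] at h; simp at h
  | cons c w => rw [readInput_append] at h; simpa using h

theorem readInput_at {u w : List Letter} {a : Letter} (hx : x = u ++ a :: w)
    (hh : h = u.length + 1) : Transducer.readInput x h = .letter a := by
  subst hx hh
  exact readInput_append u w a

theorem head?_of_readInput {u w : List Letter} {a : Letter} (hx : x = u ++ w)
    (hh : h = u.length + 1) (ha : Transducer.readInput x h = .letter a) : w.head? = some a := by
  subst hx hh
  exact readInput_eq_letter ha

theorem run_right (hh : h ≤ x.length) :
    Run x b (act .right none) (st h σ o) () (st (h + 1) σ o) := by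
  have := Run.act (x := x) (b := b) (s := st h σ o) (d := .right) (o := none)
  simpa [st, HeadMove.apply, hh] using this

theorem run_left (hh : h ≤ x.length + 1) :
    Run x b (act .left none) (st h σ o) () (st (h - 1) σ o) := by
  have := Run.act (x := x) (b := b) (s := st h σ o) (d := .left) (o := none)
  simpa [st, HeadMove.apply, show h - 1 ≤ x.length + 1 by omega] using this

end Routine

/-- The letter is a binary digit. -/
def Letter.isBit : Letter → Bool
  | .bit _ => true
  | _ => false

/-- The string does not start with a binary digit. -/
def NoBit (w : List Letter) : Prop := ∀ a, w.head? = some a → a.isBit = false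

namespace Routine

variable {x : List Letter} {b h : ℕ} {σ : Regs} {o : List Letter} {A : Type}

/-- Moves the input head to the right as long as it scans binary digits. -/
def skipBits : Prog Unit := whileLetter Letter.isBit fun _ => act .right none

theorem run_skipBits : ∀ (ds : List Bool) {h h' : ℕ} {u w : List Letter}, NoBit w →
    x = u ++ (ds.map Letter.bit ++ w) → h = u.length + 1 → h' = h + ds.length →
    Run x b skipBits (st h σ o) () (st h' σ o)
  | [], h, h', u, w, hw, hx, hh, hh' => by
    obtain rfl : h' = h := by simpa using hh'
    exact run_whileLetter_done fun a ha => hw a (head?_of_readInput hx hh ha)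
  | d :: ds, h, h', u, w, hw, hx, hh, hh' => by
    refine run_whileLetter_next (a := .bit d) (readInput_at (by simpa using hx) hh) rfl
      (run_right (by simp [hx, hh]))
      (run_skipBits ds (u := u ++ [.bit d]) hw (by simp [hx]) (by simp [hh]) ?_)
    rw [hh', List.length_cons]
    omega

/-- The number with the binary digits `ds`, but at most `N`. -/
def cappedValue (N v : ℕ) (ds : List Bool) : ℕ :=
  ds.foldr (fun d v => min (2 * v + d.toNat) N) v

/-- Capping in every step of Horner's rule amounts to capping the result, because doubling and
adding a digit never brings a value that has reached `N` below `N`. -/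
theorem cappedValue_bits (N a : ℕ) : cappedValue N 0 a.bits = min a N := by
  induction a using Nat.binaryRec' with
  | zero => simp [cappedValue]
  | bit d n h ih =>
    rw [Nat.bits_append_bit n d h]
    rw [cappedValue] at ih ⊢
    rw [List.foldr_cons, ih, Nat.bit_val]
    omega

/-- Moves the input head to the left as long as it scans binary digits, and appends the digits to
`r`, which does not become larger than `len`. -/
noncomputable def horner (r : Reg) : Prog Unit :=
  whileLetter Letter.isBit fun d => add r r >>= fun _ =>
    (match d with
      | .bit true => inc r
      | _ => pure ()) >>= fun _ =>
    lt .len r >>= fun c => (if c then copy r .len else pure ()) >>= fun _ => act .left none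

/-- Horner's rule needs the most significant digit first, which is the last one on the tape; hence
the leftward movement and the induction from the end of the list. Before it is capped, the value is
at most `2 * σ.len + 1`. -/
theorem run_horner {r : Reg} (hr : r ≠ .len) {u : List Letter} {m : Letter}
    (hm : m.isBit = false) (ds : List Bool) : ∀ {h h' v : ℕ} {w : List Letter},
    x = u ++ m :: (ds.map Letter.bit ++ w) → 2 * σ.len + 1 < 2 ^ b → v ≤ σ.len →
    h' = u.length + 1 → h = h' + ds.length →
    Run x b (horner r) (st h (σ.set r v) o) () (st h' (σ.set r (cappedValue σ.len v ds)) o) := by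
  induction ds using List.reverseRecOn with
  | nil =>
    intro h h' v w hx hb hv hh' hh
    obtain rfl : h = h' := by simpa using hh
    refine run_whileLetter_done fun a ha => ?_
    have := (readInput_at (x := x) (u := u) (a := m) (by simpa using hx) hh').symm.trans ha
    simp only [InputSymbol.letter.injEq] at this
    exact this ▸ hm
  | append_singleton ds d ih =>
    intro h h' v w hx hb hv hh' hh
    have hlen : (σ.set r v).get .len = σ.len := by rw [Regs.get_set, if_neg hr.symm]; rfl
    simp only [List.length_append, List.length_singleton] at hh
    refine run_whileLetter_next (a := .bit d) (s' := st (h - 1)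
      (σ.set r (min (2 * v + d.toNat) σ.len)) o)
      (readInput_at (u := u ++ m :: ds.map Letter.bit) (w := w) (by simpa using hx) ?_) rfl ?_ ?_
    · simp [st, hh, hh']; omega
    · refine .bind (a := ()) (s' := st h (σ.set r (2 * v)) o) ?_ (.bind (a := ())
        (s' := st h (σ.set r (2 * v + d.toNat)) o) ?_ (.bind run_lt (.bind (a := ())
          (s' := st h (σ.set r (min (2 * v + d.toNat) σ.len)) o) ?_ (run_left ?_))))
      · convert run_add (r := r) (s := r) ?_ using 2
        · rw [Regs.set_set, Regs.get_set, if_pos rfl, two_mul]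
        · intro _
          rw [Regs.get_set, if_pos rfl]
          omega
      · cases d with
        | true =>
          convert run_inc (r := r) ?_ using 2
          · rw [Regs.set_set, Regs.get_set, if_pos rfl, Bool.toNat_true]
          · intro _
            rw [Regs.get_set, if_pos rfl]
            omega
        | false => exact .pure
      · have h1 : (σ.set r (2 * v + d.toNat)).get .len = σ.len := by
          rw [Regs.get_set, if_neg hr.symm]; rfl
        have h2 : (σ.set r (2 * v + d.toNat)).get r = 2 * v + d.toNat := by
          rw [Regs.get_set, if_pos rfl]
        rw [h1, h2]
        split_ifs with hc
        · convert run_copy (r := r) (s := .len) using 2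
          rw [Regs.set_set, h1]
          congr 1
          exact min_eq_right (by simp at hc; omega)
        · rw [min_eq_left (by simpa using hc)]
          exact .pure
      · simp only [hx, hh, hh', List.length_append, List.length_cons, List.length_map]
        omega
    · have h1 : cappedValue σ.len v (ds ++ [d]) =
          cappedValue σ.len (min (2 * v + d.toNat) σ.len) ds := List.foldr_append
      rw [h1]
      exact ih (w := .bit d :: w) (by simpa using hx) hb (min_le_right _ _) hh'
        (show h - 1 = h' + ds.length by omega)

/-- Reads the numeral that starts at the scanned letter and moves to its end; stores its value
in `r`, but not more than `len`. -/
noncomputable def readNumeral (r : Reg) : Prog Unit :=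
  copy r .zero >>= fun _ => act .right none >>= fun _ => skipBits >>= fun _ =>
    act .left none >>= fun _ => horner r >>= fun _ => act .right none >>= fun _ => skipBits

/-- The digits are crossed three times: to find their end, to evaluate them from right to left, and
to move on. For `a = 0` there are no digits, and the step back to the left returns to the mark,
where `horner` stops at once. -/
theorem run_readNumeral {r : Reg} (hr : r ≠ .len) {u w : List Letter} {m : Letter}
    (hm : m.isBit = false) {a h h' : ℕ} (hx : x = u ++ (numeral m a ++ w)) (hw : NoBit w)
    (hz : σ.zero = 0) (hb : 2 * σ.len + 1 < 2 ^ b) (hh : h = u.length + 1)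
    (hh' : h' = (u ++ numeral m a).length + 1) :
    Run x b (readNumeral r) (st h σ o) () (st h' (σ.set r (min a σ.len)) o) := by
  have hx' : x = u ++ m :: (a.bits.map Letter.bit ++ w) := by simpa [numeral] using hx
  have hh2 : h' = h + 1 + a.bits.length := by rw [hh', hh]; simp [numeral]; omega
  have hl : x.length = u.length + 1 + a.bits.length + w.length := by rw [hx']; simp; omega
  have hskip : ∀ σ : Regs, Run x b skipBits (st (h + 1) σ o) () (st h' σ o) := fun σ =>
    run_skipBits a.bits (u := u ++ [m]) (w := w) hw (by simpa using hx') (by simp [hh]) (by omega)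
  refine .bind run_copy (.bind (run_right (by omega)) (.bind (hskip _) (.bind (run_left (by omega))
    (.bind (a := ()) (s' := st h (σ.set r (min a σ.len)) o) ?_
      (.bind (run_right (by omega)) (hskip _))))))
  rw [← cappedValue_bits]
  have h0 : σ.get .zero = 0 := hz
  rw [h0]
  exact run_horner hr hm a.bits hx' hb (Nat.zero_le _) hh (by omega)

end Routine

/-! ### The reduction as a program -/

/-- The code of an edge with ends `u` and `v`. -/
def edgeText (c : Letter) (u v : ℕ) : List Letter := numeral c u ++ numeral .comma v

/-- The text in the second pass, nothing in the first one. -/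
def onPass (second : Bool) (l : List Letter) : List Letter := if second then l else []

theorem onPass_append (second : Bool) (l l' : List Letter) :
    onPass second (l ++ l') = onPass second l ++ onPass second l' := by
  cases second <;> rfl

@[simp]
theorem onPass_nil (second : Bool) : onPass second [] = [] := by cases second <;> rfl

/-! ### The gadgets of the vertices -/

/-- The edges between the vertex `c` and the `K` ports from `vb` on. -/
def portText (vb c K : ℕ) : List Letter :=
  (List.range K).flatMap fun e => edgeText .plain (vb + e) c

/-- The edges at the first `K` extra vertices of a vertex whose ports are numbered from `vb` on. -/
def extraText (N vb c K : ℕ) : List Letter :=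
  (List.range K).flatMap fun i => portText vb (c + i) N

/-- The edges of the gadgets for vertices with given capacities. -/
def vertexText (N : ℕ) : ℕ → ℕ → List ℕ → List Letter
  | _, _, [] => []
  | vb, c, k :: ks => extraText N vb c (N - k) ++ vertexText N (vb + N) (c + (N - k)) ks

namespace Routine

variable {x : List Letter} {b h : ℕ} {σ : Regs} {o : List Letter} {A : Type}

/-- Writes the edge between the vertices `r` and `s`, in the second pass only. -/
noncomputable def emitEdge (second : Bool) (c : Letter) (r s : Reg) : Prog Unit :=
  if second then emitNumeral c r >>= fun _ => emitNumeral .comma s else pure ()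

theorem run_emitEdge {second : Bool} {c : Letter} {r s : Reg} :
    Run x b (emitEdge second c r s) (st h σ o) ()
      (st h σ (o ++ onPass second (edgeText c (σ.get r) (σ.get s)))) := by
  cases second with
  | false => simpa [emitEdge, onPass] using .pure
  | true =>
    have := Run.bind (k := fun _ => emitNumeral .comma s) (run_emitNumeral (x := x) (b := b)
      (h := h) (σ := σ) (o := o) (m := c) (r := r)) run_emitNumeral
    simpa [emitEdge, onPass, edgeText] using this

/-- Joins the vertex `next` to all ports of a vertex. -/
noncomputable def joinPorts (second : Bool) : Prog Unit :=
  copy .p .base >>= fun _ =>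
  whileLt .e .len (emitEdge second .plain .p .next >>= fun _ => inc .p >>= fun _ => inc .e) >>=
    fun _ => copy .e .zero >>= fun _ => copy .p .zero

theorem run_joinPorts {second : Bool} {N n c vb i a j : ℕ} (hb : vb + N < 2 ^ b) :
    Run x b (joinPorts second) (st h ⟨0, N, n, c, vb, i, 0, a, 0, 0, 0, j⟩ o) ()
      (st h ⟨0, N, n, c, vb, i, 0, a, 0, 0, 0, j⟩ (o ++ onPass second (portText vb c N))) := by
  refine .bind run_copy (.bind (a := ()) (s' := st h ⟨0, N, n, c, vb, i, N, a, 0, vb + N, 0, j⟩ _)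
    ?_ (.bind run_copy run_copy))
  have := run_whileLt (x := x) (b := b) (h := h) (r := .e) (s := .len)
    (M := (emitEdge second .plain .p .next >>= fun _ => inc .p >>= fun _ => inc .e))
    (fun k => ⟨0, N, n, c, vb, i, k, a, 0, vb + k, 0, j⟩)
    (fun k => o ++ onPass second (portText vb c k)) (K := N) (fun k hk => ⟨hk, ?_⟩) le_rfl
  · simpa [portText, Regs.set, Regs.get] using this
  · refine .bind run_emitEdge (.bind (run_inc ?_) ?_)
    · intro _
      change vb + k + 1 < _
      omega
    · simp only [portText, List.range_succ, List.flatMap_append, onPass_append, ← List.append_assoc,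
        List.flatMap_singleton]
      refine run_inc fun h => ?_
      have : N < _ := h .len
      change k + 1 < _
      omega

/-- Creates the extra vertices of a vertex with the capacity `a`. -/
noncomputable def extras (second : Bool) : Prog Unit :=
  copy .i .a >>= fun _ =>
  whileLt .i .len (joinPorts second >>= fun _ => inc .next >>= fun _ => inc .i) >>=
    fun _ => copy .i .zero >>= fun _ => copy .a .zero

theorem run_extras {second : Bool} {N n c vb a j : ℕ} (hb : vb + N < 2 ^ b) (hc : c + N < 2 ^ b) :
    Run x b (extras second) (st h ⟨0, N, n, c, vb, 0, 0, min a N, 0, 0, 0, j⟩ o) ()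
      (st h ⟨0, N, n, c + (N - a), vb, 0, 0, 0, 0, 0, 0, j⟩
        (o ++ onPass second (extraText N vb c (N - a)))) := by
  -- The counter runs from `min a N` up to `N`, so there are `N - a` rounds in truncated
  -- subtraction, and none if `a` is at least `N`.
  refine .bind run_copy (.bind (a := ())
    (s' := st h ⟨0, N, n, c + (N - a), vb, min a N + (N - a), 0, min a N, 0, 0, 0, j⟩ _)
    ?_ (.bind run_copy run_copy))
  have := run_whileLt (x := x) (b := b) (h := h) (r := .i) (s := .len)
    (M := (joinPorts second >>= fun _ => inc .next >>= fun _ => inc .i))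
    (fun k => ⟨0, N, n, c + k, vb, min a N + k, 0, min a N, 0, 0, 0, j⟩)
    (fun k => o ++ onPass second (extraText N vb c k)) (K := N - a) (fun k hk => ⟨?_, ?_⟩) ?_
  · simpa [extraText, Regs.set, Regs.get] using this
  · change min a N + k < N
    omega
  · refine .bind (run_joinPorts hb) (.bind (run_inc ?_) ?_)
    · intro _
      change c + k + 1 < _
      omega
    · simp only [extraText, List.range_succ, List.flatMap_append, onPass_append, ← List.append_assoc,
        List.flatMap_singleton]
      refine run_inc fun h => ?_
      have : N < _ := h .len
      change min a N + k + 1 < _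
      omega
  · change N ≤ min a N + (N - a)
    omega

end Routine

/-- The letter is the mark of a vertex. -/
def Letter.isVertex : Letter → Bool
  | .vertex => true
  | _ => false

/-- The letter is a colour. -/
def Letter.isColour : Letter → Bool
  | .plain => true
  | .red => true
  | .blue => true
  | _ => false

/-- The number of extra vertices. -/
def extraCount (N : ℕ) (caps : List ℕ) : ℕ := (caps.map (N - ·)).sum

namespace Routine

variable {x : List Letter} {b h : ℕ} {σ : Regs} {o : List Letter} {A : Type}

/-- Creates the gadgets of all vertices. -/
noncomputable def vertexPass (second : Bool) : Prog Unit :=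
  whileLetter Letter.isVertex fun _ => readNumeral .a >>= fun _ => extras second >>= fun _ =>
    add .base .len

theorem noBit_numeral {m : Letter} (hm : m.isBit = false) (a : ℕ) (w : List Letter) :
    NoBit (numeral m a ++ w) := by
  intro c hc
  simp only [numeral, List.cons_append, List.head?_cons, Option.some.injEq] at hc
  exact hc ▸ hm

/-- Each vertex advances `vb` by its `N` ports and `c` by at most `N` extra vertices. The additional
block in `caps.length + 1` leaves room for the auxiliary counters of the current gadget. -/
theorem run_vertexPass {second : Bool} {N n j : ℕ} : ∀ (caps : List ℕ) {h c vb : ℕ}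
    {o u w : List Letter}, NoBit w → (∀ a, w.head? = some a → a.isVertex = false) →
    x = u ++ (caps.flatMap (fun k => numeral .vertex k) ++ w) → h = u.length + 1 →
    2 * N + 1 < 2 ^ b → vb + N * (caps.length + 1) < 2 ^ b → c + N * (caps.length + 1) < 2 ^ b →
    Run x b (vertexPass second) (st h ⟨0, N, n, c, vb, 0, 0, 0, 0, 0, 0, j⟩ o) ()
      (st (h + (caps.flatMap fun k => numeral .vertex k).length)
        ⟨0, N, n, c + extraCount N caps, vb + N * caps.length, 0, 0, 0, 0, 0, 0, j⟩
        (o ++ onPass second (vertexText N vb c caps)))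
  | [], h, c, vb, o, u, w, hw, hw', hx, hh, hN, hb, hc => by
    have := run_whileLetter_done (x := x) (b := b) (P := Letter.isVertex)
      (s := st h ⟨0, N, n, c, vb, 0, 0, 0, 0, 0, 0, j⟩ o) (M := fun _ => readNumeral .a >>= fun _ =>
        extras second >>= fun _ => add .base .len)
      fun a ha => hw' a (head?_of_readInput (by simpa using hx) hh ha)
    simpa [vertexText, extraCount, vertexPass] using this
  | k :: ks, h, c, vb, o, u, w, hw, hw', hx, hh, hN, hb, hc => by
    have hx' : x = u ++ (numeral .vertex k ++ (ks.flatMap (fun k => numeral .vertex k) ++ w)) := by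
      simpa using hx
    simp only [List.length_cons, Nat.mul_add] at hb hc
    have hb' : vb + N < 2 ^ b := by omega
    have hc' : c + N < 2 ^ b := by omega
    have ih := run_vertexPass (second := second) (n := n) (j := j) ks (h := h + (numeral .vertex k).length)
      (c := c + (N - k)) (vb := vb + N) (o := o ++ onPass second (extraText N vb c (N - k)))
      (u := u ++ numeral .vertex k) hw hw' (by simpa using hx) (by simp [hh]; omega) hN
      (by simp only [Nat.mul_add]; omega) (by simp only [Nat.mul_add]; omega)
    refine run_whileLetter_next (a := .vertex) (readInput_at (by simpa [numeral] using hx') hh) rfl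
      (.bind (run_readNumeral (by decide) rfl hx' ?_ rfl hN hh rfl) (.bind
        (run_extras hb' hc') (run_add ?_))) ?_
    · cases ks with
      | nil => simpa using hw
      | cons k' ks =>
        simp only [List.flatMap_cons, List.append_assoc]
        exact noBit_numeral rfl _ _
    · intro _
      change vb + N < _
      omega
    · have h1 : c + extraCount N (k :: ks) = c + (N - k) + extraCount N ks := by
        simp [extraCount, add_assoc]
      have h2 : vb + N * (k :: ks).length = vb + N + N * ks.length := by
        rw [List.length_cons]; ring
      have h3 : h + ((k :: ks).flatMap fun k => numeral .vertex k).length =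
          h + (numeral .vertex k).length + (ks.flatMap fun k => numeral .vertex k).length := by
        rw [List.flatMap_cons, List.length_append, add_assoc]
      rw [h1, h2, h3, vertexText, onPass_append, ← List.append_assoc]
      have h4 : (u ++ numeral .vertex k).length + 1 = h + (numeral .vertex k).length := by
        rw [hh, List.length_append]; omega
      rw [h4]
      exact ih

end Routine

/-! ### The paths that replace the edges -/

/-- The colour of the edges of a path that represents an edge with the colour `m`, apart from the
last one and those that are always plain. -/
def Letter.pathColour : Letter → Letter
  | .blue => .red
  | _ => .plain

/-- The colour of the last edge of a path that represents an edge with the colour `m`. -/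
def Letter.lastColour : Letter → Letter
  | .plain => .plain
  | _ => .red

/-- The end of the path after `2 * k + 1` vertices, if it starts in `p` and goes on in `c`. -/
def pathEnd (p c k : ℕ) : ℕ := if k = 0 then p else c + 2 * k - 1

/-- The first `2 * k` edges of a path that represents an edge with the colour `m`. -/
def pathText (m : Letter) (p c k : ℕ) : List Letter :=
  (List.range k).flatMap fun i => edgeText m.pathColour (pathEnd p c i) (c + 2 * i) ++
    edgeText .plain (c + 2 * i) (c + 2 * i + 1)

/-- The path for an edge with the colour `m` and the ends `u` and `v`. -/
def linkText (N : ℕ) (m : Letter) (j c u v : ℕ) : List Letter :=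
  pathText m (j + N * u) c N ++ edgeText m.lastColour (pathEnd (j + N * u) c N) (j + N * v)

/-- A letter that does not occur in the code of a graph, if the numbers are not the ends of an edge
of a graph with `n` vertices. -/
def alarmText (n u v : ℕ) : List Letter := if u < n ∧ v < n ∧ u ≠ v then [] else [.blue]

/-- The paths for the given edges. -/
def edgesText (N n : ℕ) : ℕ → ℕ → List (Letter × ℕ × ℕ) → List Letter
  | _, _, [] => []
  | j, c, (m, u, v) :: es => alarmText n (min u N) (min v N) ++
      linkText N m j c (min u N) (min v N) ++ edgesText N n (j + 1) (c + 2 * N) es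

/-- The code of an edge with the colour `m` and the ends `u` and `v`. -/
def rawEdge (e : Letter × ℕ × ℕ) : List Letter := edgeText e.1 e.2.1 e.2.2

namespace Routine

variable {x : List Letter} {b h : ℕ} {σ : Regs} {o : List Letter} {A : Type}

/-- Computes the name of a port of the vertex `a`. -/
noncomputable def portName : Prog Unit :=
  copy .p .j >>= fun _ => whileLt .i .a (add .p .len >>= fun _ => inc .i) >>= fun _ => copy .i .zero

theorem run_portName {N n c vb a a' p p' j : ℕ} (hb : j + N * (a + 1) < 2 ^ b) :
    Run x b portName (st h ⟨0, N, n, c, vb, 0, 0, a, a', p, p', j⟩ o) ()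
      (st h ⟨0, N, n, c, vb, 0, 0, a, a', j + N * a, p', j⟩ o) := by
  refine .bind run_copy (.bind (a := ())
    (s' := st h ⟨0, N, n, c, vb, a, 0, a, a', j + N * a, p', j⟩ o) ?_ run_copy)
  have := run_whileLt (x := x) (b := b) (h := h) (r := .i) (s := .a)
    (M := (add .p .len >>= fun _ => inc .i))
    (fun k => ⟨0, N, n, c, vb, k, 0, a, a', j + N * k, p', j⟩)
    (fun k => o) (K := a) (fun k hk => ⟨hk, ?_⟩) le_rfl
  · simpa [Regs.set, Regs.get] using this
  · have h1 : j + N * (k + 1) = j + N * k + N := by ring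
    rw [h1]
    refine .bind (run_add fun h => ?_) (run_inc fun h => ?_)
    · change j + N * k + N < _
      have := Nat.mul_le_mul_left N (show k + 1 ≤ a + 1 by omega)
      have := Nat.mul_succ N k
      omega
    · have : a < _ := h .a
      change k + 1 < _
      omega

/-- Writes a path from `p'` to `p`. -/
noncomputable def path (second : Bool) (m : Letter) : Prog Unit :=
  whileLt .i .len (emitEdge second m.pathColour .p' .next >>= fun _ =>
    copy .p' .next >>= fun _ => inc .p' >>= fun _ => emitEdge second .plain .next .p' >>= fun _ =>
    copy .next .p' >>= fun _ => inc .next >>= fun _ => inc .i) >>= fun _ =>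
  copy .i .zero >>= fun _ => emitEdge second m.lastColour .p' .p

/-- Throughout the loop `p'` holds the current end of the path and `next` the first unused name.
Each round appends two inner vertices; the edge to the port `p` is written after the loop. -/
theorem run_path {second : Bool} {m : Letter} {N n c vb a a' p p' j : ℕ} (hb : c + 2 * N < 2 ^ b) :
    Run x b (path second m) (st h ⟨0, N, n, c, vb, 0, 0, a, a', p, p', j⟩ o) ()
      (st h ⟨0, N, n, c + 2 * N, vb, 0, 0, a, a', p, pathEnd p' c N, j⟩ (o ++ onPass second
        (pathText m p' c N ++ edgeText m.lastColour (pathEnd p' c N) p))) := by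
  rw [onPass_append, ← List.append_assoc]
  refine .bind (a := ()) (s' := st h ⟨0, N, n, c + 2 * N, vb, N, 0, a, a', p, pathEnd p' c N, j⟩
    (o ++ onPass second (pathText m p' c N))) ?_ (.bind run_copy run_emitEdge)
  have := run_whileLt (x := x) (b := b) (h := h) (r := .i) (s := .len)
    (M := (emitEdge second m.pathColour .p' .next >>= fun _ =>
      copy .p' .next >>= fun _ => inc .p' >>= fun _ => emitEdge second .plain .next .p' >>= fun _ =>
      copy .next .p' >>= fun _ => inc .next >>= fun _ => inc .i))
    (fun k => ⟨0, N, n, c + 2 * k, vb, k, 0, a, a', p, pathEnd p' c k, j⟩)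
    (fun k => o ++ onPass second (pathText m p' c k)) (K := N) (fun k hk => ⟨hk, ?_⟩) le_rfl
  · simpa [pathText, pathEnd, Regs.set, Regs.get] using this
  · refine .bind run_emitEdge (.bind run_copy (.bind (run_inc fun h => ?_) (.bind run_emitEdge
      (.bind run_copy (.bind (run_inc fun h => ?_) ?_)))))
    · change c + 2 * k + 1 < _
      omega
    · change c + 2 * k + 1 + 1 < _
      omega
    · have h1 : pathEnd p' c (k + 1) = c + 2 * k + 1 := by
        rw [pathEnd, if_neg (by omega)]; omega
      simp only [pathText, List.range_succ, List.flatMap_append, onPass_append, ← List.append_assoc,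
        List.flatMap_singleton, h1]
      refine run_inc fun h => ?_
      have : N < _ := h .len
      change k + 1 < _
      omega

/-- Writes a letter that does not occur in the code of a graph, if `a` and `a'` are not the ends of
an edge. -/
noncomputable def alarm (second : Bool) : Prog Unit :=
  lt .a .num >>= fun c₁ => lt .a' .num >>= fun c₂ => lt .a .a' >>= fun c₃ => lt .a' .a >>= fun c₄ =>
    if (c₁ && c₂ && (c₃ || c₄)) || !second then pure () else emit .blue

theorem run_alarm {second : Bool} :
    Run x b (alarm second) (st h σ o) ()
      (st h σ (o ++ onPass second (alarmText σ.num σ.a σ.a'))) := by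
  refine .bind run_lt (.bind run_lt (.bind run_lt (.bind run_lt ?_)))
  have h1 : (σ.get .a < σ.get .num ∧ σ.get .a' < σ.get .num ∧ σ.get .a ≠ σ.get .a') ↔
      (σ.a < σ.num ∧ σ.a' < σ.num ∧ σ.a ≠ σ.a') := Iff.rfl
  cases second with
  | false => simpa [onPass] using .pure
  | true =>
    unfold alarmText
    rw [if_congr h1.symm rfl rfl]
    by_cases hc : σ.get .a < σ.get .num ∧ σ.get .a' < σ.get .num ∧ σ.get .a ≠ σ.get .a'
    · rw [if_pos hc, if_pos]
      · simpa using .pure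
      · simp; omega
    · rw [if_neg hc, if_neg]
      · exact run_emit
      · simp; omega

/-- Creates the path for an edge. -/
noncomputable def link (second : Bool) (m : Letter) : Prog Unit :=
  readNumeral .a >>= fun _ => readNumeral .a' >>= fun _ => alarm second >>= fun _ =>
  portName >>= fun _ => copy .p' .p >>= fun _ => copy .a .a' >>= fun _ => portName >>= fun _ =>
  path second m >>= fun _ => copy .a .zero >>= fun _ => copy .a' .zero >>= fun _ =>
  copy .p .zero >>= fun _ => copy .p' .zero >>= fun _ => inc .j

/-- The ends are capped at `N`, so the computed port names stay below `j + N * (N + 1)` even when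
the numerals in the input are huge. -/
theorem run_link {second : Bool} {m : Letter} (hm : m.isBit = false) {N n c vb j k l : ℕ}
    {u w : List Letter} (hw : NoBit w) (hx : x = u ++ (edgeText m k l ++ w)) (hh : h = u.length + 1)
    (hb : 2 * N + 1 < 2 ^ b) (hc : c + 2 * N < 2 ^ b) (hj : j + N * (N + 1) < 2 ^ b)
    (hj' : j + 1 < 2 ^ b) :
    Run x b (link second m) (st h ⟨0, N, n, c, vb, 0, 0, 0, 0, 0, 0, j⟩ o) ()
      (st ((u ++ edgeText m k l).length + 1) ⟨0, N, n, c + 2 * N, vb, 0, 0, 0, 0, 0, 0, j + 1⟩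
        (o ++ onPass second (alarmText n (min k N) (min l N) ++
          linkText N m j c (min k N) (min l N)))) := by
  rw [onPass_append, ← List.append_assoc]
  have hk : N * (min k N + 1) ≤ N * (N + 1) :=
    Nat.mul_le_mul_left N (Nat.succ_le_succ (min_le_right k N))
  have hl : N * (min l N + 1) ≤ N * (N + 1) :=
    Nat.mul_le_mul_left N (Nat.succ_le_succ (min_le_right l N))
  have hk' : j + N * (min k N + 1) < 2 ^ b := by omega
  have hl' : j + N * (min l N + 1) < 2 ^ b := by omega
  exact .bind (run_readNumeral (by decide) hm (w := numeral .comma l ++ w)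
      (by simpa [edgeText] using hx) (noBit_numeral rfl _ _) rfl hb hh rfl)
    (.bind (run_readNumeral (u := u ++ numeral m k) (a := l)
      (h' := (u ++ edgeText m k l).length + 1) (by decide) (m := .comma) rfl
      (by simpa [edgeText] using hx) hw rfl hb (by simp) (by simp [edgeText])) (.bind run_alarm
    (.bind (run_portName hk') (.bind run_copy (.bind run_copy (.bind (run_portName hl')
    (.bind (run_path hc) (.bind run_copy (.bind run_copy (.bind run_copy (.bind run_copy
    (run_inc fun _ => hj'))))))))))))

/-- Creates the paths for all edges. -/
noncomputable def edgePass (second : Bool) : Prog Unit :=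
  whileLetter Letter.isColour (link second)

theorem run_edgePass {second : Bool} {N n vb : ℕ} : ∀ (es : List (Letter × ℕ × ℕ)) {h c j : ℕ}
    {o u w : List Letter}, NoBit w → (∀ a, w.head? = some a → a.isColour = false) →
    (∀ e ∈ es, e.1.isColour = true) →
    x = u ++ (es.flatMap rawEdge ++ w) → h = u.length + 1 →
    2 * N + 1 < 2 ^ b → c + 2 * N * es.length < 2 ^ b →
    j + es.length + N * (N + 1) < 2 ^ b →
    Run x b (edgePass second) (st h ⟨0, N, n, c, vb, 0, 0, 0, 0, 0, 0, j⟩ o) ()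
      (st (h + (es.flatMap rawEdge).length)
        ⟨0, N, n, c + 2 * N * es.length, vb, 0, 0, 0, 0, 0, 0, j + es.length⟩
        (o ++ onPass second (edgesText N n j c es)))
  | [], h, c, j, o, u, w, hw, hw', hes, hx, hh, hN, hc, hj => by
    have := run_whileLetter_done (x := x) (b := b) (P := Letter.isColour)
      (s := st h ⟨0, N, n, c, vb, 0, 0, 0, 0, 0, 0, j⟩ o) (M := link second)
      fun a ha => hw' a (head?_of_readInput (by simpa using hx) hh ha)
    simpa [edgesText, edgePass] using this
  | (m, k, l) :: es, h, c, j, o, u, w, hw, hw', hes, hx, hh, hN, hc, hj => by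
    have hx' : x = u ++ (edgeText m k l ++ (es.flatMap rawEdge ++ w)) := by
      simpa [rawEdge] using hx
    have hm : m.isColour = true := hes _ List.mem_cons_self
    have hm' : m.isBit = false := by cases m <;> first | rfl | cases hm
    have hes' : ∀ e ∈ es, e.1.isColour = true := fun e he => hes e (List.mem_cons_of_mem _ he)
    rw [List.length_cons] at hj
    rw [List.length_cons, Nat.mul_succ] at hc
    refine run_whileLetter_next (a := m) (readInput_at (by simpa [edgeText, numeral] using hx') hh)
      hm (run_link (w := es.flatMap rawEdge ++ w) hm' ?_ hx' hh hN (by omega) (by omega) (by omega))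
      ?_
    · cases es with
      | nil => simpa using hw
      | cons e es =>
        simp only [List.flatMap_cons, List.append_assoc, rawEdge, edgeText]
        refine noBit_numeral ?_ _ _
        have he := hes' e List.mem_cons_self
        cases h : e.1 <;> simp_all [Letter.isColour, Letter.isBit]
    · have ih := run_edgePass (second := second) (n := n) (vb := vb) es (c := c + 2 * N) (j := j + 1)
        (o := o ++ onPass second (alarmText n (min k N) (min l N) ++
          linkText N m j c (min k N) (min l N)))
        (u := u ++ edgeText m k l) hw hw' hes' (by simpa using hx') rfl hN (by omega) (by omega)
      have h1 : c + 2 * N * ((m, k, l) :: es).length = c + 2 * N + 2 * N * es.length := by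
        rw [List.length_cons]; ring
      have h2 : j + ((m, k, l) :: es).length = j + 1 + es.length := by rw [List.length_cons]; ring
      have h3 : h + (((m, k, l) :: es).flatMap rawEdge).length =
          (u ++ edgeText m k l).length + 1 + (es.flatMap rawEdge).length := by
        rw [List.flatMap_cons, List.length_append, hh, List.length_append]
        simp only [rawEdge]; omega
      rw [h1, h2, h3, edgesText, onPass_append _ (_ ++ _), ← List.append_assoc]
      exact ih

end Routine

/-! ### Recognition of the encodings -/

/-- The text that lists the capacities, the edges and the two targets. -/
def inputText (caps : List ℕ) (es : List (Letter × ℕ × ℕ)) (k l : ℕ) : List Letter :=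
  caps.flatMap (fun a => numeral .vertex a) ++
    (es.flatMap rawEdge ++ (numeral .target k ++ numeral .target l))

/-- The kind of the last mark that has been read. -/
inductive Phase : Type where
  | start | vertex | colour | comma | target | final
  deriving DecidableEq

instance : Fintype Phase :=
  ⟨{.start, .vertex, .colour, .comma, .target, .final}, by rintro (_ | _) <;> decide⟩

/-- The marks that may follow. -/
def Phase.next : Phase → Letter → Option Phase
  | .start, .vertex => some .vertex
  | .vertex, .vertex => some .vertex
  | .start, .target => some .target
  | .vertex, .target => some .target
  | .comma, .target => some .target
  | .target, .target => some .final
  | .colour, .comma => some .comma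
  | .start, a => if a.isColour then some .colour else none
  | .vertex, a => if a.isColour then some .colour else none
  | .comma, a => if a.isColour then some .colour else none
  | _, _ => none

/-- The automaton that recognizes the encodings; the second component of the state tells whether
the last letter is the digit `0`. -/
def recognize : Option (Phase × Bool) → Letter → Option (Phase × Bool)
  | none, _ => none
  | some (φ, _), .bit d => if φ = .start then none else some (φ, !d)
  | some (φ, z), a => if z then none else (φ.next a).map fun ψ => (ψ, false)

theorem foldl_recognize_none (w : List Letter) : w.foldl recognize none = none := by
  induction w with
  | nil => rfl
  | cons a w ih => exact ih

theorem getLast?_bits (a : ℕ) : a.bits.getLast? ≠ some false := by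
  induction a using Nat.binaryRec' with
  | zero => simp
  | bit d n h ih =>
    rw [Nat.bits_append_bit n d h]
    by_cases hn : n = 0
    · subst hn; simp [h rfl]
    · cases hb : n.bits with
      | nil => exact absurd (Nat.size_eq_zero.1 (by rw [← Nat.size_eq_bits_len, hb]; rfl)) hn
      | cons e es => rw [List.getLast?_cons_cons, ← hb]; exact ih

theorem exists_bits_eq : ∀ ds : List Bool, ds.getLast? ≠ some false → ∃ a : ℕ, a.bits = ds
  | [], _ => ⟨0, by simp⟩
  | [d], h => ⟨1, by cases d <;> simp_all⟩
  | d :: e :: ds, h => by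
    obtain ⟨a, ha⟩ := exists_bits_eq (e :: ds) (by rwa [List.getLast?_cons_cons] at h)
    refine ⟨Nat.bit d a, ?_⟩
    rw [Nat.bits_append_bit a d (by rintro rfl; simp at ha), ha]

theorem foldl_recognize_bits {φ : Phase} (hφ : φ ≠ .start) : ∀ (ds : List Bool) (z : Bool),
    (ds.map Letter.bit).foldl recognize (some (φ, z)) =
      some (φ, (ds.getLast?.map not).getD z)
  | [], z => rfl
  | [d], z => by simp [recognize, hφ]
  | d :: e :: ds, z => by
    have := foldl_recognize_bits hφ (e :: ds) (!d)
    simp only [List.map_cons, List.foldl_cons, recognize, hφ, if_false] at this ⊢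
    rw [this, List.getLast?_cons_cons]
    cases h : (e :: ds).getLast? with
    | none => simp at h
    | some => rfl

/-- The binary expansion of a number never ends with the digit `0`, so after a numeral the flag is
`false` and the next mark is accepted. -/
theorem foldl_recognize_numeral {φ ψ : Phase} {m : Letter} (h : φ.next m = some ψ)
    (hψ : ψ ≠ .start) (a : ℕ) (w : List Letter) :
    (numeral m a ++ w).foldl recognize (some (φ, false)) =
      w.foldl recognize (some (ψ, false)) := by
  have hm : recognize (some (φ, false)) m = some (ψ, false) := by
    cases m with
    | bit d => cases φ <;> simp [Phase.next, Letter.isColour] at h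
    | _ => simp [recognize, h]
  rw [numeral, List.cons_append, List.foldl_cons, hm, List.foldl_append,
    foldl_recognize_bits hψ]
  congr 1
  have := getLast?_bits a
  cases hl : a.bits.getLast? with
  | none => rfl
  | some d => cases d <;> simp_all

theorem foldl_recognize_edges {φ : Phase} (hφ : φ = .start ∨ φ = .vertex ∨ φ = .comma)
    {es : List (Letter × ℕ × ℕ)} (hes : ∀ e ∈ es, e.1.isColour = true) (k l : ℕ) :
    (es.flatMap rawEdge ++ (numeral .target k ++ numeral .target l)).foldl recognize
      (some (φ, false)) = some (.final, false) := by
  induction es generalizing φ with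
  | nil =>
    rw [List.flatMap_nil, List.nil_append, foldl_recognize_numeral (ψ := .target)
      (by rcases hφ with rfl | rfl | rfl <;> rfl) (by decide), ← List.append_nil (numeral _ l),
      foldl_recognize_numeral (ψ := .final) rfl (by decide)]
    rfl
  | cons e es ih =>
    have he : e.1.isColour = true := hes _ List.mem_cons_self
    rw [List.flatMap_cons, rawEdge, edgeText, List.append_assoc, List.append_assoc,
      foldl_recognize_numeral (ψ := .colour) ?_ (by decide),
      foldl_recognize_numeral (ψ := .comma) rfl (by decide)]
    · exact ih (by simp) fun e he => hes e (List.mem_cons_of_mem _ he)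
    · obtain ⟨m, u, v⟩ := e
      rcases hφ with rfl | rfl | rfl <;> cases m <;> first | rfl | cases he

theorem foldl_recognize_inputText (caps : List ℕ) {es : List (Letter × ℕ × ℕ)}
    (hes : ∀ e ∈ es, e.1.isColour = true) (k l : ℕ) :
    (inputText caps es k l).foldl recognize (some (.start, false)) = some (.final, false) := by
  suffices ∀ φ : Phase, φ = .start ∨ φ = .vertex →
      (inputText caps es k l).foldl recognize (some (φ, false)) = some (.final, false) from
    this _ (.inl rfl)
  induction caps with
  | nil => exact fun φ hφ => foldl_recognize_edges (by tauto) hes k l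
  | cons a caps ih =>
    intro φ hφ
    rw [inputText, List.flatMap_cons, List.append_assoc,
      foldl_recognize_numeral (ψ := .vertex) (by rcases hφ with rfl | rfl <;> rfl) (by decide)]
    exact ih _ (.inr rfl)

/-- What may follow the numeral of the last mark. -/
def Phase.Rest : Phase → List Letter → Prop
  | .start, w => ∃ caps es k l, (∀ e ∈ es, e.1.isColour = true) ∧ w = inputText caps es k l
  | .vertex, w => ∃ caps es k l, (∀ e ∈ es, e.1.isColour = true) ∧ w = inputText caps es k l
  | .comma, w => ∃ es k l, (∀ e ∈ es, e.1.isColour = true) ∧ w = inputText [] es k l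
  | .colour, w => ∃ a es k l, (∀ e ∈ es, e.1.isColour = true) ∧
      w = numeral .comma a ++ inputText [] es k l
  | .target, w => ∃ l, w = numeral .target l
  | .final, w => w = []

/-- Every transition of the automaton corresponds to prepending one numeral to one of the patterns
of `Phase.Rest`. -/
theorem Phase.rest_numeral {φ ψ : Phase} {m : Letter} (h : φ.next m = some ψ) {a : ℕ}
    {w : List Letter} (hw : ψ.Rest w) : φ.Rest (numeral m a ++ w) := by
  have key : m.isColour = true → Phase.colour.Rest w →
      ∃ es k l, (∀ e ∈ es, e.1.isColour = true) ∧ numeral m a ++ w = inputText [] es k l := by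
    rintro hm ⟨a', es, k, l, hes, rfl⟩
    refine ⟨(m, a, a') :: es, k, l, by simpa [hm] using hes, ?_⟩
    simp [inputText, rawEdge, edgeText]
  have key' : Phase.target.Rest w →
      ∃ es k l, (∀ e ∈ es, e.1.isColour = true) ∧ numeral .target a ++ w = inputText [] es k l := by
    rintro ⟨l, rfl⟩
    exact ⟨[], a, l, by simp, by simp [inputText]⟩
  have key'' : Phase.vertex.Rest w → ∃ caps es k l, (∀ e ∈ es, e.1.isColour = true) ∧
      numeral .vertex a ++ w = inputText caps es k l := by
    rintro ⟨caps, es, k, l, hes, rfl⟩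
    exact ⟨a :: caps, es, k, l, hes, by simp [inputText]⟩
  cases φ <;> cases m <;> simp only [next, Letter.isColour, Option.some.injEq, if_true,
    reduceCtorEq, Bool.false_eq_true, if_false] at h <;> subst h
  all_goals first
    | exact key'' hw
    | exact ⟨[], key' hw⟩
    | exact ⟨[], key rfl hw⟩
    | exact key' hw
    | exact key rfl hw
    | skip
  · obtain ⟨es, k, l, hes, rfl⟩ := hw
    exact ⟨a, es, k, l, hes, rfl⟩
  · obtain rfl := hw
    exact ⟨a, by simp⟩

/-- Soundness of the automaton, by induction on the unread string. It may begin in the middle of a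
numeral: `ds` are the digits still to come, and the flag `z` matters only if there are none. -/
theorem rest_of_foldl_recognize : ∀ (w : List Letter) (φ : Phase) (z : Bool),
    w.foldl recognize (some (φ, z)) = some (.final, false) →
    ∃ ds w', w = ds.map Letter.bit ++ w' ∧ φ.Rest w' ∧ ds.getLast? ≠ some false ∧
      (ds = [] → z = false) ∧ (φ = .start → ds = [])
  | [], φ, z, h => by
    simp only [List.foldl_nil, Option.some.injEq, Prod.mk.injEq] at h
    obtain ⟨rfl, rfl⟩ := h
    exact ⟨[], [], rfl, rfl, by simp, fun _ => rfl, fun _ => rfl⟩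
  | a :: w, φ, z, h => by
    rw [List.foldl_cons] at h
    by_cases ha : a.isBit = true
    · obtain ⟨d, rfl⟩ : ∃ d, a = .bit d := by
        cases a <;> first | exact ⟨_, rfl⟩ | cases ha
      by_cases hφ : φ = .start
      · simp [recognize, hφ, foldl_recognize_none] at h
      · simp only [recognize, hφ, if_false] at h
        obtain ⟨ds, w', rfl, h1, h2, h3, -⟩ := rest_of_foldl_recognize w φ (!d) h
        refine ⟨d :: ds, w', rfl, h1, ?_, by simp, fun h => absurd h hφ⟩
        cases ds with
        | nil => simpa using h3 rfl
        | cons e ds => rwa [List.getLast?_cons_cons]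
    · have h1 : recognize (some (φ, z)) a =
          if z then none else (φ.next a).map fun ψ => (ψ, false) := by
        cases a <;> first | rfl | exact absurd rfl ha
      rw [h1] at h
      cases z with
      | true => simp [foldl_recognize_none] at h
      | false =>
        cases hn : φ.next a with
        | none => simp [hn, foldl_recognize_none] at h
        | some ψ =>
          simp only [hn, Bool.false_eq_true, if_false, Option.map_some] at h
          obtain ⟨ds, w', rfl, h1, h2, -, -⟩ := rest_of_foldl_recognize w ψ false h
          -- The absence of a final `0` makes `ds` the expansion of a number.
          obtain ⟨c, rfl⟩ := exists_bits_eq ds h2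
          exact ⟨[], _, rfl, Phase.rest_numeral (a := c) hn h1, by simp, fun _ => rfl, fun _ => rfl⟩

theorem exists_inputText_of_foldl_recognize {x : List Letter}
    (h : x.foldl recognize (some (.start, false)) = some (.final, false)) :
    ∃ caps es k l, (∀ e ∈ es, e.1.isColour = true) ∧ x = inputText caps es k l := by
  obtain ⟨ds, w, rfl, hw, -, -, h0⟩ := rest_of_foldl_recognize x _ _ h
  rw [h0 rfl]
  exact hw

namespace Routine

variable {x : List Letter} {b h : ℕ} {σ : Regs} {o : List Letter} {A : Type}

/-! ### The whole program -/

/-- Runs the automaton over the whole input. -/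
noncomputable def scan : Prog (Option (Phase × Bool)) :=
  loop (fun q => read >>= fun c => match c with
    | .leftEnd => act .right none >>= fun _ => pure (q, true)
    | .letter a => act .right none >>= fun _ => pure (recognize q a, true)
    | .rightEnd => pure (q, false)) (some (.start, false))

theorem run_scan :
    Run x b scan (st 0 σ o) (x.foldl recognize (some (.start, false))) (st (x.length + 1) σ o) := by
  have key : ∀ (w u : List Letter) (q : Option (Phase × Bool)), x = u ++ w →
      Run x b (loop (fun q => read >>= fun c => match c with
        | .leftEnd => act .right none >>= fun _ => pure (q, true)
        | .letter a => act .right none >>= fun _ => pure (recognize q a, true)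
        | .rightEnd => pure (q, false)) q) (st (u.length + 1) σ o) (w.foldl recognize q)
        (st (x.length + 1) σ o) := by
    intro w
    induction w with
    | nil =>
      intro u q hx
      obtain rfl : x = u := by simpa using hx
      have h1 : Transducer.readInput x (st (x.length + 1) σ o).head = .rightEnd := readInput_end x
      refine .loop_done (.bind .read ?_)
      rw [h1]
      exact .pure
    | cons a w ih =>
      intro u q hx
      have h1 : Transducer.readInput x (st (u.length + 1) σ o).head = .letter a :=
        readInput_at hx rfl
      refine .loop_next (a' := recognize q a) (.bind .read ?_) (ih (u ++ [a]) _ (by simpa using hx))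
      rw [h1, List.length_append]
      exact .bind (run_right (by simp [hx])) .pure
  refine .loop_next (a' := some (.start, false)) (.bind .read ?_) (key x [] _ rfl)
  exact .bind (run_right (Nat.zero_le _)) .pure

/-- Moves the input head to the left end. -/
def rewind : Prog Unit := whileLetter (fun _ => true) fun _ => act .left none

theorem run_rewind : h ≤ x.length → Run x b rewind (st h σ o) () (st 0 σ o) := by
  induction h with
  | zero => exact fun _ => run_whileLetter_done fun a ha => by cases ha
  | succ h ih =>
    intro hh
    refine run_whileLetter_next (a := x[h]) ?_ rfl (run_left (by omega)) (ih (by omega))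
    simp [Transducer.readInput, st, List.getElem?_eq_getElem hh]

/-- Moves the input head to the left end; counts the letters in `len` and the vertices in `num`. -/
noncomputable def count : Prog Unit :=
  whileLetter (fun _ => true) fun a => inc .len >>= fun _ =>
    (if a.isVertex then inc .num else pure ()) >>= fun _ => act .left none

/-- `N` letters have been counted so far, `n` of them vertex marks; `n ≤ N` lets the length of the
input bound both registers. -/
theorem run_count (hx : x.length < 2 ^ b) : ∀ {h N n : ℕ}, h + N ≤ x.length → n ≤ N →
    Run x b count (st h ⟨0, N, n, 0, 0, 0, 0, 0, 0, 0, 0, 0⟩ o) ()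
      (st 0 ⟨0, N + h, n + (x.take h).countP Letter.isVertex, 0, 0, 0, 0, 0, 0, 0, 0, 0⟩ o) := by
  intro h
  induction h with
  | zero =>
    intro N n _ _
    rw [List.take_zero]
    exact run_whileLetter_done fun a ha => by cases ha
  | succ h ih =>
    intro N n hh hn
    have hh' : h < x.length := by omega
    have h1 : N + (h + 1) = N + 1 + h := by ring
    have h2 : n + (x.take (h + 1)).countP Letter.isVertex =
        n + (if (x[h]).isVertex then 1 else 0) + (x.take h).countP Letter.isVertex := by
      rw [← List.take_append_getElem hh', List.countP_append, List.countP_singleton]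
      omega
    rw [h1, h2]
    refine run_whileLetter_next (a := x[h]) (s' := st h
      ⟨0, N + 1, n + (if (x[h]).isVertex then 1 else 0), 0, 0, 0, 0, 0, 0, 0, 0, 0⟩ o)
      ?_ rfl (.bind (run_inc fun _ => ?_) (.bind (a := ()) (s' := st (h + 1)
        ⟨0, N + 1, n + (if (x[h]).isVertex then 1 else 0), 0, 0, 0, 0, 0, 0, 0, 0, 0⟩ o) ?_
        (run_left (by omega))))
      (ih (by omega) (by split <;> omega))
    · simp [Transducer.readInput, st, List.getElem?_eq_getElem hh']
    · change N + 1 < _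
      omega
    · by_cases hv : (x[h]).isVertex = true
      · simp only [hv, if_true]
        refine run_inc fun _ => ?_
        change n + 1 < _
        omega
      · simp only [hv]
        exact .pure

/-- Creates the whole graph, starting with the input head at the left end. -/
noncomputable def graphPass (second : Bool) : Prog Unit :=
  act .right none >>= fun _ => copy .next .zero >>= fun _ => copy .base .zero >>= fun _ =>
  copy .j .zero >>= fun _ => whileLt .i .num (add .next .len >>= fun _ => inc .i) >>= fun _ =>
  copy .i .zero >>= fun _ => vertexPass second >>= fun _ => edgePass second

/-- The number of vertices of the graph. -/
def totalCount (N : ℕ) (caps : List ℕ) (m : ℕ) : ℕ :=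
  N * caps.length + extraCount N caps + 2 * N * m

/-- The code of the edges of the graph. -/
def graphText (N : ℕ) (caps : List ℕ) (es : List (Letter × ℕ × ℕ)) : List Letter :=
  vertexText N 0 (N * caps.length) caps ++
    edgesText N caps.length 0 (N * caps.length + extraCount N caps) es

theorem extraCount_le (N : ℕ) (caps : List ℕ) : extraCount N caps ≤ N * caps.length := by
  induction caps with
  | nil => simp [extraCount]
  | cons k ks ih =>
    simp only [extraCount, List.map_cons, List.sum_cons, List.length_cons, Nat.mul_succ] at ih ⊢
    omega

theorem length_le_of_forall_flatMap {γ : Type} (f : γ → List Letter) (c : ℕ) (l : List γ)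
    (hf : ∀ a, c ≤ (f a).length) : c * l.length ≤ (l.flatMap f).length := by
  induction l with
  | nil => simp
  | cons a l ih =>
    rw [List.flatMap_cons, List.length_append, List.length_cons, Nat.mul_succ]
    have := hf a
    omega

/-- This makes the length of the input a legitimate `N`: it is at least the number of vertices and
exceeds the number of edges. -/
theorem length_inputText (caps : List ℕ) (es : List (Letter × ℕ × ℕ)) (k l : ℕ) :
    caps.length + 2 * es.length + 2 ≤ (inputText caps es k l).length := by
  have h1 := length_le_of_forall_flatMap (fun a => numeral .vertex a) 1 caps (by simp [numeral])
  have h2 := length_le_of_forall_flatMap rawEdge 2 es (by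
    intro a; simp [rawEdge, edgeText, numeral]; omega)
  simp only [inputText, List.length_append, numeral, List.length_cons] at h1 ⊢
  omega

theorem countP_inputText (caps : List ℕ) {es : List (Letter × ℕ × ℕ)}
    (hes : ∀ e ∈ es, e.1.isColour = true) (k l : ℕ) :
    (inputText caps es k l).countP Letter.isVertex = caps.length := by
  have h0 : ∀ m a, (numeral m a).countP Letter.isVertex = if m.isVertex then 1 else 0 := by
    intro m a
    rw [numeral, List.countP_cons, List.countP_map]
    have : (Letter.isVertex ∘ Letter.bit) = fun _ => false := rfl
    rw [this]
    simp
  have h1 : (caps.flatMap fun a => numeral .vertex a).countP Letter.isVertex = caps.length := by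
    induction caps with
    | nil => rfl
    | cons a caps ih =>
      rw [List.flatMap_cons, List.countP_append, ih, h0, List.length_cons, add_comm]
      rfl
  have h2 : (es.flatMap rawEdge).countP Letter.isVertex = 0 := by
    induction es with
    | nil => rfl
    | cons e es ih =>
      have he := hes e List.mem_cons_self
      rw [List.flatMap_cons, List.countP_append, ih fun e he => hes e (List.mem_cons_of_mem _ he),
        rawEdge, edgeText, List.countP_append, h0, h0]
      obtain ⟨m, u, v⟩ := e
      cases m <;> first | rfl | cases he
  rw [inputText, List.countP_append, List.countP_append, List.countP_append, h1, h2, h0, h0]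
  rfl

/-- All numbers that the program computes are small. -/
theorem bound_aux {N n m : ℕ} (h : n + 2 * m + 2 ≤ N) :
    N * n + N * (n + 1) + 2 * N * m ≤ 2 * (N * N) := by
  nlinarith

/-- The initial values `c`, `vb` and `j` are arbitrary because the second pass starts with what the
first one has left in these registers. -/
theorem run_graphPass {second : Bool} {caps : List ℕ} {es : List (Letter × ℕ × ℕ)} {k l : ℕ}
    (hes : ∀ e ∈ es, e.1.isColour = true) (hx : x = inputText caps es k l)
    (hb : 4 * (x.length * x.length) < 2 ^ b) {c vb j : ℕ} :
    Run x b (graphPass second)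
      (st 0 ⟨0, x.length, caps.length, c, vb, 0, 0, 0, 0, 0, 0, j⟩ o) ()
      (st ((caps.flatMap (fun a => numeral .vertex a) ++ es.flatMap rawEdge).length + 1)
        ⟨0, x.length, caps.length, totalCount x.length caps es.length, x.length * caps.length,
          0, 0, 0, 0, 0, 0, es.length⟩
        (o ++ onPass second (graphText x.length caps es))) := by
  have hl := length_inputText caps es k l
  rw [← hx] at hl
  generalize hN : x.length = N at *
  have h1 := bound_aux hl
  have h2 := extraCount_le N caps
  have h3 : N * (caps.length + 1) = N * caps.length + N := Nat.mul_succ _ _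
  have h4 : N * (N + 1) = N * N + N := Nat.mul_succ _ _
  have h5 : 2 * N ≤ N * N := Nat.mul_le_mul_right N (by omega)
  have hw : NoBit (numeral .target k ++ numeral .target l) := noBit_numeral rfl _ _
  have hw2 : NoBit (es.flatMap rawEdge ++ (numeral .target k ++ numeral .target l)) := by
    cases es with
    | nil => exact hw
    | cons e es =>
      obtain ⟨m, u, v⟩ := e
      have he := hes _ List.mem_cons_self
      simp only [List.flatMap_cons, rawEdge, edgeText, List.append_assoc]
      refine noBit_numeral ?_ _ _
      cases m <;> first | rfl | cases he
  have hw3 : ∀ a, (es.flatMap rawEdge ++ (numeral .target k ++ numeral .target l)).head? = some a →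
      a.isVertex = false := by
    cases es with
    | nil => simp [numeral, Letter.isVertex]
    | cons e es =>
      obtain ⟨m, u, v⟩ := e
      have he := hes _ List.mem_cons_self
      simp only [List.flatMap_cons, rawEdge, edgeText, numeral, List.cons_append, List.head?_cons,
        Option.some.injEq]
      rintro _ rfl
      cases m <;> first | rfl | cases he
  have hloop := run_whileLt (x := x) (b := b) (h := 1) (r := .i) (s := .num)
    (M := (add .next .len >>= fun _ => inc .i))
    (fun i => ⟨0, N, caps.length, N * i, 0, i, 0, 0, 0, 0, 0, 0⟩)
    (fun _ => o) (K := caps.length) (fun i hi => ⟨hi, by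
      refine .bind (run_add fun _ => ?_) (run_inc fun h => ?_)
      · change N * i + N < _
        have := Nat.mul_le_mul_left N (show i + 1 ≤ caps.length from hi)
        rw [Nat.mul_succ] at this
        omega
      · change i + 1 < _
        omega⟩) le_rfl
  have hv1 : 2 * N + 1 < 2 ^ b := by omega
  have hv2 : 0 + N * (caps.length + 1) < 2 ^ b := by omega
  have hv3 : N * caps.length + N * (caps.length + 1) < 2 ^ b := by omega
  refine .bind (run_right (Nat.zero_le _)) (.bind run_copy (.bind run_copy (.bind run_copy
    (.bind hloop (.bind run_copy (.bind (run_vertexPass caps (u := []) hw2 hw3 hx rfl hv1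
      hv2 hv3) ?_))))))
  have h6 := run_edgePass (x := x) (b := b) (second := second) (N := N) (n := caps.length)
    (vb := N * caps.length) es (c := N * caps.length + extraCount N caps) (j := 0)
    (o := o ++ onPass second (vertexText N 0 (N * caps.length) caps))
    (u := caps.flatMap fun a => numeral .vertex a)
    hw (by simp [numeral, Letter.isColour]) hes hx rfl (by omega) (by omega) (by omega)
  rw [graphText, onPass_append, ← List.append_assoc, totalCount]
  simp only [List.length_append]
  rw [show ∀ a c : ℕ, a + c + 1 = a + 1 + c by intros; ring]
  simp only [zero_add, add_comm 1] at h6 ⊢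
  exact h6

/-- The text written on the output tape. -/
def outputText (N : ℕ) (caps : List ℕ) (es : List (Letter × ℕ × ℕ)) (k l : ℕ) : List Letter :=
  List.replicate (totalCount N caps es.length) .vertex ++ graphText N caps es ++
    numeral .target (min k N + (N + 1) * min l N)

/-- The program of the reduction. -/
noncomputable def reduction : Prog Unit :=
  scan >>= fun q => if q = some (.final, false) then
    act .left none >>= fun _ => count >>= fun _ => graphPass false >>= fun _ =>
    whileLt .i .next (emit .vertex >>= fun _ => inc .i) >>= fun _ => copy .i .zero >>= fun _ =>
    rewind >>= fun _ => graphPass true >>= fun _ => readNumeral .a >>= fun _ =>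
    readNumeral .a' >>= fun _ => whileLt .i .a' (add .a .len >>= fun _ => inc .a >>= fun _ =>
      inc .i) >>= fun _ => emitNumeral .target .a
  else pure ()

theorem run_reduction_none (h : x.foldl recognize (some (.start, false)) ≠ some (.final, false)) :
    Run x b reduction (st 0 σ o) () (st (x.length + 1) σ o) := by
  refine .bind run_scan ?_
  rw [if_neg h]
  exact .pure

/-- In the output the vertex marks precede the edges, but their number is known only after all
gadgets have been counted. A silent first pass leaves this number in `next`, and the second pass
writes the edges. It ends in front of the first target, so `k` and `l` are read next. -/
theorem run_reduction {caps : List ℕ} {es : List (Letter × ℕ × ℕ)} {k l : ℕ}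
    (hes : ∀ e ∈ es, e.1.isColour = true) (hx : x = inputText caps es k l)
    (hb : 4 * (x.length * x.length) < 2 ^ b) :
    ∃ h σ, Run x b reduction (st 0 ⟨0, 0, 0, 0, 0, 0, 0, 0, 0, 0, 0, 0⟩ []) ()
      (st h σ (outputText x.length caps es k l)) := by
  have hl := length_inputText caps es k l
  rw [← hx] at hl
  have h1 := bound_aux hl
  have h2 := extraCount_le x.length caps
  have h5 : 2 * x.length ≤ x.length * x.length := Nat.mul_le_mul_right _ (by omega)
  have hcount := run_count (x := x) (b := b) (o := []) (by omega) (h := x.length) (N := 0) (n := 0)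
    (by omega) le_rfl
  rw [List.take_length, hx, countP_inputText caps hes, ← hx, zero_add, zero_add] at hcount
  have ht : totalCount x.length caps es.length < 2 ^ b := by
    rw [Nat.mul_succ] at h1
    unfold totalCount
    omega
  have hloop := fun h => run_whileLt (x := x) (b := b) (h := h) (r := .i) (s := .next)
    (M := (emit .vertex >>= fun _ => inc .i))
    (fun i => ⟨0, x.length, caps.length, totalCount x.length caps es.length,
      x.length * caps.length, i, 0, 0, 0, 0, 0, es.length⟩)
    (fun i => List.replicate i .vertex) (K := totalCount x.length caps es.length)
    (fun i hi => ⟨hi, by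
      rw [List.replicate_succ']
      refine .bind run_emit (run_inc fun h => ?_)
      change i + 1 < _
      omega⟩) le_rfl
  have hK : ∀ i, i ≤ min l x.length → min k x.length + (x.length + 1) * i < 2 ^ b := by
    intro i hi
    have : (x.length + 1) * i ≤ x.length * x.length + x.length :=
      (Nat.mul_le_mul_left _ (hi.trans (min_le_right _ _))).trans_eq (Nat.succ_mul _ _)
    omega
  have hsum := fun h o => run_whileLt (x := x) (b := b) (h := h) (r := .i) (s := .a')
    (M := (add .a .len >>= fun _ => inc .a >>= fun _ => inc .i))
    (fun i => ⟨0, x.length, caps.length, totalCount x.length caps es.length,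
      x.length * caps.length, i, 0, min k x.length + (x.length + 1) * i, min l x.length, 0, 0,
      es.length⟩)
    (fun i => o) (K := min l x.length)
    (fun i hi => ⟨hi, by
      have h7 : min k x.length + (x.length + 1) * (i + 1) =
        min k x.length + (x.length + 1) * i + x.length + 1 := by ring
      have h8 := hK (i + 1) hi
      rw [h7] at h8 ⊢
      refine .bind (run_add fun _ => ?_) (.bind (run_inc fun _ => h8) (run_inc fun _ => ?_))
      · change min k x.length + (x.length + 1) * i + x.length < _
        omega
      · change i + 1 < _
        omega⟩) le_rfl
  simp only [Nat.mul_zero, add_zero] at hsum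
  have hx1 : x = caps.flatMap (fun a => numeral .vertex a) ++ es.flatMap rawEdge ++
      (numeral .target k ++ numeral .target l) := by simpa [inputText] using hx
  have hw : NoBit (numeral .target l) := by
    rw [← List.append_nil (numeral _ l)]
    exact noBit_numeral rfl _ _
  have hv1 : 2 * x.length + 1 < 2 ^ b := by omega
  have hrew : (caps.flatMap (fun a => numeral .vertex a) ++ es.flatMap rawEdge).length + 1 ≤
      x.length := by
    rw [hx1]
    simp [numeral]
  have hnum := run_readNumeral (x := x) (b := b) (r := .a') (by decide) (m := .target) (a := l)
    (w := []) (u := caps.flatMap (fun a => numeral .vertex a) ++ es.flatMap rawEdge ++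
      numeral .target k) (σ := ⟨0, x.length, caps.length, totalCount x.length caps es.length,
      x.length * caps.length, 0, 0, min k x.length, 0, 0, 0, es.length⟩)
    (o := List.replicate (totalCount x.length caps es.length) .vertex ++ graphText x.length caps es)
    rfl (by simpa using hx1) (by intro a ha; cases ha) rfl hv1 rfl rfl
  refine ⟨(caps.flatMap (fun a => numeral .vertex a) ++ es.flatMap rawEdge ++ numeral .target k ++
    numeral .target l).length + 1, ⟨0, x.length, caps.length, totalCount x.length caps es.length,
      x.length * caps.length, min l x.length, 0, min k x.length + (x.length + 1) * min l x.length,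
      min l x.length, 0, 0, es.length⟩, .bind run_scan ?_⟩
  rw [if_pos (by rw [hx]; exact foldl_recognize_inputText caps hes k l)]
  exact .bind (run_left le_rfl) (.bind hcount (.bind (run_graphPass hes hx hb) (.bind
      (hloop _) (.bind run_copy (.bind (run_rewind hrew) (.bind (run_graphPass hes hx hb) (.bind
      (run_readNumeral (by decide) rfl hx1 hw rfl hv1 rfl rfl)
      (.bind hnum (.bind (hsum _ _) run_emitNumeral)))))))))

end Routine

theorem four_mul_sq_lt (a : ℕ) : 4 * (a * a) < 2 ^ (2 * Nat.log 2 a + 4) := by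
  have h : a < 2 ^ (Nat.log 2 a + 1) := Nat.lt_pow_succ_log_self (by norm_num) a
  calc 4 * (a * a) < 4 * (2 ^ (Nat.log 2 a + 1) * 2 ^ (Nat.log 2 a + 1)) := by
        have := Nat.mul_lt_mul'' h h
        omega
    _ = 2 ^ (2 * Nat.log 2 a + 4) := by ring

/-- The reduction is computable in logarithmic space. -/
theorem exists_reduction : ∃ f : List Letter → List Letter, LogspaceComputable f ∧
    (∀ caps es k l, (∀ e ∈ es, e.1.isColour = true) → f (inputText caps es k l) =
      Routine.outputText (inputText caps es k l).length caps es k l) ∧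
    ∀ x, (¬ ∃ caps es k l, (∀ e ∈ es, e.1.isColour = true) ∧ x = inputText caps es k l) →
      f x = [] := by
  have hst : (st 0 ⟨0, 0, 0, 0, 0, 0, 0, 0, 0, 0, 0, 0⟩ [] : Store Reg Letter) =
      ⟨0, fun _ => 0, []⟩ := by
    unfold st
    congr 1
    funext r
    cases r <;> rfl
  have key : ∀ x : List Letter, ∃ s, Routine.Run x (2 * Nat.log 2 x.length + 4) Routine.reduction
      ⟨0, fun _ => 0, []⟩ () s ∧
      (∀ caps es k l, (∀ e ∈ es, e.1.isColour = true) → x = inputText caps es k l →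
        s.out = Routine.outputText x.length caps es k l) ∧
      ((¬ ∃ caps es k l, (∀ e ∈ es, e.1.isColour = true) ∧ x = inputText caps es k l) →
        s.out = []) := by
    intro x
    rw [← hst]
    by_cases hx : ∃ caps es k l, (∀ e ∈ es, e.1.isColour = true) ∧ x = inputText caps es k l
    · have hrun := fun caps es k l hes hx' => Routine.run_reduction (x := x) (caps := caps)
        (es := es) (k := k) (l := l) hes hx' (four_mul_sq_lt x.length)
      obtain ⟨caps, es, k, l, hes, hx'⟩ := hx
      obtain ⟨h, σ, hs⟩ := hrun caps es k l hes hx'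
      -- Unique readability of the input is not needed: any two readings describe the output of the
      -- same deterministic machine on the same string.
      refine ⟨_, hs, fun caps' es' k' l' hes' hx'' => ?_, fun hn => absurd ⟨_, _, _, _, hes, hx'⟩ hn⟩
      obtain ⟨h', σ', hs'⟩ := hrun caps' es' k' l' hes' hx''
      rw [hst] at hs hs'
      exact hs.outputs.unique hs'.outputs
    · refine ⟨_, Routine.run_reduction_none fun h => hx (exists_inputText_of_foldl_recognize h),
        fun caps es k l hes hx' => absurd ⟨_, _, _, _, hes, hx'⟩ hx, fun _ => rfl⟩
  choose s hs h1 h2 using key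
  -- With `2 * Nat.log 2 x.length + 4` digits, at most `2 * Nat.log 2 x.length + 6` cells are
  -- visited, whence the constant `6`.
  refine ⟨fun x => (s x).out, ⟨Routine.reduction.toTransducer, fun x => (hs x).outputs, 6,
    fun x => (hs x).spaceBoundedBy (by omega)⟩, fun caps es k l hes => h1 _ _ _ _ _ hes rfl, h2⟩

/-! ### The graph -/

namespace Gadget

variable {n m N : ℕ} {b : Fin n → ℕ} {s t : Fin m → Fin n} (hm : m < N)

/-- The vertices of the graph: `N` ports and `N - b v` extra vertices for every vertex `v`, and
`2 * N` inner vertices of a path for every edge. -/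
abbrev Vertex (m N : ℕ) (b : Fin n → ℕ) : Type :=
  (Fin n × Fin N) ⊕ ((Σ v : Fin n, Fin (N - b v)) ⊕ (Fin m × Fin (2 * N)))

/-- The edges of the graph. -/
abbrev Edge (m N : ℕ) (b : Fin n → ℕ) : Type :=
  (Σ v : Fin n, Fin (N - b v) × Fin N) ⊕ (Fin m × Fin (2 * N + 1))

/-- The `i`-th vertex of the path for the edge `e`, which starts and ends in a port. -/
def pathVertex (b : Fin n → ℕ) (s t : Fin m → Fin n) (hm : m < N) (e : Fin m) (i : ℕ) :
    Vertex m N b :=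
  if i = 0 then .inl (s e, e.castLE hm.le)
  else if h : i - 1 < 2 * N then .inr (.inr (e, ⟨i - 1, h⟩))
  else .inl (t e, e.castLE hm.le)

/-- The ends of an edge. -/
def ends (b : Fin n → ℕ) (s t : Fin m → Fin n) (hm : m < N) : Edge m N b → Vertex m N b × Vertex m N b
  | .inl g => (.inl (g.1, g.2.2), .inr (.inl ⟨g.1, g.2.1⟩))
  | .inr g => (pathVertex b s t hm g.1 g.2, pathVertex b s t hm g.1 (g.2 + 1))

theorem pathVertex_eq_port {e : Fin m} {i : ℕ} {v : Fin n} {j : Fin N} :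
    pathVertex b s t hm e i = .inl (v, j) ↔
      e.castLE hm.le = j ∧ (i = 0 ∧ s e = v ∨ 2 * N < i ∧ t e = v) := by
  unfold pathVertex
  split_ifs with h1 h2
  · simp [h1]; tauto
  · simp; omega
  · have : 2 * N < i := by omega
    simp [h1, this]; tauto

theorem pathVertex_ne_extra {e : Fin m} {i : ℕ} {g : Σ v : Fin n, Fin (N - b v)} :
    pathVertex b s t hm e i ≠ .inr (.inl g) := by
  unfold pathVertex
  split_ifs <;> simp

theorem pathVertex_eq_inner {e e' : Fin m} {i : ℕ} {j : Fin (2 * N)} :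
    pathVertex b s t hm e i = .inr (.inr (e', j)) ↔ e = e' ∧ i = j + 1 := by
  unfold pathVertex
  split_ifs with h1 h2
  · simp [h1]
  · simp [Fin.ext_iff]; omega
  · simp; omega

/-- A port on a path carries the number of its edge, and an inner vertex carries its edge and
position. The two end ports of one path differ since there are no loops. -/
theorem pathVertex_injective (hst : ∀ e, s e ≠ t e) {e e' : Fin m} {i i' : ℕ} (hi : i ≤ 2 * N + 1)
    (hi' : i' ≤ 2 * N + 1) (h : pathVertex b s t hm e i = pathVertex b s t hm e' i') :
    e = e' ∧ i = i' := by
  rcases h0 : pathVertex b s t hm e' i' with ⟨v, j⟩ | g | ⟨f, j⟩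
  · rw [h0] at h
    rw [pathVertex_eq_port] at h h0
    have he : e = e' := by
      have := h.1.trans h0.1.symm
      simpa [Fin.ext_iff] using this
    subst he
    refine ⟨rfl, ?_⟩
    have := hst e
    rcases h.2 with ⟨h1, h2⟩ | ⟨h1, h2⟩ <;> rcases h0.2 with ⟨h3, h4⟩ | ⟨h3, h4⟩
    · omega
    · exact absurd (h2.trans h4.symm) this
    · exact absurd (h4.trans h2.symm) this
    · omega
  · exact absurd h0 (pathVertex_ne_extra hm)
  · rw [h0] at h
    rw [pathVertex_eq_inner] at h h0
    exact ⟨h.1.trans h0.1.symm, h.2.trans h0.2.symm⟩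

theorem ends_injective (hst : ∀ e, s e ≠ t e) :
    Function.Injective fun g : Edge m N b => s((ends b s t hm g).1, (ends b s t hm g).2) := by
  rintro (⟨v, i, j⟩ | ⟨e, i⟩) (⟨v', i', j'⟩ | ⟨e', i'⟩) h
  · simp only [ends, Sym2.eq_iff, Sum.inl.injEq, Sum.inr.injEq, Prod.mk.injEq, reduceCtorEq,
      and_false, or_false] at h
    obtain ⟨⟨rfl, rfl⟩, h⟩ := h
    simp only [Sigma.mk.injEq, heq_eq_eq, true_and] at h
    rw [h]
  · simp only [ends, Sym2.eq_iff] at h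
    rcases h with h | h
    · exact absurd h.2.symm (pathVertex_ne_extra hm)
    · exact absurd h.2.symm (pathVertex_ne_extra hm)
  · simp only [ends, Sym2.eq_iff] at h
    rcases h with h | h
    · exact absurd h.2 (pathVertex_ne_extra hm)
    · exact absurd h.1 (pathVertex_ne_extra hm)
  · simp only [ends, Sym2.eq_iff] at h
    have hi := i.2
    have hi' := i'.2
    rcases h with h | h
    · obtain ⟨rfl, h1⟩ := pathVertex_injective hm hst (by omega) (by omega) h.1
      rw [Fin.ext h1]
    · have h1 := (pathVertex_injective hm hst (by omega) (by omega) h.1).2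
      have h2 := (pathVertex_injective hm hst (by omega) (by omega) h.2).2
      omega

/-- The edge `g` is incident with the vertex `x`. -/
def Inc (b : Fin n → ℕ) (s t : Fin m → Fin n) (hm : m < N) (g : Edge m N b) (x : Vertex m N b) : Prop :=
  (ends b s t hm g).1 = x ∨ (ends b s t hm g).2 = x

theorem inc_spoke_port {v v' : Fin n} {i : Fin (N - b v)} {j j' : Fin N} :
    Inc b s t hm (.inl ⟨v, i, j⟩) (.inl (v', j')) ↔ v = v' ∧ j = j' := by
  simp [Inc, ends]

theorem inc_spoke_extra {v v' : Fin n} {i : Fin (N - b v)} {j : Fin N} {i' : Fin (N - b v')} :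
    Inc b s t hm (.inl ⟨v, i, j⟩) (.inr (.inl ⟨v', i'⟩)) ↔
      (⟨v, i⟩ : Σ v : Fin n, Fin (N - b v)) = ⟨v', i'⟩ := by
  simp [Inc, ends]

theorem not_inc_spoke_inner {g : Σ v : Fin n, Fin (N - b v) × Fin N} {y : Fin m × Fin (2 * N)} :
    ¬ Inc b s t hm (.inl g) (.inr (.inr y)) := by
  simp [Inc, ends]

theorem inc_path_port {e : Fin m} {i : Fin (2 * N + 1)} {v : Fin n} {j : Fin N} :
    Inc b s t hm (.inr (e, i)) (.inl (v, j)) ↔ e.castLE hm.le = j ∧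
      ((i : ℕ) = 0 ∧ s e = v ∨ (i : ℕ) = 2 * N ∧ t e = v) := by
  have hi := i.2
  simp only [Inc, ends, pathVertex_eq_port]
  constructor
  · rintro (⟨h, ⟨h1, h2⟩ | ⟨h1, h2⟩⟩ | ⟨h, ⟨h1, h2⟩ | ⟨h1, h2⟩⟩)
    · exact ⟨h, .inl ⟨h1, h2⟩⟩
    · omega
    · omega
    · exact ⟨h, .inr ⟨by omega, h2⟩⟩
  · rintro ⟨h, ⟨h1, h2⟩ | ⟨h1, h2⟩⟩
    · exact .inl ⟨h, .inl ⟨h1, h2⟩⟩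
    · exact .inr ⟨h, .inr ⟨by omega, h2⟩⟩

theorem not_inc_path_extra {e : Fin m × Fin (2 * N + 1)} {g : Σ v : Fin n, Fin (N - b v)} :
    ¬ Inc b s t hm (.inr e) (.inr (.inl g)) := by
  simp [Inc, ends, pathVertex_ne_extra]

theorem inc_path_inner {e e' : Fin m} {i : Fin (2 * N + 1)} {j : Fin (2 * N)} :
    Inc b s t hm (.inr (e, i)) (.inr (.inr (e', j))) ↔
      e = e' ∧ ((i : ℕ) = j + 1 ∨ (i : ℕ) = j) := by
  simp only [Inc, ends, pathVertex_eq_inner]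
  constructor
  · rintro (⟨h, h1⟩ | ⟨h, h1⟩)
    · exact ⟨h, .inl h1⟩
    · exact ⟨h, .inr (by omega)⟩
  · rintro ⟨h, h1 | h1⟩
    · exact .inl ⟨h, h1⟩
    · exact .inr ⟨h, by omega⟩

/-- A perfect matching of the graph. -/
def IsPerfect (b : Fin n → ℕ) (s t : Fin m → Fin n) (hm : m < N) (S : Finset (Edge m N b)) : Prop :=
  ∀ x, ∃! g, g ∈ S ∧ Inc b s t hm g x

/-- A perfect `b`-matching of the given multigraph. -/
def IsBMatching (b : Fin n → ℕ) (s t : Fin m → Fin n) (M : Finset (Fin m)) : Prop :=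
  ∀ v, (M.filter fun e => s e = v ∨ t e = v).card = b v

/-- The ports of `v` that are matched with extra vertices. -/
def freePorts (s t : Fin m → Fin n) (hm : m < N) (M : Finset (Fin m)) (v : Fin n) : Finset (Fin N) :=
  ((M.filter fun e => s e = v ∨ t e = v).map (Fin.castLEEmb hm.le))ᶜ

theorem mem_freePorts {M : Finset (Fin m)} {v : Fin n} {j : Fin N} :
    j ∈ freePorts s t hm M v ↔ ¬ ∃ e ∈ M, (s e = v ∨ t e = v) ∧ e.castLE hm.le = j := by
  simp only [freePorts, Finset.mem_compl, Finset.mem_map, Finset.mem_filter, Fin.castLEEmb_apply,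
    and_assoc]

theorem card_freePorts (M : Finset (Fin m)) (v : Fin n) :
    (freePorts s t hm M v).card = N - (M.filter fun e => s e = v ∨ t e = v).card := by
  rw [freePorts, Finset.card_compl, Finset.card_map, Fintype.card_fin]

/-- The edges of the paths that belong to a perfect matching. -/
theorem IsPerfect.mem_path {S : Finset (Edge m N b)} (hS : IsPerfect b s t hm S) (e : Fin m) :
    ∀ (i : ℕ) (hi : i < 2 * N + 1), (.inr (e, ⟨i, hi⟩) : Edge m N b) ∈ S ↔
      (((.inr (e, 0) : Edge m N b) ∈ S) ↔ Even i)
  | 0, hi => by simp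
  | i + 1, hi => by
    have ih := hS.mem_path e i (by omega)
    rw [Nat.even_add_one]
    obtain ⟨g, ⟨hg, hg'⟩, hu⟩ := hS (.inr (.inr (e, ⟨i, by omega⟩)))
    have h1 : Inc b s t hm (.inr (e, ⟨i, by omega⟩)) (.inr (.inr (e, ⟨i, by omega⟩))) :=
      (inc_path_inner hm).2 ⟨rfl, .inr rfl⟩
    have h2 : Inc b s t hm (.inr (e, ⟨i + 1, hi⟩)) (.inr (.inr (e, ⟨i, by omega⟩))) :=
      (inc_path_inner hm).2 ⟨rfl, .inl rfl⟩
    have h3 : ¬ ((.inr (e, ⟨i, by omega⟩) : Edge m N b) ∈ S ∧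
        (.inr (e, ⟨i + 1, hi⟩) : Edge m N b) ∈ S) := by
      rintro ⟨h4, h5⟩
      have := (hu _ ⟨h4, h1⟩).trans (hu _ ⟨h5, h2⟩).symm
      simp [Fin.ext_iff] at this
    have h4 : (.inr (e, ⟨i, by omega⟩) : Edge m N b) ∈ S ∨
        (.inr (e, ⟨i + 1, hi⟩) : Edge m N b) ∈ S := by
      rcases g with g | ⟨e', i'⟩
      · exact absurd hg' (not_inc_spoke_inner hm)
      · obtain ⟨rfl, h | h⟩ := (inc_path_inner hm).1 hg'
        · exact .inr (by convert hg; exact h.symm)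
        · exact .inl (by convert hg; exact h.symm)
    tauto

/-- The edges of the multigraph that are selected by a perfect matching. -/
def selected (S : Finset (Edge m N b)) : Finset (Fin m) :=
  Finset.univ.filter fun e => (.inr (e, 0) : Edge m N b) ∈ S

theorem IsPerfect.isBMatching {S : Finset (Edge m N b)} (hS : IsPerfect b s t hm S) :
    IsBMatching b s t (selected S) ∧ ∀ v, b v < N := by
  have key : ∀ v, N - b v = (freePorts s t hm (selected S) v).card := by
    intro v
    have h1 : ∀ i : Fin (N - b v), ∃ j, (.inl ⟨v, i, j⟩ : Edge m N b) ∈ S := by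
      intro i
      obtain ⟨g, ⟨hg, hg'⟩, -⟩ := hS (.inr (.inl ⟨v, i⟩))
      rcases g with ⟨v', i', j⟩ | g
      · have := (inc_spoke_extra hm).1 hg'
        cases this
        exact ⟨j, hg⟩
      · exact absurd hg' (not_inc_path_extra hm)
    choose p hp using h1
    -- Sending each extra vertex to its partner is a bijection onto the free ports.
    rw [← Fintype.card_fin (N - b v), ← Finset.card_univ]
    refine Finset.card_bij (fun i _ => p i) (fun i _ => ?_) (fun i _ i' _ h => ?_) (fun j hj => ?_)
    · rw [mem_freePorts]
      rintro ⟨e, he, hev, hj⟩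
      obtain ⟨g, -, hu⟩ := hS (.inl (v, p i))
      have h2 := hu _ ⟨hp i, (inc_spoke_port hm).2 ⟨rfl, rfl⟩⟩
      have he0 : (.inr (e, 0) : Edge m N b) ∈ S := by simpa [selected] using he
      rcases hev with hev | hev
      · have h3 := hu _ ⟨he0, (inc_path_port hm).2 ⟨hj, .inl ⟨rfl, hev⟩⟩⟩
        rw [← h3] at h2
        cases h2
      · have he1 : (.inr (e, ⟨2 * N, by omega⟩) : Edge m N b) ∈ S := by
          rw [hS.mem_path]; simp [he0]
        have h3 := hu _ ⟨he1, (inc_path_port hm).2 ⟨hj, .inr ⟨rfl, hev⟩⟩⟩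
        rw [← h3] at h2
        cases h2
    · obtain ⟨g, -, hu⟩ := hS (.inl (v, p i))
      have h2 := (hu _ ⟨hp i, (inc_spoke_port hm).2 ⟨rfl, rfl⟩⟩).trans
        (hu _ ⟨hp i', (inc_spoke_port hm).2 ⟨rfl, h.symm⟩⟩).symm
      simpa [h] using h2
    · rw [mem_freePorts] at hj
      obtain ⟨g, ⟨hg, hg'⟩, -⟩ := hS (.inl (v, j))
      rcases g with ⟨v', i, j'⟩ | ⟨e, i⟩
      · obtain ⟨rfl, rfl⟩ := (inc_spoke_port hm).1 hg'
        refine ⟨i, Finset.mem_univ _, ?_⟩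
        obtain ⟨g, -, hu⟩ := hS (.inr (.inl ⟨v', i⟩))
        have h2 := (hu _ ⟨hp i, (inc_spoke_extra hm).2 rfl⟩).trans
          (hu _ ⟨hg, (inc_spoke_extra hm).2 rfl⟩).symm
        simpa using h2
      · obtain ⟨h1, h2⟩ := (inc_path_port hm).1 hg'
        refine absurd ⟨e, ?_, ?_, h1⟩ hj
        · have h3 := hS.mem_path hm e i i.2
          rw [Fin.eta] at h3
          -- A path meets a port only with its edges `0` and `2 * N`, both of even index, hence
          -- matched only if the edge is selected.
          have h4 : Even (i : ℕ) := by
            rcases h2 with ⟨h2, -⟩ | ⟨h2, -⟩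
            · rw [h2]; exact Even.zero
            · rw [h2]; exact even_two_mul N
          simp only [h4, iff_true] at h3
          simpa [selected] using h3.1 hg
        · tauto
  -- Since `m < N`, the subtraction from `N` is not truncated on the side of the degree, so the
  -- equation in `key` also excludes `N ≤ b v`.
  have h2 : ∀ v, ((selected S).filter fun e => s e = v ∨ t e = v).card ≤ m := fun v =>
    (Finset.card_le_univ _).trans_eq (Fintype.card_fin m)
  constructor
  · intro v
    have h1 := key v
    rw [card_freePorts] at h1
    have := h2 v
    omega
  · intro v
    have h1 := key v
    rw [card_freePorts] at h1
    have := h2 v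
    omega

/-- The paths of edges in `M` contribute their even edges, all others their odd edges; an arbitrary
bijection matches the extra vertices with the free ports, whose number is right by hypothesis. -/
theorem IsBMatching.exists_isPerfect (hst : ∀ e, s e ≠ t e) {M : Finset (Fin m)}
    (hM : IsBMatching b s t M) :
    ∃ S : Finset (Edge m N b), IsPerfect b s t hm S ∧ selected S = M := by
  classical
  have hcard : ∀ v, Fintype.card (Fin (N - b v)) = Fintype.card (freePorts s t hm M v) := by
    intro v
    rw [Fintype.card_fin, Fintype.card_coe, card_freePorts, hM v]
  have p : ∀ v, Fin (N - b v) ≃ freePorts s t hm M v := fun v => Fintype.equivOfCardEq (hcard v)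
  let P : Edge m N b → Prop := fun g => match g with
    | .inl g => (p g.1 g.2.1 : Fin N) = g.2.2
    | .inr g => (g.1 ∈ M ↔ Even (g.2 : ℕ))
  have hP1 : ∀ v i j, P (.inl ⟨v, i, j⟩) ↔ (p v i : Fin N) = j := fun _ _ _ => Iff.rfl
  have hP2 : ∀ e i, P (.inr (e, i)) ↔ (e ∈ M ↔ Even (i : ℕ)) := fun _ _ => Iff.rfl
  refine ⟨Finset.univ.filter P, ?_, ?_⟩
  · rintro (⟨v, j⟩ | ⟨v, i⟩ | ⟨e, i⟩)
    · by_cases hj : j ∈ freePorts s t hm M v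
      · refine ⟨.inl ⟨v, (p v).symm ⟨j, hj⟩, j⟩, ⟨by simp [hP1], (inc_spoke_port hm).2 ⟨rfl, rfl⟩⟩, ?_⟩
        rintro (⟨v', i', j'⟩ | ⟨e', i'⟩) ⟨hg, hg'⟩
        · obtain ⟨rfl, rfl⟩ := (inc_spoke_port hm).1 hg'
          simp only [Finset.mem_filter, Finset.mem_univ, true_and, hP1] at hg
          have : i' = (p v').symm ⟨j', hj⟩ := by
            rw [Equiv.eq_symm_apply]
            exact Subtype.ext hg
          rw [this]
        · obtain ⟨h1, h2⟩ := (inc_path_port hm).1 hg'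
          simp only [Finset.mem_filter, Finset.mem_univ, true_and, hP2] at hg
          rw [mem_freePorts] at hj
          refine absurd ⟨e', hg.2 ?_, by tauto, h1⟩ hj
          rcases h2 with ⟨h2, -⟩ | ⟨h2, -⟩
          · rw [h2]; exact Even.zero
          · rw [h2]; exact even_two_mul N
      · have hj' := hj
        rw [mem_freePorts, not_not] at hj'
        obtain ⟨e, he, hev, rfl⟩ := hj'
        -- Here `i₀` is the end edge of the path at this port. It is unique because the other end of
        -- the path belongs to a different vertex.
        have huniq : ∀ i₀ : Fin (2 * N + 1), ((i₀ : ℕ) = 0 ∧ s e = v ∨ (i₀ : ℕ) = 2 * N ∧ t e = v) →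
            ∃! g, g ∈ Finset.univ.filter P ∧ Inc b s t hm g (.inl (v, e.castLE hm.le)) := by
          intro i₀ hi₀
          refine ⟨.inr (e, i₀), ⟨?_, (inc_path_port hm).2 ⟨rfl, hi₀⟩⟩, ?_⟩
          · simp only [Finset.mem_filter, Finset.mem_univ, true_and, hP2, he, true_iff]
            rcases hi₀ with ⟨h2, -⟩ | ⟨h2, -⟩
            · rw [h2]; exact Even.zero
            · rw [h2]; exact even_two_mul N
          · rintro (⟨v', i', j'⟩ | ⟨e', i'⟩) ⟨hg, hg'⟩
            · obtain ⟨rfl, rfl⟩ := (inc_spoke_port hm).1 hg'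
              simp only [Finset.mem_filter, Finset.mem_univ, true_and, hP1] at hg
              exact absurd (hg ▸ (p v' i').2) hj
            · obtain ⟨h1, h2⟩ := (inc_path_port hm).1 hg'
              have he' : e' = e := by simpa [Fin.ext_iff] using h1
              subst he'
              have h3 := hst e'
              have : i' = i₀ := by
                refine Fin.ext ?_
                rcases hi₀ with ⟨h4, h5⟩ | ⟨h4, h5⟩ <;> rcases h2 with ⟨h6, h7⟩ | ⟨h6, h7⟩
                · omega
                · exact absurd (h5.trans h7.symm) h3
                · exact absurd (h7.trans h5.symm) h3
                · omega
              rw [this]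
        rcases hev with hev | hev
        · exact huniq 0 (.inl ⟨rfl, hev⟩)
        · exact huniq ⟨2 * N, by omega⟩ (.inr ⟨rfl, hev⟩)
    · refine ⟨.inl ⟨v, i, p v i⟩, ⟨by simp [hP1], (inc_spoke_extra hm).2 rfl⟩, ?_⟩
      rintro (⟨v', i', j'⟩ | g) ⟨hg, hg'⟩
      · have := (inc_spoke_extra hm).1 hg'
        cases this
        simp only [Finset.mem_filter, Finset.mem_univ, true_and, hP1] at hg
        rw [hg]
      · exact absurd hg' (not_inc_path_extra hm)
    · have hi := i.2
      have huniq : ∀ i₀ : Fin (2 * N + 1), ((i₀ : ℕ) = i + 1 ∨ (i₀ : ℕ) = i) →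
          (e ∈ M ↔ Even (i₀ : ℕ)) →
          ∃! g, g ∈ Finset.univ.filter P ∧ Inc b s t hm g (.inr (.inr (e, i))) := by
        intro i₀ hi₀ he
        refine ⟨.inr (e, i₀), ⟨by simpa [hP2] using he, (inc_path_inner hm).2 ⟨rfl, hi₀⟩⟩, ?_⟩
        rintro (g | ⟨e', i'⟩) ⟨hg, hg'⟩
        · exact absurd hg' (not_inc_spoke_inner hm)
        · obtain ⟨rfl, h1⟩ := (inc_path_inner hm).1 hg'
          simp only [Finset.mem_filter, Finset.mem_univ, true_and, hP2] at hg
          have h2 := hg.symm.trans he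
          have : i' = i₀ := by
            refine Fin.ext ?_
            rw [Nat.even_iff, Nat.even_iff] at h2
            omega
          rw [this]
      by_cases h : e ∈ M ↔ Even (i : ℕ)
      · exact huniq ⟨i, by omega⟩ (.inr rfl) h
      · refine huniq ⟨i + 1, by omega⟩ (.inl rfl) ?_
        rw [Nat.even_add_one]
        tauto
  · ext e
    simp [selected, hP2]

end Gadget

/-! ### Red edges, the combined target and bipartiteness -/

namespace Gadget

variable {n m N : ℕ} {b : Fin n → ℕ} {s t : Fin m → Fin n} (hm : m < N) {R B : Finset (Fin m)}

/-- The red edges of the graph. -/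
def IsRed (b : Fin n → ℕ) (N : ℕ) (R B : Finset (Fin m)) : Edge m N b → Prop
  | .inl _ => False
  | .inr g => Even (g.2 : ℕ) ∧ if (g.2 : ℕ) = 2 * N then g.1 ∈ R ∪ B else g.1 ∈ B

instance : DecidablePred (IsRed b N R B) := fun g => by
  rcases g with g | g <;> unfold IsRed <;> infer_instance

/-- The embedding `f` takes the last edge of the path of each selected red edge, and `g` the `N + 1`
even edges for each selected blue one; disjointness of `R` and `B` makes the count a sum. -/
theorem IsPerfect.card_red {S : Finset (Edge m N b)} (hS : IsPerfect b s t hm S)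
    (hRB : Disjoint R B) :
    (S.filter (IsRed b N R B)).card =
      (selected S ∩ R).card + (N + 1) * (selected S ∩ B).card := by
  obtain ⟨f, hf⟩ : ∃ f : Fin m ↪ Edge m N b, ∀ e, f e = .inr (e, ⟨2 * N, by omega⟩) :=
    ⟨⟨fun e => .inr (e, ⟨2 * N, by omega⟩), fun e e' h => by simpa using h⟩, fun _ => rfl⟩
  obtain ⟨g, hg⟩ : ∃ g : Fin m × Fin (N + 1) ↪ Edge m N b,
      ∀ p, g p = .inr (p.1, ⟨2 * p.2, by omega⟩) :=
    ⟨⟨fun p => .inr (p.1, ⟨2 * p.2, by omega⟩), fun p p' h => by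
      simp only [Sum.inr.injEq, Prod.mk.injEq, Fin.mk.injEq] at h
      exact Prod.ext h.1 (Fin.ext (by omega))⟩, fun _ => rfl⟩
  have hsel : ∀ e, e ∈ selected S ↔ (.inr (e, 0) : Edge m N b) ∈ S := fun e => by simp [selected]
  have h1 : S.filter (IsRed b N R B) =
      (selected S ∩ R).map f ∪ ((selected S ∩ B) ×ˢ Finset.univ).map g := by
    ext x
    simp only [Finset.mem_filter, Finset.mem_union, Finset.mem_map, Finset.mem_inter,
      Finset.mem_product, Finset.mem_univ, and_true, hsel]
    constructor
    · rcases x with x | ⟨e, i⟩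
      · exact fun h => h.2.elim
      · rintro ⟨h1, h2, h3⟩
        have h4 := hS.mem_path hm e i i.2
        rw [Fin.eta] at h4
        simp only [h2, iff_true] at h4
        have h5 := h4.1 h1
        obtain ⟨j, hj⟩ := h2
        change (i : ℕ) = j + j at hj
        have hi := i.2
        have hB : e ∈ B → ∃ a : Fin m × Fin (N + 1),
            ((.inr (a.1, 0) : Edge m N b) ∈ S ∧ a.1 ∈ B) ∧ g a = .inr (e, i) := fun h =>
          ⟨(e, ⟨j, by omega⟩), ⟨h5, h⟩, by simp [hg, Fin.ext_iff]; omega⟩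
        by_cases h6 : (i : ℕ) = 2 * N
        · rw [if_pos h6, Finset.mem_union] at h3
          rcases h3 with h3 | h3
          · exact .inl ⟨e, ⟨h5, h3⟩, by simp [hf, Fin.ext_iff]; omega⟩
          · exact .inr (hB h3)
        · rw [if_neg h6] at h3
          exact .inr (hB h3)
    · rintro (⟨e, ⟨h1, h2⟩, rfl⟩ | ⟨⟨e, i⟩, ⟨h1, h2⟩, rfl⟩)
      · rw [hf]
        refine ⟨?_, even_two_mul N, ?_⟩
        · rw [hS.mem_path hm]
          simp [h1]
        · simp [h2]
      · rw [hg]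
        refine ⟨?_, even_two_mul _, ?_⟩
        · rw [hS.mem_path hm]
          simpa using h1
        · simp only at h2 ⊢
          split_ifs
          · exact Finset.mem_union_right _ h2
          · exact h2
  rw [h1, Finset.card_union_of_disjoint, Finset.card_map, Finset.card_map, Finset.card_product,
    Finset.card_univ, Fintype.card_fin, mul_comm (N + 1)]
  rw [Finset.disjoint_left]
  intro x hx hx'
  simp only [Finset.mem_map, Finset.mem_inter, Finset.mem_product] at hx hx'
  obtain ⟨e, ⟨-, h2⟩, rfl⟩ := hx
  obtain ⟨p, ⟨⟨-, h4⟩, -⟩, h5⟩ := hx'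
  have : p.1 = e := by
    simp only [hf, hg, Sum.inr.injEq, Prod.mk.injEq] at h5
    exact h5.1
  exact Finset.disjoint_left.1 hRB h2 (this ▸ h4)

/-- Both sides are expansions in base `N + 1` with digits at most `N`. A target capped at `N` cannot
equal a count below `N`, so capping creates no solutions. -/
theorem add_mul_inj {N r c k l : ℕ} (hr : r < N) (hc : c < N) :
    r + (N + 1) * c = min k N + (N + 1) * min l N ↔ r = k ∧ c = l := by
  constructor
  · intro h
    have h1 := congrArg (· % (N + 1)) h
    have h2 := congrArg (· / (N + 1)) h
    simp only [Nat.add_mul_mod_self_left] at h1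
    simp only [Nat.add_mul_div_left _ _ (Nat.succ_pos N)] at h2
    rw [Nat.mod_eq_of_lt (by omega), Nat.mod_eq_of_lt (by omega)] at h1
    rw [Nat.div_eq_of_lt (by omega), Nat.div_eq_of_lt (by omega)] at h2
    omega
  · rintro ⟨rfl, rfl⟩
    rw [min_eq_left hr.le, min_eq_left hc.le]

/-- Perfect matchings of the graph with the right number of red edges correspond to perfect
`b`-matchings with the right numbers of red and blue edges. -/
theorem exists_isPerfect_iff (hst : ∀ e, s e ≠ t e) (hRB : Disjoint R B) (k l : ℕ) :
    (∃ S : Finset (Edge m N b), IsPerfect b s t hm S ∧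
      (S.filter (IsRed b N R B)).card = min k N + (N + 1) * min l N) ↔
    ∃ M, IsBMatching b s t M ∧ (M ∩ R).card = k ∧ (M ∩ B).card = l := by
  have hlt : ∀ A : Finset (Fin m), A.card < N := fun A =>
    ((Finset.card_le_univ A).trans_eq (Fintype.card_fin m)).trans_lt hm
  constructor
  · rintro ⟨S, hS, h⟩
    rw [hS.card_red hm hRB, add_mul_inj (hlt _) (hlt _)] at h
    exact ⟨_, (hS.isBMatching hm).1, h⟩
  · rintro ⟨M, hM, h⟩
    obtain ⟨S, hS, rfl⟩ := hM.exists_isPerfect hm hst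
    exact ⟨S, hS, by rw [hS.card_red hm hRB, add_mul_inj (hlt _) (hlt _)]; exact h⟩

/-- Ports inherit the side of their vertex, extra vertices get the opposite side, and the sides
alternate along a path; its odd length fits the two different sides of its ends. -/
theorem exists_colouring {side : Fin n → Bool} (hside : ∀ e, side (s e) ≠ side (t e)) :
    ∃ c : Vertex m N b → Bool, ∀ g : Edge m N b, c (ends b s t hm g).1 ≠ c (ends b s t hm g).2 := by
  let c : Vertex m N b → Bool := fun x => match x with
    | .inl p => side p.1
    | .inr (.inl p) => !side p.1
    | .inr (.inr p) => if Even (p.2 : ℕ) then !side (s p.1) else side (s p.1)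
  have hc : ∀ e i, i ≤ 2 * N + 1 →
      c (pathVertex b s t hm e i) = if Even i then side (s e) else !side (s e) := by
    intro e i hi
    unfold pathVertex
    split_ifs with h1 h2 h3 h3 h3
    · rfl
    · exact absurd (h1 ▸ Even.zero) h2
    · have : ¬ Even (i - 1) := by rw [Nat.even_iff] at h3 ⊢; omega
      simp [c, this]
    · have : Even (i - 1) := by rw [Nat.even_iff] at h3 ⊢; omega
      simp [c, this]
    · rw [Nat.even_iff] at h3; omega
    · have := hside e
      simp only [c]
      revert this
      cases side (s e) <;> cases side (t e) <;> simp
  refine ⟨c, ?_⟩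
  rintro (g | ⟨e, i⟩)
  · simp [ends, c]
  · have hi := i.2
    simp only [ends]
    rw [hc e i (by omega), hc e (i + 1) (by omega)]
    by_cases h : Even (i : ℕ) <;> simp [h, Nat.even_add_one]

/-- The hypothesis `hb` provides an extra vertex for every `v`. It is adjacent to all ports of `v`,
which therefore share a side, and this becomes the side of `v`. -/
theorem exists_side (hb : ∀ v, b v < N) {c : Vertex m N b → Bool}
    (hc : ∀ g : Edge m N b, c (ends b s t hm g).1 ≠ c (ends b s t hm g).2) :
    ∃ side : Fin n → Bool, ∀ e, side (s e) ≠ side (t e) := by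
  refine ⟨fun v => !c (.inr (.inl ⟨v, ⟨0, Nat.sub_pos_of_lt (hb v)⟩⟩)), fun e => ?_⟩
  have hport : ∀ v j, c (.inl (v, j)) = !c (.inr (.inl ⟨v, ⟨0, Nat.sub_pos_of_lt (hb v)⟩⟩)) := by
    intro v j
    have := hc (.inl ⟨v, ⟨0, Nat.sub_pos_of_lt (hb v)⟩, j⟩)
    simp only [ends] at this
    revert this
    generalize c (.inl (v, j)) = x
    generalize c (.inr (.inl _)) = y
    cases x <;> cases y <;> simp
  have hpath : ∀ i, i ≤ 2 * N + 1 → c (pathVertex b s t hm e i) =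
      if Even i then c (pathVertex b s t hm e 0) else !c (pathVertex b s t hm e 0) := by
    intro i
    induction i with
    | zero => simp
    | succ i ih =>
      intro hi
      have h1 := hc (.inr (e, ⟨i, by omega⟩))
      simp only [ends] at h1
      rw [ih (by omega)] at h1
      revert h1
      generalize c (pathVertex b s t hm e (i + 1)) = x
      generalize c (pathVertex b s t hm e 0) = y
      by_cases h : Even i <;> simp only [h, if_true, if_false, Nat.even_add_one, not_true, not_false_eq_true] <;>
        cases x <;> cases y <;> simp
  have h2 := hpath (2 * N + 1) le_rfl
  have h3 : ¬ Even (2 * N + 1) := by simp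
  rw [if_neg h3] at h2
  have h4 : pathVertex b s t hm e 0 = .inl (s e, e.castLE hm.le) := rfl
  have h5 : pathVertex b s t hm e (2 * N + 1) = .inl (t e, e.castLE hm.le) := by
    unfold pathVertex
    simp
  rw [h4, h5, hport, hport] at h2
  intro h
  beta_reduce at h
  rw [← h] at h2
  revert h2
  generalize c (.inr (.inl _)) = y
  cases y <;> simp

end Gadget

/-! ### The code of a graph -/

theorem map_bit_append_inj : ∀ {ds ds' : List Bool} {w w' : List Letter}, NoBit w → NoBit w' →
    ds.map Letter.bit ++ w = ds'.map Letter.bit ++ w' → ds = ds' ∧ w = w'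
  | [], [], _, _, _, _, h => ⟨rfl, h⟩
  | [], d :: ds', w, w', hw, _, h => by
    have := hw (.bit d) (by rw [List.map_nil, List.nil_append] at h; simp [h])
    cases this
  | d :: ds, [], w, w', _, hw', h => by
    have := hw' (.bit d) (by rw [List.map_nil, List.nil_append] at h; simp [← h])
    cases this
  | d :: ds, d' :: ds', w, w', hw, hw', h => by
    simp only [List.map_cons, List.cons_append, List.cons.injEq, Letter.bit.injEq] at h
    obtain ⟨rfl, h⟩ := h
    obtain ⟨rfl, rfl⟩ := map_bit_append_inj hw hw' h
    exact ⟨rfl, rfl⟩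

theorem numeral_append_inj {m m' : Letter} {a a' : ℕ} {w w' : List Letter} (hw : NoBit w)
    (hw' : NoBit w') (h : numeral m a ++ w = numeral m' a' ++ w') : m = m' ∧ a = a' ∧ w = w' := by
  simp only [numeral, List.cons_append, List.cons.injEq] at h
  obtain ⟨h1, h2⟩ := map_bit_append_inj hw hw' h.2
  refine ⟨h.1, ?_, h2⟩
  -- Capping at `max a a'` changes neither number, so `cappedValue` recovers both from their common
  -- digits.
  have h3 := Routine.cappedValue_bits (max a a') a
  have h4 := Routine.cappedValue_bits (max a a') a'
  rw [h1] at h3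
  omega

theorem noBit_edges {es : List (Letter × ℕ × ℕ)} (hes : ∀ e ∈ es, e.1.isColour = true)
    {w : List Letter} (hw : NoBit w) : NoBit (es.flatMap rawEdge ++ w) := by
  cases es with
  | nil => exact hw
  | cons e es =>
    obtain ⟨m, u, v⟩ := e
    have he := hes _ List.mem_cons_self
    simp only [List.flatMap_cons, rawEdge, edgeText, List.append_assoc]
    refine Routine.noBit_numeral ?_ _ _
    cases m <;> first | rfl | cases he

theorem edges_target_inj {es es' : List (Letter × ℕ × ℕ)} {k k' : ℕ}
    (hes : ∀ e ∈ es, e.1.isColour = true) (hes' : ∀ e ∈ es', e.1.isColour = true)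
    (h : es.flatMap rawEdge ++ numeral .target k = es'.flatMap rawEdge ++ numeral .target k') :
    es = es' ∧ k = k' := by
  have hnil : NoBit [] := by intro a ha; cases ha
  have hT : ∀ k, NoBit (numeral .target k) := fun k => by
    rw [← List.append_nil (numeral _ k)]
    exact Routine.noBit_numeral rfl _ _
  induction es generalizing es' with
  | nil =>
    cases es' with
    | nil => exact ⟨rfl, (numeral_append_inj hnil hnil (by simpa using h)).2.1⟩
    | cons e' es' =>
      have he := hes' _ List.mem_cons_self
      simp only [List.flatMap_nil, List.nil_append, List.flatMap_cons, rawEdge, edgeText, numeral,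
        List.cons_append, List.cons.injEq] at h
      rw [← h.1] at he
      cases he
  | cons e es ih =>
    cases es' with
    | nil =>
      have he := hes _ List.mem_cons_self
      simp only [List.flatMap_nil, List.nil_append, List.flatMap_cons, rawEdge, edgeText, numeral,
        List.cons_append, List.cons.injEq] at h
      rw [h.1] at he
      cases he
    | cons e' es' =>
      have h1 := fun e he => hes e (List.mem_cons_of_mem _ he)
      have h2 := fun e he => hes' e (List.mem_cons_of_mem _ he)
      simp only [List.flatMap_cons, rawEdge, edgeText, List.append_assoc] at h
      obtain ⟨h3, h4, h⟩ := numeral_append_inj (Routine.noBit_numeral rfl _ _)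
        (Routine.noBit_numeral rfl _ _) h
      obtain ⟨-, h5, h⟩ := numeral_append_inj (noBit_edges h1 (hT k)) (noBit_edges h2 (hT k')) h
      obtain ⟨rfl, rfl⟩ := ih h1 h2 h
      exact ⟨by rw [show e = e' from Prod.ext h3 (Prod.ext h4 h5)], rfl⟩

theorem replicate_vertex_append_inj {n n' : ℕ} {w w' : List Letter}
    (hw : ∀ a, w.head? = some a → a.isVertex = false)
    (hw' : ∀ a, w'.head? = some a → a.isVertex = false)
    (h : List.replicate n .vertex ++ w = List.replicate n' .vertex ++ w') : n = n' ∧ w = w' := by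
  induction n generalizing n' with
  | zero =>
    cases n' with
    | zero => exact ⟨rfl, by simpa using h⟩
    | succ n' =>
      have := hw .vertex (by
        rw [List.replicate_zero, List.nil_append] at h; simp [h, List.replicate_succ])
      cases this
  | succ n ih =>
    cases n' with
    | zero =>
      have := hw' .vertex (by
        rw [List.replicate_zero, List.nil_append] at h; simp [← h, List.replicate_succ])
      cases this
    | succ n' =>
      rw [List.replicate_succ, List.replicate_succ, List.cons_append, List.cons_append,
        List.cons.injEq] at h
      obtain ⟨rfl, rfl⟩ := ih h.2
      exact ⟨rfl, rfl⟩

theorem head?_edges_target {es : List (Letter × ℕ × ℕ)} (hes : ∀ e ∈ es, e.1.isColour = true)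
    (k : ℕ) : ∀ a, (es.flatMap rawEdge ++ numeral .target k).head? = some a →
      a.isVertex = false := by
  cases es with
  | nil => simp [numeral, Letter.isVertex]
  | cons e es =>
    obtain ⟨m, u, v⟩ := e
    have he := hes _ List.mem_cons_self
    simp only [List.flatMap_cons, rawEdge, edgeText, numeral, List.cons_append, List.head?_cons,
      Option.some.injEq]
    rintro _ rfl
    cases m <;> first | rfl | cases he

/-- The code of an instance determines the instance. -/
theorem graph_code_inj {n n' k k' : ℕ} {es es' : List (Letter × ℕ × ℕ)}
    (hes : ∀ e ∈ es, e.1.isColour = true) (hes' : ∀ e ∈ es', e.1.isColour = true)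
    (h : List.replicate n .vertex ++ es.flatMap rawEdge ++ numeral .target k =
      List.replicate n' .vertex ++ es'.flatMap rawEdge ++ numeral .target k') :
    n = n' ∧ es = es' ∧ k = k' := by
  rw [List.append_assoc, List.append_assoc] at h
  obtain ⟨h1, h⟩ := replicate_vertex_append_inj (head?_edges_target hes k)
    (head?_edges_target hes' k') h
  exact ⟨h1, edges_target_inj hes hes' h⟩

/-! ### Codes of graphs and matchings over indexed edges -/

namespace ExactPMInstance

/-- An edge of a graph with its colour. -/
def rawEdge (I : ExactPMInstance) (p : Fin I.n × Fin I.n) : Letter × ℕ × ℕ :=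
  (if s(p.1, p.2) ∈ I.R then .red else .plain, p.1, p.2)

theorem isColour_rawEdge (I : ExactPMInstance) (p : Fin I.n × Fin I.n) :
    (I.rawEdge p).1.isColour = true := by
  simp only [rawEdge]
  split_ifs <;> rfl

theorem isEncodedBy_iff {I : ExactPMInstance} {x : List Letter} : I.IsEncodedBy x ↔
    ∃ es : List (Fin I.n × Fin I.n), (es.map fun p => s(p.1, p.2)).Nodup ∧
      (∀ e, e ∈ es.map (fun p => s(p.1, p.2)) ↔ e ∈ I.G.edgeSet) ∧
      x = List.replicate I.n .vertex ++ (es.map I.rawEdge).flatMap _root_.rawEdge ++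
        numeral .target I.k := by
  unfold IsEncodedBy
  refine exists_congr fun es => and_congr_right' (and_congr_right' ?_)
  rw [List.flatMap_map]
  have : ∀ p : Fin I.n × Fin I.n, edgeCode (if s(p.1, p.2) ∈ I.R then .red else .plain) p =
      _root_.rawEdge (I.rawEdge p) := by
    intro p
    simp only [edgeCode, _root_.rawEdge, rawEdge, edgeText]
  simp only [this]

/-- This is what makes `blue` usable as an alarm letter for edges with invalid ends. -/
theorem blue_notMem {I : ExactPMInstance} {x : List Letter} (h : I.IsEncodedBy x) :
    Letter.blue ∉ x := by
  obtain ⟨es, -, -, rfl⟩ := h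
  have hbits : ∀ a : ℕ, Letter.blue ∉ a.bits.map Letter.bit := by simp
  simp only [List.mem_append, List.mem_replicate, List.mem_flatMap, edgeCode, numeral, List.mem_cons]
  rintro ((⟨-, h⟩ | ⟨p, -, ((h | h) | (h | h))⟩) | (h | h))
  · cases h
  · split_ifs at h
  · exact hbits _ h
  · cases h
  · exact hbits _ h
  · cases h
  · exact hbits _ h

/-- Perfect matchings in terms of an indexing of the edges. -/
theorem isYes_iff {I : ExactPMInstance} {E : Type} [Fintype E] {φ : E → Sym2 (Fin I.n)}
    (hφ : Function.Injective φ) (hG : ∀ z, z ∈ I.G.edgeSet ↔ ∃ g, φ g = z) {red : E → Prop}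
    [DecidablePred red] (hR : ∀ g, φ g ∈ I.R ↔ red g) :
    I.IsYes ↔ ∃ S : Finset E, (S.filter red).card = I.k ∧ ∀ v, ∃! g, g ∈ S ∧ v ∈ φ g := by
  classical
  have hcard : ∀ S : Finset E, (S.image φ ∩ I.R).card = (S.filter red).card := by
    intro S
    have : S.image φ ∩ I.R = (S.filter red).image φ := by
      ext z
      simp only [Finset.mem_inter, Finset.mem_image, Finset.mem_filter]
      constructor
      · rintro ⟨⟨g, hg, rfl⟩, hz⟩
        exact ⟨g, ⟨hg, (hR g).1 hz⟩, rfl⟩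
      · rintro ⟨g, ⟨hg, hg'⟩, rfl⟩
        exact ⟨⟨g, hg, rfl⟩, (hR g).2 hg'⟩
    rw [this, Finset.card_image_of_injective _ hφ]
  have huniq : ∀ (S : Finset E) v, (∃! e, e ∈ S.image φ ∧ v ∈ e) ↔ ∃! g, g ∈ S ∧ v ∈ φ g := by
    intro S v
    constructor
    · rintro ⟨e, ⟨he, hv⟩, hu⟩
      obtain ⟨g, hg, rfl⟩ := Finset.mem_image.1 he
      exact ⟨g, ⟨hg, hv⟩, fun g' hg' =>
        hφ (hu _ ⟨Finset.mem_image_of_mem _ hg'.1, hg'.2⟩)⟩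
    · rintro ⟨g, ⟨hg, hv⟩, hu⟩
      refine ⟨φ g, ⟨Finset.mem_image_of_mem _ hg, hv⟩, ?_⟩
      rintro e ⟨he, hv'⟩
      obtain ⟨g', hg', rfl⟩ := Finset.mem_image.1 he
      rw [hu g' ⟨hg', hv'⟩]
  constructor
  · rintro ⟨M, hM, hk, hv⟩
    have hM' : M = (Finset.univ.filter fun g => φ g ∈ M).image φ := by
      ext z
      simp only [Finset.mem_image, Finset.mem_filter, Finset.mem_univ, true_and]
      constructor
      · intro hz
        obtain ⟨g, rfl⟩ := (hG z).1 (hM z hz)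
        exact ⟨g, hz, rfl⟩
      · rintro ⟨g, hg, rfl⟩
        exact hg
    rw [hM'] at hk hv
    refine ⟨_, (hcard _).symm.trans ?_, fun v => (huniq _ v).1 (hv v)⟩
    rw [← hk]
  · rintro ⟨S, hk, hv⟩
    refine ⟨S.image φ, ?_, ?_, fun v => (huniq S v).2 (hv v)⟩
    · intro e he
      obtain ⟨g, -, rfl⟩ := Finset.mem_image.1 he
      exact (hG _).2 ⟨g, rfl⟩
    · rw [← hk, ← hcard]

end ExactPMInstance

theorem flatMap_range_eq {γ : Type} (K : ℕ) (f : ℕ → List γ) :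
    (List.range K).flatMap f = (List.finRange K).flatMap fun i : Fin K => f i := by
  have : List.range K = (List.finRange K).map Fin.val := by
    refine List.ext_getElem (by simp) fun i _ _ => by simp
  rw [this, List.flatMap_map]

theorem nodup_flatMap_of_leftInverse {γ δ : Type} {l : List γ} {f : γ → List δ} (π : δ → γ)
    (hl : l.Nodup) (hf : ∀ a, (f a).Nodup) (hπ : ∀ a, ∀ d ∈ f a, π d = a) :
    (l.flatMap f).Nodup := by
  rw [List.nodup_flatMap]
  refine ⟨fun a _ => hf a, hl.imp fun {a a'} h => ?_⟩
  intro d hd hd'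
  exact h ((hπ a d hd).symm.trans (hπ a' d hd'))

/-! ### The numbering of the vertices and the list of the edges -/

namespace Gadget

variable {n m N : ℕ} {b : Fin n → ℕ} {s t : Fin m → Fin n} (hm : m < N) {R B : Finset (Fin m)}

/-- All edges of the graph. -/
def allEdges (m N : ℕ) (b : Fin n → ℕ) : List (Edge m N b) :=
  ((List.finRange n).flatMap fun v => (List.finRange (N - b v)).flatMap fun i =>
    (List.finRange N).map fun j => .inl ⟨v, i, j⟩) ++
  (List.finRange m).flatMap fun e => (List.finRange (2 * N + 1)).map fun i => .inr (e, i)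

theorem mem_allEdges (g : Edge m N b) : g ∈ allEdges m N b := by
  rcases g with ⟨v, i, j⟩ | ⟨e, i⟩ <;> simp [allEdges]

theorem nodup_allEdges : (allEdges m N b).Nodup := by
  refine List.Nodup.append ?_ ?_ ?_
  -- The left inverse must be defined on all edges and so needs a default value; the empty cases of
  -- `Fin n`, `Fin (N - b v)` and `Fin m` are treated separately.
  · rcases n with _ | n
    · simp
    refine nodup_flatMap_of_leftInverse (fun g => match g with
      | .inl g => g.1
      | _ => 0) (List.nodup_finRange _) (fun v => ?_) (fun v g hg => ?_)
    · by_cases hv : N - b v = 0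
      · have : List.finRange (N - b v) = [] := by rw [List.finRange_eq_nil_iff]; exact hv
        rw [this]
        simp
      refine nodup_flatMap_of_leftInverse (fun g => match g with
        | .inl g => if h : g.1 = v then h ▸ g.2.1 else ⟨0, by omega⟩
        | _ => ⟨0, by omega⟩) (List.nodup_finRange _) (fun i => ?_) (fun i g hg => ?_)
      · exact (List.nodup_finRange _).map fun j j' h => by simpa using h
      · obtain ⟨j, -, rfl⟩ := List.mem_map.1 hg
        simp
    · simp only [List.mem_flatMap, List.mem_map] at hg
      obtain ⟨i, -, j, -, rfl⟩ := hg
      rfl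
  · rcases m with _ | m
    · simp
    refine nodup_flatMap_of_leftInverse (fun g => match g with
      | .inr g => g.1
      | _ => 0) (List.nodup_finRange _) (fun e => ?_) (fun e g hg => ?_)
    · exact (List.nodup_finRange _).map fun j j' h => by simpa using h
    · obtain ⟨j, -, rfl⟩ := List.mem_map.1 hg
      rfl
  · intro g hg hg'
    simp only [List.mem_flatMap, List.mem_map] at hg hg'
    obtain ⟨v, -, i, -, j, -, rfl⟩ := hg
    obtain ⟨e, -, i, -, h⟩ := hg'
    cases h

/-- The number of vertices. -/
def vertexCount (m N : ℕ) (b : Fin n → ℕ) : ℕ := n * N + (∑ v, (N - b v) + m * (2 * N))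

/-- The numbering of the vertices. -/
def name (m N : ℕ) (b : Fin n → ℕ) : Vertex m N b ≃ Fin (vertexCount m N b) :=
  (Equiv.sumCongr finProdFinEquiv
    ((Equiv.sumCongr finSigmaFinEquiv finProdFinEquiv).trans finSumFinEquiv)).trans finSumFinEquiv

theorem name_port (v : Fin n) (j : Fin N) : (name m N b (.inl (v, j)) : ℕ) = j + N * v := by
  change ((finSumFinEquiv (.inl (finProdFinEquiv (v, j))) :
    Fin (n * N + (∑ v, (N - b v) + m * (2 * N)))) : ℕ) = _
  simp

theorem name_extra (v : Fin n) (i : Fin (N - b v)) : (name m N b (.inr (.inl ⟨v, i⟩)) : ℕ) =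
    N * n + ∑ k : Fin v, (N - b (Fin.castLE v.2.le k)) + i := by
  change ((finSumFinEquiv (.inr (finSumFinEquiv (.inl (finSigmaFinEquiv ⟨v, i⟩)))) :
    Fin (n * N + (∑ v, (N - b v) + m * (2 * N)))) : ℕ) = _
  simp [finSigmaFinEquiv_apply]
  ring

theorem name_inner (e : Fin m) (i : Fin (2 * N)) : (name m N b (.inr (.inr (e, i))) : ℕ) =
    N * n + ∑ v, (N - b v) + 2 * N * e + i := by
  change ((finSumFinEquiv (.inr (finSumFinEquiv (.inr (finProdFinEquiv (e, i))))) :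
    Fin (n * N + (∑ v, (N - b v) + m * (2 * N)))) : ℕ) = _
  simp
  ring

/-- The colour of an edge, where `colour` are the colours of the edges of the multigraph. -/
def edgeColour (colour : Fin m → Letter) : Edge m N b → Letter
  | .inl _ => .plain
  | .inr g => if Even (g.2 : ℕ) then
      (if (g.2 : ℕ) = 2 * N then (colour g.1).lastColour else (colour g.1).pathColour) else .plain

/-- The code of the edges of the graph. -/
def codeOf (s t : Fin m → Fin n) (hm : m < N) (colour : Fin m → Letter) (g : Edge m N b) : List Letter :=
  edgeText (edgeColour colour g) (name m N b (ends b s t hm g).1) (name m N b (ends b s t hm g).2)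

/-- The running counter of the program becomes a closed formula: the extra vertices of `v` start
after the sum of the earlier `N - b k`, which matches `finSigmaFinEquiv`. -/
theorem vertexText_eq (N : ℕ) : ∀ (n : ℕ) (b : Fin n → ℕ) (vb c : ℕ),
    vertexText N vb c ((List.finRange n).map b) = (List.finRange n).flatMap fun v : Fin n =>
      extraText N (vb + N * v) (c + ∑ k : Fin v, (N - b (Fin.castLE v.2.le k))) (N - b v)
  | 0, b, vb, c => by simp [vertexText]
  | n + 1, b, vb, c => by
    rw [List.finRange_succ, List.map_cons, vertexText, List.map_map,
      vertexText_eq N n (b ∘ Fin.succ), List.flatMap_cons, List.flatMap_map]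
    have h0 : ∑ k : Fin ((0 : Fin (n + 1)) : ℕ),
        (N - b (Fin.castLE (0 : Fin (n + 1)).2.le k)) = 0 := Fin.sum_univ_zero _
    refine congrArg₂ (· ++ ·) (by rw [h0]; simp) ?_
    · congr 1
      funext v
      have h1 : vb + N + N * v = vb + N * v.succ := by rw [Fin.val_succ]; ring
      have h2 : ∑ k : Fin (v.succ : Fin (n + 1)), (N - b (Fin.castLE v.succ.2.le k)) =
          (N - b 0) + ∑ k : Fin v, (N - b (Fin.castLE v.2.le k).succ) :=
        Fin.sum_univ_succ _
      rw [h1, h2, ← add_assoc]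
      rfl

/-- The program writes a path in pairs of edges plus a last one. With `p` the sequence of all its
vertex names, ports included, it becomes a uniform list of consecutive pairs coloured by parity. -/
theorem linkText_eq (N : ℕ) (colour : Letter) (j c u v : ℕ) {p : ℕ → ℕ} (h0 : p 0 = j + N * u)
    (h1 : ∀ i < 2 * N, p (i + 1) = c + i) (h2 : p (2 * N + 1) = j + N * v) :
    linkText N colour j c u v = (List.range (2 * N + 1)).flatMap fun i => edgeText
      (if Even i then (if i = 2 * N then colour.lastColour else colour.pathColour) else .plain)
      (p i) (p (i + 1)) := by
  have hp : ∀ k ≤ N, pathEnd (j + N * u) c k = p (2 * k) := by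
    intro k hk
    unfold pathEnd
    split_ifs with h
    · rw [h, ← h0]
    · have := h1 (2 * k - 1) (by omega)
      rw [show 2 * k - 1 + 1 = 2 * k by omega] at this
      rw [this]
      omega
  have key : ∀ k ≤ N, pathText colour (j + N * u) c k = (List.range (2 * k)).flatMap fun i => edgeText
      (if Even i then (if i = 2 * N then colour.lastColour else colour.pathColour) else .plain)
      (p i) (p (i + 1)) := by
    intro k
    induction k with
    | zero => intro _; rfl
    | succ k ih =>
      intro hk
      have h3 := h1 (2 * k) (by omega)
      have h4 := h1 (2 * k + 1) (by omega)
      rw [show 2 * (k + 1) = 2 * k + 1 + 1 by ring, List.range_succ, List.range_succ,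
        List.flatMap_append, List.flatMap_append, ← ih (by omega)]
      simp only [pathText, List.range_succ, List.flatMap_append, List.flatMap_singleton,
        List.append_assoc]
      rw [hp k (by omega), if_pos (even_two_mul k), if_neg (by omega), if_neg (by simp), h3, h4]
      rfl
  rw [linkText, key N le_rfl, List.range_succ, List.flatMap_append, List.flatMap_singleton,
    hp N le_rfl, if_pos (even_two_mul N), if_pos rfl, h2]

/-- For valid ends the alarm is silent and, since `n' ≤ N`, capping at `N` has no effect. -/
theorem edgesText_eq (N n' : ℕ) : ∀ (m : ℕ) (colour : Fin m → Letter) (s t : Fin m → ℕ) (j c : ℕ),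
    (∀ e, s e < n') → (∀ e, t e < n') → (∀ e, s e ≠ t e) → n' ≤ N →
    edgesText N n' j c ((List.finRange m).map fun e => (colour e, s e, t e)) =
      (List.finRange m).flatMap fun e : Fin m =>
        linkText N (colour e) (j + e) (c + 2 * N * e) (s e) (t e)
  | 0, colour, s, t, j, c, _, _, _, _ => by simp [edgesText]
  | m + 1, colour, s, t, j, c, hs, ht, hst, hn => by
    have ih := edgesText_eq N n' m (colour ∘ Fin.succ) (s ∘ Fin.succ) (t ∘ Fin.succ) (j + 1)
      (c + 2 * N) (fun e => hs _) (fun e => ht _) (fun e => hst _) hn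
    rw [List.finRange_succ, List.map_cons, edgesText, List.map_map,
      min_eq_left ((hs 0).le.trans hn), min_eq_left ((ht 0).le.trans hn), alarmText,
      if_pos ⟨hs 0, ht 0, hst 0⟩, List.nil_append, List.flatMap_cons, List.flatMap_map]
    refine congrArg₂ (· ++ ·) (by simp) (ih.trans ?_)
    · congr 1
      funext e
      have h1 : j + 1 + e = j + e.succ := by rw [Fin.val_succ]; ring
      have h2 : c + 2 * N + 2 * N * e = c + 2 * N * e.succ := by rw [Fin.val_succ]; ring
      rw [h1, h2]
      rfl

theorem graphText_eq (hst : ∀ e, s e ≠ t e) (hn : n ≤ N) (colour : Fin m → Letter) :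
    Routine.graphText N ((List.finRange n).map b)
      ((List.finRange m).map fun e => (colour e, (s e : ℕ), (t e : ℕ))) =
    (allEdges m N b).flatMap (codeOf s t hm colour) := by
  have hextra : extraCount N ((List.finRange n).map b) = ∑ v, (N - b v) := by
    rw [extraCount, List.map_map, ← List.ofFn_eq_map, List.sum_ofFn]
    rfl
  rw [Routine.graphText, vertexText_eq, List.length_map, List.length_finRange, hextra,
    edgesText_eq N n m colour (fun e => s e) (fun e => t e) _ _ (fun e => (s e).2)
      (fun e => (t e).2) (fun e h => hst e (Fin.ext h)) hn, allEdges, List.flatMap_append,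
    List.flatMap_assoc, List.flatMap_assoc]
  congr 1
  · congr 1
    funext v
    rw [List.flatMap_assoc, extraText, flatMap_range_eq]
    congr 1
    funext i
    rw [portText, flatMap_range_eq, List.flatMap_map]
    congr 1
    funext j
    simp only [codeOf, edgeColour, ends, name_port, name_extra]
    congr 1
    ring
  · congr 1
    funext e
    have hp : ∀ i, (name m N b (pathVertex b s t hm e i) : ℕ) = if i = 0 then e + N * s e
        else if i - 1 < 2 * N then N * n + ∑ v, (N - b v) + 2 * N * e + (i - 1)
        else e + N * t e := by
      intro i
      unfold pathVertex
      split_ifs with h1 h2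
      · simp [name_port]
      · simp [name_inner]
      · simp [name_port]
    rw [linkText_eq N (colour e) _ _ _ _ (p := fun i => name m N b (pathVertex b s t hm e i)),
      flatMap_range_eq, List.flatMap_map]
    · rfl
    · simp [hp]
    · intro i hi
      simp [hp, hi]
    · simp [hp]

end Gadget

/-- Membership in the language only asserts that some instance is encoded. The string determines
`n`, `k` and the coloured list of edges, and with them the graph and its red set, which contains
only edges of the graph. -/
theorem ExactPMInstance.IsEncodedBy.unique {I J : ExactPMInstance} {x : List Letter}
    (hI : I.IsEncodedBy x) (hJ : J.IsEncodedBy x) : I = J := by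
  rw [ExactPMInstance.isEncodedBy_iff] at hI hJ
  obtain ⟨es, -, hes, hx⟩ := hI
  obtain ⟨es', -, hes', hx'⟩ := hJ
  rw [hx] at hx'
  obtain ⟨hn, hee, hk⟩ := graph_code_inj (List.forall_mem_map.2 fun p _ => I.isColour_rawEdge p)
    (List.forall_mem_map.2 fun p _ => J.isColour_rawEdge p) hx'
  clear hx hx'
  obtain ⟨n, G, R, hR, k⟩ := I
  obtain ⟨n', G', R', hR', k'⟩ := J
  obtain rfl : n = n' := hn
  obtain rfl : k = k' := hk
  dsimp only at *
  obtain rfl : es = es' := by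
    have h := congrArg (List.map fun e : Letter × ℕ × ℕ => e.2) hee
    simp only [List.map_map] at h
    refine List.map_injective_iff.2 ?_ h
    intro p q hpq
    simp only [Function.comp, ExactPMInstance.rawEdge, Prod.mk.injEq, Fin.val_inj] at hpq
    exact Prod.ext hpq.1 hpq.2
  obtain rfl : G = G' := by
    rw [← SimpleGraph.edgeSet_inj]
    ext z
    rw [← hes, hes']
  have h : ∀ z ∈ G.edgeSet, z ∈ R ↔ z ∈ R' := by
    intro z hz
    obtain ⟨p, hp, rfl⟩ := List.mem_map.1 ((hes z).2 hz)
    have h1 := congrArg Prod.fst (List.map_inj_left.1 hee p hp)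
    simp only [ExactPMInstance.rawEdge] at h1
    split_ifs at h1 with h2 h3 h3 <;> simp [h2, h3]
  obtain rfl : R = R' := by
    ext z
    exact ⟨fun hz => (h z (hR z hz)).1 hz, fun hz => (h z (hR' z hz)).2 hz⟩
  rfl

/-! ### The gadget graph as an instance of Exact Perfect Matching -/

namespace Gadget

variable {n m N : ℕ} {b : Fin n → ℕ} {s t : Fin m → Fin n} (hm : m < N) {R B : Finset (Fin m)}

/-- An edge as an unordered pair of numbers of vertices. -/
def edgePair (b : Fin n → ℕ) (s t : Fin m → Fin n) (hm : m < N) (g : Edge m N b) :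
    Sym2 (Fin (vertexCount m N b)) :=
  s(name m N b (ends b s t hm g).1, name m N b (ends b s t hm g).2)

theorem edgePair_injective (hst : ∀ e, s e ≠ t e) : Function.Injective (edgePair b s t hm) :=
  fun g g' h => ends_injective hm hst
    (Sym2.map.injective (name m N b).injective (by simpa [edgePair] using h))

theorem mem_edgePair {g : Edge m N b} {x : Vertex m N b} :
    name m N b x ∈ edgePair b s t hm g ↔ Inc b s t hm g x := by
  simp [edgePair, Inc, eq_comm]

theorem ends_ne (hst : ∀ e, s e ≠ t e) (g : Edge m N b) :
    (ends b s t hm g).1 ≠ (ends b s t hm g).2 := by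
  rcases g with g | ⟨e, i⟩
  · simp [ends]
  · intro h
    have hi := i.2
    have := (pathVertex_injective (b := b) hm hst (e := e) (e' := e) (i := i) (i' := i + 1)
      (by omega) (by omega) h).2
    omega

/-- The graph as an instance. -/
def graphInstance (hm : m < N) (hst : ∀ e, s e ≠ t e) (b : Fin n → ℕ) (R B : Finset (Fin m)) (k : ℕ) :
    ExactPMInstance where
  n := vertexCount m N b
  G := SimpleGraph.fromEdgeSet (Set.range (edgePair b s t hm))
  R := (Finset.univ.filter (IsRed b N R B)).map ⟨edgePair b s t hm, edgePair_injective hm hst⟩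
  R_subset := by
    intro z hz
    obtain ⟨g, -, rfl⟩ := Finset.mem_map.1 hz
    rw [SimpleGraph.edgeSet_fromEdgeSet]
    refine ⟨⟨g, rfl⟩, ?_⟩
    simp [edgePair, ends_ne hm hst]
  k := k

theorem mem_edgeSet_graphInstance (hst : ∀ e, s e ≠ t e) {k : ℕ}
    (z : Sym2 (Fin (vertexCount m N b))) :
    z ∈ (graphInstance hm hst b R B k).G.edgeSet ↔ ∃ g, edgePair b s t hm g = z := by
  simp only [graphInstance, SimpleGraph.edgeSet_fromEdgeSet]
  refine ⟨fun h => h.1, ?_⟩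
  rintro ⟨g, rfl⟩
  refine ⟨⟨g, rfl⟩, ?_⟩
  simp [edgePair, ends_ne hm hst]

theorem edgePair_mem_R (hst : ∀ e, s e ≠ t e) {k : ℕ} (g : Edge m N b) :
    edgePair b s t hm g ∈ (graphInstance hm hst b R B k).R ↔ IsRed b N R B g := by
  refine (Finset.mem_map' ⟨edgePair b s t hm, edgePair_injective hm hst⟩).trans ?_
  simp

/-- The code of the graph. -/
def graphCode (b : Fin n → ℕ) (s t : Fin m → Fin n) (hm : m < N) (colour : Fin m → Letter) (k : ℕ) :
    List Letter :=
  List.replicate (vertexCount m N b) .vertex ++ (allEdges m N b).flatMap (codeOf s t hm colour) ++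
    numeral .target k

theorem outputText_eq (hst : ∀ e, s e ≠ t e) (hn : n ≤ N) (colour : Fin m → Letter) (k l : ℕ) :
    Routine.outputText N ((List.finRange n).map b)
      ((List.finRange m).map fun e => (colour e, (s e : ℕ), (t e : ℕ))) k l =
    graphCode b s t hm colour (min k N + (N + 1) * min l N) := by
  have hextra : extraCount N ((List.finRange n).map b) = ∑ v, (N - b v) := by
    rw [extraCount, List.map_map, ← List.ofFn_eq_map, List.sum_ofFn]
    rfl
  rw [Routine.outputText, graphText_eq hm hst hn, graphCode, Routine.totalCount, hextra,
    List.length_map, List.length_map, List.length_finRange, List.length_finRange, vertexCount]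
  rw [show N * n + ∑ v, (N - b v) + 2 * N * m = n * N + (∑ v, (N - b v) + m * (2 * N)) by ring]

variable {colour : Fin m → Letter}

theorem edgeColour_eq (hRB : Disjoint R B)
    (hc : ∀ e, colour e = if e ∈ R then .red else if e ∈ B then .blue else .plain)
    (g : Edge m N b) : edgeColour colour g = if IsRed b N R B g then .red else .plain := by
  rcases g with g | ⟨e, i⟩
  · rfl
  · have h : e ∈ R → e ∉ B := fun h => Finset.disjoint_left.1 hRB h
    by_cases h1 : Even (i : ℕ) <;> by_cases h2 : (i : ℕ) = 2 * N <;> by_cases h3 : e ∈ R <;>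
      by_cases h4 : e ∈ B <;>
      simp_all [edgeColour, IsRed, Letter.pathColour, Letter.lastColour]

theorem isEncodedBy_graphCode (hst : ∀ e, s e ≠ t e) (hRB : Disjoint R B)
    (hc : ∀ e, colour e = if e ∈ R then .red else if e ∈ B then .blue else .plain) (k : ℕ) :
    (graphInstance hm hst b R B k).IsEncodedBy (graphCode b s t hm colour k) := by
  rw [ExactPMInstance.isEncodedBy_iff]
  let pair (g : Edge m N b) : Fin (graphInstance hm hst b R B k).n ×
      Fin (graphInstance hm hst b R B k).n := (name m N b (ends b s t hm g).1, name m N b (ends b s t hm g).2)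
  have hpair : ((allEdges m N b).map pair).map (fun p => s(p.1, p.2)) =
      (allEdges m N b).map (edgePair b s t hm) := by
    rw [List.map_map]
    rfl
  refine ⟨(allEdges m N b).map pair, ?_, ?_, ?_⟩
  · exact hpair ▸ nodup_allEdges.map (edgePair_injective hm hst)
  · intro z
    refine Iff.trans ?_ (mem_edgeSet_graphInstance hm hst z).symm
    refine (iff_of_eq (congrArg (z ∈ ·) hpair)).trans ?_
    exact List.mem_map.trans (exists_congr fun g => and_iff_right (mem_allEdges g))
  · rw [graphCode, List.flatMap_map, List.flatMap_map]
    congr 3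
    funext g
    rw [codeOf, edgeColour_eq hRB hc, rawEdge, ExactPMInstance.rawEdge]
    have : s((pair g).1, (pair g).2) ∈ (graphInstance hm hst b R B k).R ↔ IsRed b N R B g :=
      edgePair_mem_R hm hst g
    by_cases h : IsRed b N R B g
    · rw [if_pos h, if_pos (this.2 h)]
    · rw [if_neg h, if_neg (mt this.1 h)]

theorem isYes_graphInstance (hst : ∀ e, s e ≠ t e) {k : ℕ} :
    (graphInstance hm hst b R B k).IsYes ↔
      ∃ S, IsPerfect b s t hm S ∧ (S.filter (IsRed b N R B)).card = k := by
  rw [ExactPMInstance.isYes_iff (φ := edgePair b s t hm) (edgePair_injective hm hst)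
    (mem_edgeSet_graphInstance hm hst) (edgePair_mem_R hm hst)]
  refine exists_congr fun S => and_comm.trans (and_congr_left' ?_)
  refine Iff.trans ?_ (forall_congr' fun x => by simp only [mem_edgePair] :
    (∀ x, ∃! g, g ∈ S ∧ name m N b x ∈ edgePair b s t hm g) ↔ IsPerfect b s t hm S)
  exact (name m N b).forall_congr_right.symm

theorem isBipartite_graphInstance (hst : ∀ e, s e ≠ t e) {k : ℕ} :
    (graphInstance hm hst b R B k).G.IsBipartite ↔ ∃ c : Vertex m N b → Bool,
      ∀ g : Edge m N b, c (ends b s t hm g).1 ≠ c (ends b s t hm g).2 := by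
  constructor
  · rintro ⟨C⟩
    refine ⟨fun x => decide (C (name m N b x) = 0), fun g h => ?_⟩
    have hadj : (graphInstance hm hst b R B k).G.Adj (name m N b (ends b s t hm g).1)
        (name m N b (ends b s t hm g).2) :=
      (SimpleGraph.mem_edgeSet _).1 ((mem_edgeSet_graphInstance hm hst _).2 ⟨g, rfl⟩)
    have h1 := C.valid hadj
    rw [decide_eq_decide] at h
    omega
  · rintro ⟨c, hc⟩
    refine (SimpleGraph.Coloring.mk (fun x => c ((name m N b).symm x)) ?_ :
      (graphInstance hm hst b R B k).G.Coloring Bool).colorable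
    intro x y hxy
    obtain ⟨g, hg⟩ := (mem_edgeSet_graphInstance hm hst _).1 ((SimpleGraph.mem_edgeSet _).2 hxy)
    have := hc g
    rcases Sym2.eq_iff.1 hg with ⟨rfl, rfl⟩ | ⟨rfl, rfl⟩
    · simpa using this
    · simpa using this.symm

theorem graphCode_mem_exactPM (hst : ∀ e, s e ≠ t e) (hRB : Disjoint R B)
    (hc : ∀ e, colour e = if e ∈ R then .red else if e ∈ B then .blue else .plain) (k l : ℕ) :
    graphCode b s t hm colour (min k N + (N + 1) * min l N) ∈ exactPM ↔
      ∃ M, IsBMatching b s t M ∧ (M ∩ R).card = k ∧ (M ∩ B).card = l := by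
  rw [← exists_isPerfect_iff hm hst hRB, ← isYes_graphInstance hm hst]
  have h := isEncodedBy_graphCode (b := b) hm hst hRB hc (min k N + (N + 1) * min l N)
  constructor
  · rintro ⟨I, hI, hyes⟩
    rwa [← hI.unique h]
  · exact fun hyes => ⟨_, h, hyes⟩

/-- Bipartiteness of the graph alone need not pass to the multigraph, since a vertex with `N ≤ b v`
has no extra vertex to tie its ports together. The perfect matching of a yes-instance excludes this
case. -/
theorem graphCode_mem_exactBipartitePM (hst : ∀ e, s e ≠ t e) (hRB : Disjoint R B)
    (hc : ∀ e, colour e = if e ∈ R then .red else if e ∈ B then .blue else .plain) (k l : ℕ) :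
    graphCode b s t hm colour (min k N + (N + 1) * min l N) ∈ exactBipartitePM ↔
      (∃ side : Fin n → Bool, ∀ e, side (s e) ≠ side (t e)) ∧
        ∃ M, IsBMatching b s t M ∧ (M ∩ R).card = k ∧ (M ∩ B).card = l := by
  have h := isEncodedBy_graphCode (b := b) hm hst hRB hc (min k N + (N + 1) * min l N)
  rw [← exists_isPerfect_iff hm hst hRB]
  constructor
  · rintro ⟨I, hI, hbip, hyes⟩
    rw [hI.unique h] at hbip hyes
    rw [isYes_graphInstance] at hyes
    obtain ⟨S, hS, -⟩ := id hyes
    obtain ⟨c, hc'⟩ := (isBipartite_graphInstance hm hst).1 hbip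
    exact ⟨exists_side hm (hS.isBMatching hm).2 hc', hyes⟩
  · rintro ⟨⟨side, hside⟩, hyes⟩
    exact ⟨_, h, (isBipartite_graphInstance hm hst).2 (exists_colouring hm hside),
      (isYes_graphInstance hm hst).2 hyes⟩

end Gadget

/-! ### Correctness of the reduction -/

theorem blue_mem_edgesText {N n : ℕ} (hn : n ≤ N) : ∀ {es : List (Letter × ℕ × ℕ)} {j c : ℕ},
    (∃ e ∈ es, ¬ (e.2.1 < n ∧ e.2.2 < n ∧ e.2.1 ≠ e.2.2)) → .blue ∈ edgesText N n j c es
  | [], _, _, h => by simp at h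
  | (m, u, v) :: es, j, c, h => by
    rw [edgesText, List.mem_append, List.mem_append]
    obtain ⟨e, he, h⟩ := h
    rcases List.mem_cons.1 he with rfl | he
    · refine .inl (.inl ?_)
      -- As `n ≤ N`, an end that is at least `n` stays so after capping, and equal ends stay equal.
      rw [alarmText, if_neg, List.mem_singleton]
      dsimp only at h
      omega
    · exact .inr (blue_mem_edgesText hn ⟨e, he, h⟩)

theorem blue_mem_outputText {N : ℕ} {caps : List ℕ} {es : List (Letter × ℕ × ℕ)} {k l : ℕ}
    (hn : caps.length ≤ N)
    (h : ∃ e ∈ es, ¬ (e.2.1 < caps.length ∧ e.2.2 < caps.length ∧ e.2.1 ≠ e.2.2)) :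
    .blue ∈ Routine.outputText N caps es k l := by
  simp only [Routine.outputText, Routine.graphText, List.mem_append]
  exact .inl (.inr (.inr (blue_mem_edgesText hn h)))

theorem mem_exactPM_of_mem {x : List Letter} (h : x ∈ exactBipartitePM) : x ∈ exactPM := by
  obtain ⟨I, h1, -, h2⟩ := h
  exact ⟨I, h1, h2⟩

/-- Every code contains the mark of its target. -/
theorem nil_notMem_exactPM : [] ∉ exactPM := by
  rintro ⟨I, ⟨es, -, -, h⟩, -⟩
  have := congrArg List.length h
  simp [numeral] at this

theorem outputText_notMem_exactPM {N : ℕ} {caps : List ℕ} {es : List (Letter × ℕ × ℕ)} {k l : ℕ}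
    (hn : caps.length ≤ N)
    (h : ∃ e ∈ es, ¬ (e.2.1 < caps.length ∧ e.2.2 < caps.length ∧ e.2.1 ≠ e.2.2)) :
    Routine.outputText N caps es k l ∉ exactPM := by
  rintro ⟨I, hI, -⟩
  exact ExactPMInstance.blue_notMem hI (blue_mem_outputText hn h)

namespace ExactRedBlueInstance

variable {I : ExactRedBlueInstance}

/-- The colour of an edge. -/
def colour (I : ExactRedBlueInstance) (e : Fin I.m) : Letter :=
  if e ∈ I.R then .red else if e ∈ I.B then .blue else .plain

theorem isColour_colour (I : ExactRedBlueInstance) (e : Fin I.m) :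
    (I.colour e).isColour = true := by
  unfold colour
  split_ifs <;> rfl

theorem isEncodedBy_iff {x : List Letter} : I.IsEncodedBy x ↔
    ∃ ends : Fin I.m → Fin I.n × Fin I.n, (∀ e, I.G.IsLink e (ends e).1 (ends e).2) ∧
      x = inputText ((List.finRange I.n).map I.b)
        ((List.finRange I.m).map fun e => (I.colour e, ((ends e).1 : ℕ), ((ends e).2 : ℕ))) I.k I.l := by
  refine exists_congr fun ends => and_congr_right' ?_
  rw [inputText, List.flatMap_map, List.flatMap_map, List.append_assoc, List.append_assoc]
  rfl

theorem isYes_iff {ends : Fin I.m → Fin I.n × Fin I.n}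
    (h : ∀ e, I.G.IsLink e (ends e).1 (ends e).2) : I.IsYes ↔
      ∃ M, Gadget.IsBMatching I.b (fun e => (ends e).1) (fun e => (ends e).2) M ∧
        (M ∩ I.R).card = I.k ∧ (M ∩ I.B).card = I.l := by
  have hinc : ∀ e v, I.G.Inc e v ↔ (ends e).1 = v ∨ (ends e).2 = v := by
    intro e v
    refine ⟨fun hv => ?_, ?_⟩
    · obtain ⟨w, hw⟩ := hv
      exact (I.G.eq_or_eq_of_isLink_of_isLink hw (h e)).imp Eq.symm Eq.symm
    · rintro (rfl | rfl)
      · exact (h e).inc_left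
      · exact (h e).inc_right
  unfold IsYes
  refine exists_congr fun M => ?_
  have hv : ∀ v, {e | e ∈ M ∧ I.G.Inc e v}.ncard =
      (M.filter fun e => (ends e).1 = v ∨ (ends e).2 = v).card := by
    intro v
    rw [← Set.ncard_coe_finset]
    congr 1
    ext e
    simp [hinc]
  simp only [hv, Gadget.IsBMatching]
  tauto

theorem isBipartite_iff {ends : Fin I.m → Fin I.n × Fin I.n}
    (h : ∀ e, I.G.IsLink e (ends e).1 (ends e).2) : I.G.IsBipartite ↔
      ∃ side : Fin I.n → Bool, ∀ e, side (ends e).1 ≠ side (ends e).2 := by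
  refine exists_congr fun side => ⟨fun hs e => hs _ _ _ (h e), fun hs e u v huv => ?_⟩
  rcases (h e).isLink_iff.1 huv with ⟨rfl, rfl⟩ | ⟨rfl, rfl⟩
  · exact hs e
  · exact (hs e).symm

/-- The output is a yes-instance if and only if the input is one. -/
theorem outputText_mem_iff {ends : Fin I.m → Fin I.n × Fin I.n}
    (h : ∀ e, I.G.IsLink e (ends e).1 (ends e).2) {N : ℕ} (hm : I.m < N) (hn : I.n ≤ N) :
    (Routine.outputText N ((List.finRange I.n).map I.b)
      ((List.finRange I.m).map fun e => (I.colour e, ((ends e).1 : ℕ), ((ends e).2 : ℕ))) I.k I.l ∈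
        exactPM ↔ I.IsYes) ∧
    (Routine.outputText N ((List.finRange I.n).map I.b)
      ((List.finRange I.m).map fun e => (I.colour e, ((ends e).1 : ℕ), ((ends e).2 : ℕ))) I.k I.l ∈
        exactBipartitePM ↔ I.G.IsBipartite ∧ I.IsYes) := by
  have := I.loopless
  have hst : ∀ e, (ends e).1 ≠ (ends e).2 := fun e => (h e).ne
  rw [Gadget.outputText_eq (s := fun e => (ends e).1) (t := fun e => (ends e).2) hm hst hn I.colour,
    Gadget.graphCode_mem_exactPM (colour := I.colour) hm hst I.disjoint fun _ => rfl,
    Gadget.graphCode_mem_exactBipartitePM (colour := I.colour) hm hst I.disjoint fun _ => rfl, isYes_iff h,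
    isBipartite_iff h]
  exact ⟨Iff.rfl, Iff.rfl⟩

/-- The text of a multigraph encodes an instance. -/
theorem exists_isEncodedBy {caps : List ℕ} {es : List (Letter × ℕ × ℕ)} (k l : ℕ)
    (hes : ∀ e ∈ es, e.1.isColour = true)
    (h : ∀ e ∈ es, e.2.1 < caps.length ∧ e.2.2 < caps.length ∧ e.2.1 ≠ e.2.2) :
    ∃ I : ExactRedBlueInstance, I.IsEncodedBy (inputText caps es k l) := by
  classical
  have h' := fun e : Fin es.length => h _ (es.getElem_mem e.2)
  let ends (e : Fin es.length) : Fin caps.length × Fin caps.length :=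
    (⟨es[e].2.1, (h' e).1⟩, ⟨es[e].2.2, (h' e).2.1⟩)
  let I : ExactRedBlueInstance :=
    { n := caps.length
      m := es.length
      G :=
        { vertexSet := Set.univ
          IsLink := fun e u v => ends e = (u, v) ∨ ends e = (v, u)
          isLink_symm := fun e _ => ⟨fun u v huv => huv.symm⟩
          eq_or_eq_of_isLink_of_isLink := by
            intro e x y v w hxy hvw
            rcases hxy with h1 | h1 <;> rcases hvw with h2 | h2 <;> rw [h1] at h2 <;>
              simp only [Prod.mk.injEq] at h2 <;> tauto
          left_mem_of_isLink := fun _ _ _ _ => Set.mem_univ _ }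
      vertexSet_eq := rfl
      edgeSet_eq := Set.eq_univ_of_forall fun e => ⟨_, _, .inl rfl⟩
      loopless := ⟨fun e v hv => (h' e).2.2 (by
        have hv' : ends e = (v, v) := or_self_iff.1 hv
        have h1 : (ends e).1 = (ends e).2 := by rw [hv']
        exact congrArg Fin.val h1)⟩
      b := fun v => caps[v]
      R := Finset.univ.filter fun e => es[e].1 = .red
      B := Finset.univ.filter fun e => es[e].1 = .blue
      disjoint := Finset.disjoint_filter.2 fun e _ h1 h2 => by rw [h1] at h2; cases h2
      k := k
      l := l }
  refine ⟨I, isEncodedBy_iff.2 ⟨ends, fun e => .inl rfl, ?_⟩⟩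
  have h1 : (List.finRange I.n).map I.b = caps := List.ext_getElem (by simp [I]) (by simp [I])
  have h2 : ((List.finRange I.m).map fun e =>
      (I.colour e, ((ends e).1 : ℕ), ((ends e).2 : ℕ))) = es := by
    refine Eq.trans (List.map_congr_left fun e _ => ?_) (List.ext_getElem (l₁ := (List.finRange es.length).map fun e => es[e])
      (by simp) (by simp))
    have hc : I.colour e = es[e].1 := by
      have := hes _ (es.getElem_mem e.2)
      simp only [colour, I, Finset.mem_filter, Finset.mem_univ, true_and]
      change es[e].1.isColour = true at this
      revert this
      cases es[e].1 <;> simp [Letter.isColour]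
    rw [hc]
  rw [h1, h2]

end ExactRedBlueInstance

theorem mainTheorem10 :
    LogspaceManyOneReducible exactRedBlueBM exactPM ∧
      LogspaceManyOneReducible exactRedBlueBipartiteBM exactBipartitePM := by
  obtain ⟨f, hf, htext, hnil⟩ := exists_reduction
  have hI : ∀ (I : ExactRedBlueInstance) x, I.IsEncodedBy x →
      (f x ∈ exactPM ↔ I.IsYes) ∧ (f x ∈ exactBipartitePM ↔ I.G.IsBipartite ∧ I.IsYes) := by
    intro I x hx
    obtain ⟨ends, hends, rfl⟩ := ExactRedBlueInstance.isEncodedBy_iff.1 hx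
    have hl := Routine.length_inputText ((List.finRange I.n).map I.b)
      ((List.finRange I.m).map fun e => (I.colour e, ((ends e).1 : ℕ), ((ends e).2 : ℕ))) I.k I.l
    rw [htext _ _ _ _ (List.forall_mem_map.2 fun e _ => I.isColour_colour e)]
    simp only [List.length_map, List.length_finRange] at hl
    exact ExactRedBlueInstance.outputText_mem_iff hends (by omega) (by omega)
  -- A string that encodes no instance fails either in its syntax, with empty output, or at the ends
  -- of an edge, with an alarm letter in the output.
  have hx : ∀ x, f x ∈ exactPM → ∃ I : ExactRedBlueInstance, I.IsEncodedBy x := by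
    intro x hfx
    by_cases h : ∃ caps es k l, (∀ e ∈ es, e.1.isColour = true) ∧ x = inputText caps es k l
    · obtain ⟨caps, es, k, l, hes, rfl⟩ := h
      rw [htext _ _ _ _ hes] at hfx
      have hl := Routine.length_inputText caps es k l
      refine ExactRedBlueInstance.exists_isEncodedBy k l hes fun e he => ?_
      by_contra hbad
      exact outputText_notMem_exactPM (by omega) ⟨e, he, hbad⟩ hfx
    · rw [hnil x h] at hfx
      exact absurd hfx nil_notMem_exactPM
  refine ⟨⟨f, hf, fun x => ⟨?_, fun h => ?_⟩⟩, ⟨f, hf, fun x => ⟨?_, fun h => ?_⟩⟩⟩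
  · rintro ⟨I, h, hyes⟩
    exact (hI I x h).1.2 hyes
  · obtain ⟨I, hIx⟩ := hx x h
    exact ⟨I, hIx, (hI I x hIx).1.1 h⟩
  · rintro ⟨I, h, hyes⟩
    exact (hI I x h).2.2 hyes
  · obtain ⟨I, hIx⟩ := hx x (mem_exactPM_of_mem h)
    exact ⟨I, hIx, (hI I x hIx).2.1 h⟩
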